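/- Let $0<m<1$, $\nu>0$, and let $h:\mathbb{R}\to[0,\infty)$ be a probability density with $h(x)=0$ for $x<0$ that has a nonincreasing representative on $(0,\infty)$. Put $\check h(x)=h(-x)$, $$\rho_h(x)=\frac{h(|x|)-m(h*\check h)(x)}{2-m},\qquad p_n=\frac{(2n-2)!}{2^{2n-1}\,n!\,(n-1)!}\,\frac{[m(2-m)]^n}{m}\quad(n\ge 1).$$ Let $Y=\sum_{k=1}^{K}Y_k$, where $Y_1,Y_2,\dots$ are i.i.d. with density $\rho_h$, and $K$ is independent of them with $\mathbb{P}(K=n)=p_n$. Then $Y$ has an even probability density $\varphi_h$ on $\mathbb{R}$. Let $N$ be the stationary Poisson branching-cluster process on $\mathbb{R}$ with immigrant rate $\nu$ and offspring density $m\varphi_h$: immigrants form a homogeneous Poisson process of rate $\nu$; independently of the immigrants, each individual (immigrant or descendant) independently has a Poisson number of children with mean $m$, each displaced from its parent by an independent amount with density $\varphi_h$; and $N$ consists of the positions of all individuals. Let $\alpha_n$ denote the $n$-th factorial moment measure of $N$ (the expected sum over ordered $n$-tuples of distinct points), and let $\kappa_3$ be its third factorial cumulant measure, $$\kappa_3=\alpha_3-\alpha_2^{01}\otimes\alpha_1^{2}-\alpha_2^{02}\otimes\alpha_1^{1}-\alpha_2^{12}\otimes\alpha_1^{0}+2\,\alpha_1\otimes\alpha_1\otimes\alpha_1,$$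 where superscripts list the coordinates on which a factor acts. Then $N$ is reversible (its law is invariant under $x\mapsto -x$), $\alpha_1,\alpha_2,\alpha_3$ are locally finite, and the reduced third factorial cumulant measure of $N$ has a density in $L^1(\mathbb{R}^2)$: there is $c_3\in L^1(\mathbb{R}^2)$ such that $$\int F\,d\kappa_3=\int_{\mathbb{R}}\int_{\mathbb{R}^2}F(t,t+\tau_1,t+\tau_2)\,c_3(\tau_1,\tau_2)\,d\tau_1\,d\tau_2\,dt$$ for every bounded, compactly supported Borel function $F:\mathbb{R}^3\to\mathbb{R}$. Consequently the factorial bispectrum $$B(\omega_1,\omega_2)=\iint_{\mathbb{R}^2} c_3(\tau_1,\tau_2)\,e^{-\mathrm{i}(\omega_1\tau_1+\omega_2\tau_2)}\,d\tau_1\,d\tau_2$$ exists, and $B(\omega_1,\omega_2)\in\mathbb{R}$ for all $(\omega_1,\omega_2)\in\mathbb{R}^2$. -/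

import Mathlib

open MeasureTheory ProbabilityTheory Set
open scoped ENNReal NNReal

noncomputable section

namespace BranchingMatch

/-! ### The symmetric offspring law -/

/-- `h` is a probability density on the line, vanishing on the negative half-line, which has a
nonincreasing representative on `(0, ∞)`. -/
structure IsMonotoneKernel (h : ℝ → ℝ) : Prop where
  measurable : Measurable h
  nonneg : ∀ x, 0 ≤ h x
  lintegral_eq_one : ∫⁻ x, ENNReal.ofReal (h x) = 1
  eq_zero_of_neg : ∀ x, x < 0 → h x = 0
  exists_antitone : ∃ g : ℝ → ℝ, AntitoneOn g (Ioi 0) ∧ h =ᵐ[volume.restrict (Ioi 0)] g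

/-- `ρ_h(x) = (h(|x|) - m (h * ȟ)(x)) / (2 - m)`, with `ȟ(x) = h(-x)`. -/
def rho (m : ℝ) (h : ℝ → ℝ) (x : ℝ) : ℝ :=
  (h |x| - m * convolution h (fun y => h (-y)) (ContinuousLinearMap.mul ℝ ℝ) volume x) / (2 - m)

/-- `p_n = (2n-2)! / (2^(2n-1) n! (n-1)!) * (m (2-m))^n / m`, to be used for `n ≥ 1`. -/
def matchProb (m : ℝ) (n : ℕ) : ℝ :=
  ((2 * n - 2).factorial : ℝ) / (2 ^ (2 * n - 1) * (n.factorial : ℝ) * ((n - 1).factorial : ℝ))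
    * ((m * (2 - m)) ^ n / m)

/-- The `n`-fold convolution power: the law of a sum of `n` independent variables of law `μ`. -/
def convPow (μ : Measure ℝ) : ℕ → Measure ℝ
  | 0 => Measure.dirac 0
  | n + 1 => (convPow μ n).conv μ

/-- The law of `Y = Y_1 + ⋯ + Y_K`, where the `Y_k` are i.i.d. with density `ρ_h`, and `K ≥ 1` is
independent of them with `P(K = n) = p_n`. -/
def randomSumLaw (m : ℝ) (h : ℝ → ℝ) : Measure ℝ :=
  Measure.sum fun n : ℕ => ENNReal.ofReal (matchProb m (n + 1)) •
    convPow (volume.withDensity fun x => ENNReal.ofReal (rho m h x)) (n + 1)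

/-- `φ` is an even probability density of the law `μ`. -/
structure IsEvenDensityOf (φ : ℝ → ℝ) (μ : Measure ℝ) : Prop where
  measurable : Measurable φ
  nonneg : ∀ x, 0 ≤ φ x
  lintegral_eq_one : ∫⁻ x, ENNReal.ofReal (φ x) = 1
  even : ∀ x, φ (-x) = φ x
  eq_withDensity : μ = volume.withDensity fun x => ENNReal.ofReal (φ x)

/-! ### Point processes with labelled points -/

/-- A random family of points on the line with labels in `ι`: the point labelled `a` is present at
the outcomes `ω ∈ present a`, and then sits at `pos a ω`. -/
structure PointFamily (Ω ι : Type*) where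
  present : ι → Set Ω
  pos : ι → Ω → ℝ

variable {Ω : Type*} {ι : Type*}

/-- The counting measure of the points present (with multiplicity, should positions coincide). -/
def PointFamily.counting (X : PointFamily Ω ι) (ω : Ω) : Measure ℝ :=
  Measure.sum fun a : ι => (X.present a).indicator (fun ω => Measure.dirac (X.pos a ω)) ω

/-- The random measure `∑^{≠} δ_{(x_0, …, x_{n-1})}` on `ℝⁿ`, the sum ranging over the ordered
tuples of distinct points (that is, points with distinct labels). -/
def PointFamily.factorialPower (X : PointFamily Ω ι) (n : ℕ) (ω : Ω) : Measure (Fin n → ℝ) :=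
  Measure.sum fun a : Fin n ↪ ι =>
    (⋂ k, X.present (a k)).indicator (fun ω => Measure.dirac fun k => X.pos (a k) ω) ω

/-- The `n`-th factorial moment measure `α_n(B) = E ∑^{≠} 1_B(x_0, …, x_{n-1})`. -/
def PointFamily.factorialMoment [MeasurableSpace Ω] (X : PointFamily Ω ι) (P : Measure Ω) (n : ℕ) :
    Measure (Fin n → ℝ) :=
  P.bind (X.factorialPower n)

/-- `∫ F dκ_3`, for the third factorial cumulant measure
`κ_3 = α_3 - α_2^{01} ⊗ α_1^2 - α_2^{02} ⊗ α_1^1 - α_2^{12} ⊗ α_1^0 + 2 α_1 ⊗ α_1 ⊗ α_1`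
(superscripts list the coordinates on which a factor acts). -/
def PointFamily.thirdFactorialCumulant [MeasurableSpace Ω] (X : PointFamily Ω ι) (P : Measure Ω)
    (F : (Fin 3 → ℝ) → ℝ) : ℝ :=
  (∫ t, F t ∂(X.factorialMoment P 3))
    - (∫ y, ∫ x, F ![x 0, x 1, y 0] ∂(X.factorialMoment P 2) ∂(X.factorialMoment P 1))
    - (∫ y, ∫ x, F ![x 0, y 0, x 1] ∂(X.factorialMoment P 2) ∂(X.factorialMoment P 1))
    - (∫ y, ∫ x, F ![y 0, x 0, x 1] ∂(X.factorialMoment P 2) ∂(X.factorialMoment P 1))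
    + 2 * ∫ x, ∫ y, ∫ z, F ![x 0, y 0, z 0]
        ∂(X.factorialMoment P 1) ∂(X.factorialMoment P 1) ∂(X.factorialMoment P 1)

/-- The reduced third factorial cumulant measure of the point process has the density
`c ∈ L¹(ℝ²)`: the factorial moment measures up to order three are locally finite, and
`∫ F dκ_3 = ∫ ∫ F(t, t + τ_1, t + τ_2) c(τ_1, τ_2) dτ dt` for all bounded, compactly supported
Borel functions `F`. -/
structure PointFamily.HasThirdCumulantDensity [MeasurableSpace Ω] (X : PointFamily Ω ι)
    (P : Measure Ω) (c : ℝ × ℝ → ℝ) : Prop where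
  locallyFinite_one : IsLocallyFiniteMeasure (X.factorialMoment P 1)
  locallyFinite_two : IsLocallyFiniteMeasure (X.factorialMoment P 2)
  locallyFinite_three : IsLocallyFiniteMeasure (X.factorialMoment P 3)
  integrable : Integrable c
  cumulant_eq : ∀ F : (Fin 3 → ℝ) → ℝ, Measurable F → (∃ M : ℝ, ∀ t, |F t| ≤ M) →
    HasCompactSupport F →
      X.thirdFactorialCumulant P F
        = ∫ t : ℝ, ∫ τ : ℝ × ℝ, F ![t, t + τ.1, t + τ.2] * c τ

/-- The factorial bispectrum
`B(ω_1, ω_2) = ∫∫ c(τ_1, τ_2) exp(-i (ω_1 τ_1 + ω_2 τ_2)) dτ_1 dτ_2`. -/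
def bispectrum (c : ℝ × ℝ → ℝ) (w₁ w₂ : ℝ) : ℂ :=
  ∫ τ : ℝ × ℝ, (c τ : ℂ) * Complex.exp (-Complex.I * ((w₁ * τ.1 + w₂ * τ.2 : ℝ) : ℂ))

/-- A random measure on the line is reversible if its law is invariant under `x ↦ -x`. -/
def IsReversible [MeasurableSpace Ω] (P : Measure Ω) (N : Ω → Measure ℝ) : Prop :=
  Measurable N ∧ P.map (fun ω => (N ω).map fun x => -x) = P.map N

/-! ### Poisson branching-cluster processes -/

/-- `I` is a Poisson process on the line with intensity measure `Λ`. -/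
structure IsPoissonProcess [MeasurableSpace Ω] (P : Measure Ω) (I : Ω → Measure ℝ)
    (Λ : Measure ℝ) : Prop where
  measurable : Measurable I
  count : ∀ A : Set ℝ, MeasurableSet A → Λ A ≠ ∞ →
    P.map (fun ω => I ω A) = (poissonMeasure (Λ A).toNNReal).map fun n : ℕ => (n : ℝ≥0∞)
  indep : ∀ (n : ℕ) (A : Fin n → Set ℝ), (∀ i, MeasurableSet (A i)) →
    Pairwise (fun i j => Disjoint (A i) (A j)) → iIndepFun (fun i ω => I ω (A i)) P

/-- The vertices of a genealogical tree are named by words: `[]` is the root and `i :: v` is the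
`i`-th child of `v`. If every `v` has `K v` children, numbered from `0`, then `InTree K v` says
that the vertex `v` occurs in the tree. -/
def InTree (K : List ℕ → ℕ) : List ℕ → Prop
  | [] => True
  | i :: v => i < K v ∧ InTree K v

/-- The position of a vertex relative to the root, if `D v` is the displacement of `v` from its
parent (`D []` is not used). -/
def treePos (D : List ℕ → ℝ) : List ℕ → ℝ
  | [] => 0
  | i :: v => treePos D v + D (i :: v)

/-- The points of a branching-cluster process: the vertex `v` of the cluster of the `j`-th
immigrant, which arrives at `U j`, has `K (j, v)` children and displacement `D (j, v)` from its
parent. -/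
def clusterPoints (U : ℕ → Ω → ℝ) (K : ℕ × List ℕ → Ω → ℕ) (D : ℕ × List ℕ → Ω → ℝ) :
    PointFamily Ω (ℕ × List ℕ) where
  present a := {ω | InTree (fun v => K (a.1, v) ω) a.2}
  pos a ω := U a.1 ω + treePos (fun v => D (a.1, v) ω) a.2

/-- The data `U, K, D` on the probability space `(Ω, P)` generate the stationary Poisson
branching-cluster process with immigrant rate `ν` and offspring density `m φ`: immigrants form a
homogeneous Poisson process of rate `ν`; independently of it, each individual has a Poisson number
of children with mean `m`, displaced from it by independent amounts with density `φ`. -/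
structure IsBranchingClusterProcess [MeasurableSpace Ω] (P : Measure Ω) (ν m : ℝ) (φ : ℝ → ℝ)
    (U : ℕ → Ω → ℝ) (K : ℕ × List ℕ → Ω → ℕ) (D : ℕ × List ℕ → Ω → ℝ) : Prop where
  measurable_U : ∀ j, Measurable (U j)
  measurable_K : ∀ a, Measurable (K a)
  measurable_D : ∀ a, Measurable (D a)
  immigrants : IsPoissonProcess P (fun ω => Measure.sum fun j => Measure.dirac (U j ω))
    (ENNReal.ofReal ν • volume)
  marks_law : ∀ a, P.map (fun ω => (K a ω, D a ω))
    = (poissonMeasure m.toNNReal).prod (volume.withDensity fun x => ENNReal.ofReal (φ x))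
  marks_indep : iIndepFun (fun a ω => (K a ω, D a ω)) P
  immigrants_indep_marks : IndepFun (fun ω j => U j ω) (fun ω a => (K a ω, D a ω)) P

end BranchingMatch

end

noncomputable section

namespace BranchingMatch

/-! ### Factorial moments of Poisson processes -/

/-! The real bispectrum and the reversibility use only that the displacement density `φ` is even and
that `m < 1`; the formula for `φ_h` matters only for its existence.

Cumulants. The factorial moment measures of the Poisson process of immigrants are the powers of `Λ =
ν dx` (`IsPoissonProcess.sum_map_embedding`), and clusters are i.i.d. and independent of the
immigrants. Sorting tuples of distinct points by which of them share an immigrant writes `α_n` as a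
sum over set partitions of the coordinates (`tsum_pattern_three`). By translation invariance each
block of size `k` contributes a measure on relative positions, integrated against `Λ`: for `k = 1`
the mean cluster size `M`, for `k = 2, 3` the measures `Q₂`, `Q₃` given by `relMeasure`. In `κ_3`
everything but the one-block term cancels (`cumulant_eq_of_moments`), so the reduced cumulant is `ν
Q₃`. This measure is finite because the total progeny of a subcritical Poisson tree has all moments
(`lintegral_clusterSize_pow_lt_top`). It has a density because resampling the displacement of the
deepest of three vertices smooths its position (`map_relPos_absolutelyContinuous`). It is invariant
under `τ ↦ -τ` because changing the sign of all displacements preserves the law of a cluster. Hence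
its Fourier transform is real.

Reversibility. Laplace functionals determine the law of a random measure (`ext_of_laplace`).
Integrating out the clusters turns the functional of `N` at `f` into that of the immigrants at `g =
-log E exp(-cluster sum of f)`. The latter depends on the intensity only, which is symmetric, and
reflecting `f` reflects `g`.

Existence of `φ_h`. Monotonicity of `h` gives `h * ȟ ≤ h` almost everywhere on `(0, ∞)`, so `ρ_h ≥
0` almost everywhere; its mass is `(2 - m) / (2 - m)`. The weights `p_n` are Catalan numbers times
powers of `m(2 - m)/4`, and the Catalan generating function gives total mass one. -/

lemma lintegral_descFactorial_poissonMeasure (r : ℝ≥0) (k : ℕ) :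
    ∫⁻ n, (n.descFactorial k : ℝ≥0∞) ∂(poissonMeasure r) = (r : ℝ≥0∞) ^ k := by
  have hterm : ∀ n : ℕ, ENNReal.ofReal (Real.exp (-r) * (r : ℝ) ^ (n + k) / ((n + k).factorial : ℝ))
      * ((n + k).descFactorial k : ℝ≥0∞)
      = (r : ℝ≥0∞) ^ k * ENNReal.ofReal (Real.exp (-r) * (r : ℝ) ^ n / (n.factorial : ℝ)) := by
    intro n
    have h1 : ((r : ℝ≥0∞) ^ k) = ENNReal.ofReal ((r : ℝ) ^ k) := by
      rw [ENNReal.ofReal_pow r.coe_nonneg, ENNReal.ofReal_coe_nnreal]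
    have h2 : (((n + k).descFactorial k : ℕ) : ℝ≥0∞)
        = ENNReal.ofReal ((n + k).descFactorial k : ℝ) := by simp
    rw [h1, h2, ← ENNReal.ofReal_mul (by positivity), ← ENNReal.ofReal_mul (by positivity)]
    congr 1
    have h3 : (n.factorial : ℝ) * ((n + k).descFactorial k : ℝ) = ((n + k).factorial : ℝ) := by
      have := Nat.factorial_mul_descFactorial (Nat.le_add_left k n)
      rw [Nat.add_sub_cancel] at this
      exact_mod_cast this
    have h4 : (n.factorial : ℝ) ≠ 0 := by positivity
    have h5 : ((n + k).factorial : ℝ) ≠ 0 := by positivity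
    field_simp
    rw [pow_add, ← h3]
    ring
  have hsum : ∑' n : ℕ, ENNReal.ofReal (Real.exp (-r) * (r : ℝ) ^ n / (n.factorial : ℝ)) = 1 := by
    rw [← ENNReal.ofReal_tsum_of_nonneg (fun n => by positivity)
      (hasSum_one_poissonMeasure r).summable, (hasSum_one_poissonMeasure r).tsum_eq]
    simp
  rw [poissonMeasure, lintegral_sum_measure]
  simp_rw [lintegral_smul_measure, lintegral_dirac, smul_eq_mul]
  -- The terms with `n < k` vanish; shifting the others by `k` leaves `r ^ k` times the total mass
  -- of the Poisson law.
  rw [← ENNReal.summable.sum_add_tsum_nat_add' (k := k)]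
  rw [Finset.sum_eq_zero, zero_add]
  · simp_rw [hterm]
    rw [ENNReal.tsum_mul_left, hsum, mul_one]
  · intro n hn
    rw [Nat.descFactorial_eq_zero_iff_lt.2 (Finset.mem_range.1 hn)]
    simp

/-! ### Counting tuples of distinct indices by colour -/

instance countable_embedding {n : ℕ} {α : Type*} [Countable α] : Countable (Fin n ↪ α) :=
  DFunLike.coe_injective.countable

/-- The number of embeddings whose values have prescribed colours. -/
lemma tsum_embedding_prod_indicator {α ι : Type*} [Fintype ι] [DecidableEq ι]
    (C : ι → Set α) (hC : Pairwise fun i j => Disjoint (C i) (C j)) (u : ℕ → α) (N : ι → ℕ)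
    (hN : ∀ c, ∑' j, (C c).indicator (fun _ => (1 : ℝ≥0∞)) (u j) = N c) :
    ∀ (n : ℕ) (f : Fin n → ι),
      ∑' a : Fin n ↪ ℕ, ∏ i, (C (f i)).indicator (fun _ => (1 : ℝ≥0∞)) (u (a i))
        = ∏ c, ((N c).descFactorial (Finset.univ.filter fun i => f i = c).card : ℝ≥0∞) := by
  intro n
  induction n with
  | zero =>
    intro f
    simp
  | succ n ih =>
    intro f
    -- The choices for one more index: of the `N (f 0)` indices of colour `f 0`, those already used
    -- by `e` are removed. By disjointness of the colours these are exactly the `e i` with `f i.succ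
    -- = f 0`. If some `e i` has a wrong colour, both sides vanish.
    have hinner : ∀ e : Fin n ↪ ℕ,
        ∑' j : {j // j ∉ Set.range e}, (C (f 0)).indicator (fun _ => (1 : ℝ≥0∞)) (u j) *
          ∏ i, (C (f i.succ)).indicator (fun _ => (1 : ℝ≥0∞)) (u (e i))
        = ((N (f 0) : ℝ≥0∞) - ((Finset.univ.filter fun i : Fin n => f i.succ = f 0).card : ℕ)) *
          ∏ i, (C (f i.succ)).indicator (fun _ => (1 : ℝ≥0∞)) (u (e i)) := by
      intro e
      rw [ENNReal.tsum_mul_right]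
      by_cases hp : ∃ i, u (e i) ∉ C (f i.succ)
      · obtain ⟨i, hi⟩ := hp
        rw [Finset.prod_eq_zero (Finset.mem_univ i) (by simp [hi])]
        simp
      · push Not at hp
        congr 1
        have hsplit := Summable.tsum_add_tsum_compl (s := Set.range e)
          (f := fun j : ℕ => (C (f 0)).indicator (fun _ => (1 : ℝ≥0∞)) (u j))
          ENNReal.summable ENNReal.summable
        have hr : ∑' j : Set.range e, (C (f 0)).indicator (fun _ => (1 : ℝ≥0∞)) (u j)
            = ((Finset.univ.filter fun i : Fin n => f i.succ = f 0).card : ℕ) := by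
          rw [tsum_range (fun j => (C (f 0)).indicator (fun _ => (1 : ℝ≥0∞)) (u j)) e.injective,
            tsum_fintype]
          rw [Finset.card_filter]
          push_cast
          refine Finset.sum_congr rfl fun i _ => ?_
          by_cases hfi : f i.succ = f 0
          · rw [if_pos hfi, Set.indicator_of_mem]
            rw [← hfi]; exact hp i
          · rw [if_neg hfi, Set.indicator_of_notMem]
            exact fun h => Set.disjoint_left.1 (hC hfi) (hp i) h
        rw [hr, hN] at hsplit
        rw [← hsplit, ENNReal.add_sub_cancel_left (ENNReal.natCast_ne_top _)]
        rfl
    rw [← (Equiv.embeddingFinSucc n ℕ).symm.tsum_eq]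
    simp_rw [Fin.prod_univ_succ, Equiv.coe_embeddingFinSucc_symm, Fin.cons_zero, Fin.cons_succ]
    rw [ENNReal.tsum_sigma']
    simp_rw [hinner]
    rw [ENNReal.tsum_mul_left, ih (fun i => f i.succ)]
    have key : ∀ g : ι → ℝ≥0∞, ∏ c, g c = g (f 0) * ∏ c ∈ Finset.univ.erase (f 0), g c :=
      fun g => (Finset.mul_prod_erase _ g (Finset.mem_univ _)).symm
    rw [key fun c => ((N c).descFactorial (Finset.univ.filter fun i => f i = c).card : ℝ≥0∞),
      key fun c => ((N c).descFactorial (Finset.univ.filter fun i : Fin n => f i.succ = c).card :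
        ℝ≥0∞), ← mul_assoc]
    have hcard : ∀ c, (Finset.univ.filter fun i : Fin (n + 1) => f i = c).card
        = (if f 0 = c then 1 else 0) + (Finset.univ.filter fun i : Fin n => f i.succ = c).card := by
      intro c
      rw [Finset.card_filter, Finset.card_filter, Fin.sum_univ_succ]
    congr 1
    -- The truncated subtraction of `ℝ≥0∞` agrees under the cast with that of `ℕ` in the descending
    -- factorial.
    · rw [hcard (f 0), if_pos rfl, add_comm 1, Nat.descFactorial_succ]
      push_cast
      rfl
    · refine Finset.prod_congr rfl fun c hc => ?_
      rw [hcard c, if_neg (Finset.ne_of_mem_erase hc).symm, zero_add]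

variable {Ω : Type*} [MeasurableSpace Ω] {P : Measure Ω}

lemma sum_dirac_apply (u : ℕ → ℝ) {A : Set ℝ} (hA : MeasurableSet A) :
    (Measure.sum fun j => Measure.dirac (u j)) A
      = ∑' j, A.indicator (fun _ => (1 : ℝ≥0∞)) (u j) := by
  rw [Measure.sum_apply _ hA]
  refine tsum_congr fun j => ?_
  rw [Measure.dirac_apply' _ hA]
  rfl

lemma IsPoissonProcess.lintegral_count {I : Ω → Measure ℝ} {Λ : Measure ℝ}
    (hI : IsPoissonProcess P I Λ) {A : Set ℝ} (hA : MeasurableSet A) (hΛ : Λ A ≠ ∞)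
    {g : ℝ≥0∞ → ℝ≥0∞} (hg : Measurable g) :
    ∫⁻ ω, g (I ω A) ∂P = ∫⁻ n, g (n : ℝ≥0∞) ∂(poissonMeasure (Λ A).toNNReal) := by
  rw [← lintegral_map (f := g) (g := fun ω => I ω A) hg
    ((Measure.measurable_coe hA).comp hI.measurable), hI.count A hA hΛ,
        lintegral_map hg (by fun_prop)]

lemma IsPoissonProcess.ae_count {I : Ω → Measure ℝ} {Λ : Measure ℝ}
    (hI : IsPoissonProcess P I Λ) {A : Set ℝ} (hA : MeasurableSet A) (hΛ : Λ A ≠ ∞) :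
    ∀ᵐ ω ∂P, ∃ n : ℕ, I ω A = n := by
  have hr : MeasurableSet (Set.range fun n : ℕ => (n : ℝ≥0∞)) := (countable_range _).measurableSet
  have h1 : P.map (fun ω => I ω A) (Set.range fun n : ℕ => (n : ℝ≥0∞))ᶜ = 0 := by
    rw [hI.count A hA hΛ, Measure.map_apply (by fun_prop) hr.compl]
    have : (fun n : ℕ => (n : ℝ≥0∞)) ⁻¹' (Set.range fun n : ℕ => (n : ℝ≥0∞))ᶜ = ∅ := by
      ext n; simp
    rw [this, measure_empty]
  have hm : Measurable fun ω => I ω A := (Measure.measurable_coe hA).comp hI.measurable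
  rw [Measure.map_apply hm hr.compl] at h1
  have h2 : ∀ᵐ ω ∂P, I ω A ∈ Set.range fun n : ℕ => (n : ℝ≥0∞) := by
    rw [ae_iff]
    exact h1
  filter_upwards [h2] with ω hω
  obtain ⟨n, hn⟩ := hω
  exact ⟨n, hn.symm⟩

lemma IsPoissonProcess.iIndepFun_fintype {I : Ω → Measure ℝ} {Λ : Measure ℝ}
    (hI : IsPoissonProcess P I Λ) {ι : Type*} [Fintype ι] (C : ι → Set ℝ)
    (hCm : ∀ c, MeasurableSet (C c)) (hC : Pairwise fun i j => Disjoint (C i) (C j)) :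
    iIndepFun (fun c ω => I ω (C c)) P := by
  have h := hI.indep (Fintype.card ι) (fun i => C ((Fintype.equivFin ι).symm i)) (fun i => hCm _)
    (fun i j hij => hC fun h => hij ((Fintype.equivFin ι).symm.injective h))
  exact iIndepFun.of_precomp (g := (Fintype.equivFin ι).symm) (Equiv.surjective _) h

/-- Almost surely the sum over embeddings is a product over colours of descending factorials of the
counts. Counts of disjoint sets are independent Poisson variables, whose factorial moments are
powers of their means. -/
lemma IsPoissonProcess.tsum_lintegral_colour {U : ℕ → Ω → ℝ} {Λ : Measure ℝ}
    (hU : ∀ j, Measurable (U j))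
    (hI : IsPoissonProcess P (fun ω => Measure.sum fun j => Measure.dirac (U j ω)) Λ)
    {ι : Type*} [Fintype ι] (C : ι → Set ℝ)
    (hCm : ∀ c, MeasurableSet (C c)) (hC : Pairwise fun i j => Disjoint (C i) (C j))
    (hΛ : ∀ c, Λ (C c) ≠ ∞) {n : ℕ} (f : Fin n → ι) :
    ∑' a : Fin n ↪ ℕ, ∫⁻ ω, ∏ i, (C (f i)).indicator (fun _ => (1 : ℝ≥0∞)) (U (a i) ω) ∂P
      = ∏ i, Λ (C (f i)) := by
  classical
  have hm : ∀ a : Fin n ↪ ℕ, Measurable fun ω =>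
      ∏ i, (C (f i)).indicator (fun _ => (1 : ℝ≥0∞)) (U (a i) ω) := fun a =>
    Finset.measurable_prod _ fun i _ => (measurable_const.indicator (hCm _)).comp (hU _)
  rw [← lintegral_tsum fun a => (hm a).aemeasurable]
  set k : ι → ℕ := fun c => (Finset.univ.filter fun i => f i = c).card with hk
  -- Counts are values of a measure; the floor recovers the natural number and makes the descending
  -- factorial a measurable function on all of `ℝ≥0∞`.
  set g : ι → ℝ≥0∞ → ℝ≥0∞ := fun c x => ((⌊x.toReal⌋₊).descFactorial (k c) : ℝ≥0∞) with hg
  have hgm : ∀ c, Measurable (g c) := fun c => by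
    have : Measurable fun n : ℕ => ((n.descFactorial (k c) : ℕ) : ℝ≥0∞) := by fun_prop
    exact this.comp (Nat.measurable_floor.comp ENNReal.measurable_toReal)
  have hae : ∀ᵐ ω ∂P, ∑' a : Fin n ↪ ℕ,
      ∏ i, (C (f i)).indicator (fun _ => (1 : ℝ≥0∞)) (U (a i) ω)
      = ∏ c, g c ((Measure.sum fun j => Measure.dirac (U j ω)) (C c)) := by
    have hall : ∀ᵐ ω ∂P, ∀ c, ∃ n : ℕ, (Measure.sum fun j => Measure.dirac (U j ω)) (C c) = n :=
      ae_all_iff.2 fun c => hI.ae_count (hCm c) (hΛ c)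
    filter_upwards [hall] with ω hω
    choose N hN using hω
    rw [tsum_embedding_prod_indicator C hC (fun j => U j ω) N
      (fun c => by rw [← hN c, sum_dirac_apply _ (hCm c)]) n f]
    refine Finset.prod_congr rfl fun c _ => ?_
    rw [hN c, hg]
    simp [hk]
  rw [lintegral_congr_ae hae]
  have hind := (hI.iIndepFun_fintype C hCm hC).comp g hgm
  have hprod := lintegral_prod_eq_prod_lintegral_of_indepFun Finset.univ
    (fun c ω => g c ((Measure.sum fun j => Measure.dirac (U j ω)) (C c))) hind
    (fun c => (hgm c).comp ((Measure.measurable_coe (hCm c)).comp hI.measurable))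
  rw [hprod]
  have hone : ∀ c, ∫⁻ ω, g c ((Measure.sum fun j => Measure.dirac (U j ω)) (C c)) ∂P
      = Λ (C c) ^ k c := by
    intro c
    rw [hI.lintegral_count (hCm c) (hΛ c) (hgm c)]
    simp only [hg, ENNReal.toReal_natCast, Nat.floor_natCast]
    rw [lintegral_descFactorial_poissonMeasure, ENNReal.coe_toNNReal (hΛ c)]
  simp_rw [hone, hk]
  rw [← Finset.prod_fiberwise Finset.univ f (fun i => Λ (C (f i)))]
  refine Finset.prod_congr rfl fun c _ => ?_
  rw [Finset.prod_congr rfl (g := fun _ => Λ (C c))]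
  · simp
  · intro i hi
    rw [(Finset.mem_filter.1 hi).2]

/-- The cell of those points which belong exactly to the sets `A i` with `s i`. -/
def cell {n : ℕ} (A : Fin n → Set ℝ) (s : Fin n → Bool) : Set ℝ :=
  {x | ∀ i, x ∈ A i ↔ s i = true}

lemma measurableSet_cell {n : ℕ} {A : Fin n → Set ℝ} (hA : ∀ i, MeasurableSet (A i))
    (s : Fin n → Bool) : MeasurableSet (cell A s) := by
  have : cell A s = ⋂ i, {x | x ∈ A i ↔ s i = true} := by
    ext x; simp [cell]
  rw [this]
  refine MeasurableSet.iInter fun i => ?_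
  exact (hA i).iff (MeasurableSet.const _)

lemma disjoint_cell {n : ℕ} (A : Fin n → Set ℝ) :
    Pairwise fun s t => Disjoint (cell A s) (cell A t) := by
  intro s t hst
  refine Set.disjoint_left.2 fun x hs ht => hst ?_
  funext i
  have := (hs i).symm.trans (ht i)
  exact Bool.eq_iff_iff.2 this

/-- The constantly false signature is left out because its cell, the complement of all `A i`, may
have infinite measure. Every other cell lies in some `A i`. -/
lemma indicator_eq_sum_cell {n : ℕ} (A : Fin n → Set ℝ) (i : Fin n) (x : ℝ) :
    (A i).indicator (fun _ => (1 : ℝ≥0∞)) x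
      = ∑ s : {s : Fin n → Bool // ∃ i, s i = true},
          if s.1 i = true then (cell A s.1).indicator (fun _ => (1 : ℝ≥0∞)) x else 0 := by
  classical
  by_cases hx : x ∈ A i
  · have hmem : x ∈ cell A fun i => decide (x ∈ A i) := fun i => by simp
    rw [Set.indicator_of_mem hx, Finset.sum_eq_single
      (⟨fun i => decide (x ∈ A i), ⟨i, by simp [hx]⟩⟩ : {s : Fin n → Bool // ∃ i, s i = true})]
    · rw [if_pos (by simpa using hx), Set.indicator_of_mem hmem]
    · intro s _ hs
      split_ifs with h
      · refine Set.indicator_of_notMem (fun h' => hs ?_) _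
        ext1
        funext i
        exact Bool.eq_iff_iff.2 (by simpa using (h' i).symm)
      · rfl
    · simp
  · rw [Set.indicator_of_notMem hx, Finset.sum_eq_zero]
    intro s _
    split_ifs with h
    · exact Set.indicator_of_notMem (fun h' => hx ((h' i).2 h)) _
    · rfl

/-- The factorial moment measures of a Poisson process are the powers of its intensity. -/
lemma IsPoissonProcess.sum_map_embedding {U : ℕ → Ω → ℝ} {Λ : Measure ℝ} [SigmaFinite Λ]
    (hU : ∀ j, Measurable (U j))
    (hI : IsPoissonProcess P (fun ω => Measure.sum fun j => Measure.dirac (U j ω)) Λ) (n : ℕ) :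
    (Measure.sum fun a : Fin n ↪ ℕ => P.map fun ω i => U (a i) ω)
      = Measure.pi fun _ : Fin n => Λ := by
  classical
  have hUm : ∀ a : Fin n ↪ ℕ, Measurable fun ω (i : Fin n) => U (a i) ω := fun a =>
    measurable_pi_lambda _ fun i => hU _
  refine (Measure.pi_eq_generateFrom (C := fun _ : Fin n => {A | MeasurableSet A ∧ Λ A < ∞})
    ?_ ?_ ?_ ?_).symm
  · intro i
    refine le_antisymm (MeasurableSpace.generateFrom_le fun A hA => hA.1) ?_
    intro A hA
    have : A = ⋃ k, A ∩ spanningSets Λ k := by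
      rw [← inter_iUnion, iUnion_spanningSets, inter_univ]
    rw [this]
    refine MeasurableSet.iUnion fun k => MeasurableSpace.measurableSet_generateFrom
      ⟨hA.inter (measurableSet_spanningSets Λ k), ?_⟩
    exact (measure_mono inter_subset_right).trans_lt (measure_spanningSets_lt_top Λ k)
  · intro i A hA B hB _
    exact ⟨hA.1.inter hB.1, (measure_mono inter_subset_left).trans_lt hA.2⟩
  · intro i
    exact ⟨spanningSets Λ, fun k => ⟨measurableSet_spanningSets Λ k,
      measure_spanningSets_lt_top Λ k⟩, fun k => measure_spanningSets_lt_top Λ k,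
      iUnion_spanningSets Λ⟩
  · intro A hA
    have hAm : ∀ i, MeasurableSet (A i) := fun i => (hA i).1
    rw [Measure.sum_apply _ (MeasurableSet.univ_pi hAm)]
    let S := {s : Fin n → Bool // ∃ i, s i = true}
    let C : S → Set ℝ := fun s => cell A s.1
    have hCm : ∀ s, MeasurableSet (C s) := fun s => measurableSet_cell hAm s.1
    have hCd : Pairwise fun s t => Disjoint (C s) (C t) := fun s t hst =>
      disjoint_cell A fun h => hst (Subtype.ext h)
    have hCf : ∀ s, Λ (C s) ≠ ∞ := fun s => by
      obtain ⟨i, hi⟩ := s.2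
      exact ((measure_mono fun x hx => (hx i).2 hi).trans_lt (hA i).2).ne
    -- The sides of a rectangle may overlap, whereas Poisson independence needs disjoint sets.
    -- Cutting each side into cells writes the rectangle as a sum of products of cells, any two of
    -- which are equal or disjoint.
    have h1 : ∀ a : Fin n ↪ ℕ, (P.map fun ω i => U (a i) ω) (univ.pi A)
        = ∑ f : Fin n → S, (if ∀ i, (f i).1 i = true then 1 else 0) *
          ∫⁻ ω, ∏ i, (C (f i)).indicator (fun _ => (1 : ℝ≥0∞)) (U (a i) ω) ∂P := by
      intro a
      rw [← lintegral_indicator_one (MeasurableSet.univ_pi hAm),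
        lintegral_map (measurable_one.indicator (MeasurableSet.univ_pi hAm)) (hUm a)]
      have : ∀ ω, (univ.pi A).indicator (1 : (Fin n → ℝ) → ℝ≥0∞) (fun i => U (a i) ω)
          = ∑ f : Fin n → S, (if ∀ i, (f i).1 i = true then 1 else 0) *
            ∏ i, (C (f i)).indicator (fun _ => (1 : ℝ≥0∞)) (U (a i) ω) := by
        intro ω
        have : (univ.pi A).indicator (1 : (Fin n → ℝ) → ℝ≥0∞) (fun i => U (a i) ω)
            = ∏ i, (A i).indicator (fun _ => (1 : ℝ≥0∞)) (U (a i) ω) := by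
          simp only [Set.indicator_apply, Finset.prod_ite_zero]
          simp
        rw [this]
        simp_rw [indicator_eq_sum_cell]
        rw [Finset.prod_univ_sum, Fintype.piFinset_univ]
        refine Finset.sum_congr rfl fun f _ => ?_
        rw [Finset.prod_ite_zero]
        simp [C]
      simp_rw [this]
      have hm : ∀ f : Fin n → S, Measurable fun ω =>
          ∏ i, (C (f i)).indicator (fun _ => (1 : ℝ≥0∞)) (U (a i) ω) := fun f =>
        Finset.measurable_prod _ fun i _ => (measurable_const.indicator (hCm _)).comp (hU _)
      rw [lintegral_finsetSum _ fun f _ => (hm f).const_mul _]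
      refine Finset.sum_congr rfl fun f _ => ?_
      rw [lintegral_const_mul _ (hm f)]
    simp_rw [h1]
    rw [Summable.tsum_finsetSum fun _ _ => ENNReal.summable]
    simp_rw [ENNReal.tsum_mul_left, hI.tsum_lintegral_colour hU C hCm hCd hCf]
    have h2 : ∀ i, Λ (A i) = ∑ s : S, if s.1 i = true then Λ (C s) else 0 := by
      intro i
      rw [← lintegral_indicator_one (hAm i)]
      have : ∀ x, (A i).indicator (1 : ℝ → ℝ≥0∞) x = ∑ s : S,
          (if s.1 i = true then 1 else 0) * (C s).indicator (fun _ => (1 : ℝ≥0∞)) x := by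
        intro x
        refine (indicator_eq_sum_cell A i x).trans (Finset.sum_congr rfl fun s _ => ?_)
        simp [C]
      simp_rw [this]
      rw [lintegral_finsetSum _ fun s _ => (measurable_const.indicator (hCm s)).const_mul _]
      refine Finset.sum_congr rfl fun s _ => ?_
      rw [lintegral_const_mul _ (measurable_const.indicator (hCm s))]
      have := lintegral_indicator_one (μ := Λ) (hCm s)
      rw [show (fun x => (C s).indicator (fun _ => (1 : ℝ≥0∞)) x) = (C s).indicator 1 from rfl,
          this]
      simp
    simp_rw [h2]
    rw [Finset.prod_univ_sum, Fintype.piFinset_univ]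
    refine Finset.sum_congr rfl fun f _ => ?_
    rw [Finset.prod_ite_zero]
    simp

/-! ### A single cluster -/

/-- The marks of a cluster: the number of children and the displacement of each vertex. -/
abbrev ClusterMarks := List ℕ → ℕ × ℝ

/-- The points of a cluster whose root sits at the origin. -/
def clusterFamily : PointFamily ClusterMarks (List ℕ) where
  present v := {k | InTree (fun w => (k w).1) v}
  pos v k := treePos (fun w => (k w).2) v

/-- The law of the marks of a cluster. -/
def clusterLaw (β : Measure (ℕ × ℝ)) : Measure ClusterMarks := Measure.infinitePi fun _ => β

instance (β : Measure (ℕ × ℝ)) [IsProbabilityMeasure β] : IsProbabilityMeasure (clusterLaw β) := by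
  unfold clusterLaw; infer_instance

lemma measurableSet_present_cluster (v : List ℕ) : MeasurableSet (clusterFamily.present v) := by
  induction v with
  | nil => simp [clusterFamily, InTree]
  | cons i v ih =>
    have : clusterFamily.present (i :: v)
        = {k : ClusterMarks | i < (k v).1} ∩ clusterFamily.present v := rfl
    rw [this]
    exact (measurableSet_lt measurable_const (measurable_pi_apply v).fst).inter ih

lemma measurable_pos_cluster (v : List ℕ) : Measurable (clusterFamily.pos v) := by
  induction v with
  | nil => exact measurable_const
  | cons i v ih =>
    have : clusterFamily.pos (i :: v)
        = fun k : ClusterMarks => clusterFamily.pos v k + (k (i :: v)).2 := rfl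
    rw [this]
    exact ih.add (measurable_pi_apply _).snd

/-- The indicator that a vertex occurs in the cluster. -/
def alive (v : List ℕ) (k : ClusterMarks) : ℝ≥0∞ :=
  (clusterFamily.present v).indicator (fun _ => 1) k

lemma measurable_alive (v : List ℕ) : Measurable (alive v) :=
  measurable_const.indicator (measurableSet_present_cluster v)

/-- The number of vertices of a cluster. -/
def clusterSize (k : ClusterMarks) : ℝ≥0∞ := ∑' v, alive v k

lemma measurable_clusterSize : Measurable clusterSize :=
  Measurable.tsum fun v => measurable_alive v

lemma alive_nil (k : ClusterMarks) : alive [] k = 1 := by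
  simp [alive, clusterFamily, InTree]

/-- A word reads from the vertex back towards the root, so its last letter names a child of the
root. Deleting that letter passes to the subtree of the child, which is the form needed for the
branching recursion. -/
lemma inTree_append_singleton (K : List ℕ → ℕ) (v : List ℕ) (i : ℕ) :
    InTree K (v ++ [i]) ↔ i < K [] ∧ InTree (fun w => K (w ++ [i])) v := by
  induction v with
  | nil => simp [InTree]
  | cons j v ih => simp only [List.cons_append, InTree, ih]; tauto

lemma alive_append_singleton (v : List ℕ) (i : ℕ) (k : ClusterMarks) :
    alive (v ++ [i]) k = if i < (k []).1 then alive v (fun w => k (w ++ [i])) else 0 := by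
  have h := inTree_append_singleton (fun w => (k w).1) v i
  by_cases h1 : k ∈ clusterFamily.present (v ++ [i])
  · have h2 := h.1 h1
    rw [alive, Set.indicator_of_mem h1, if_pos h2.1, alive, Set.indicator_of_mem]
    exact h2.2
  · rw [alive, Set.indicator_of_notMem h1]
    split_ifs with h2
    · rw [alive, Set.indicator_of_notMem]
      exact fun h3 => h1 (h.2 ⟨h2, h3⟩)
    · rfl

lemma tsum_option {α : Type*} (g : Option α → ℝ≥0∞) : ∑' o, g o = g none + ∑' a, g (some a) := by
  rw [← Summable.tsum_add_tsum_compl (s := Set.range (some : α → Option α)) (f := g)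
    ENNReal.summable ENNReal.summable, add_comm, Set.compl_range_some, tsum_singleton,
    tsum_range g (Option.some_injective α)]

lemma tsum_list_append_singleton (g : List ℕ → ℝ≥0∞) :
    ∑' v, g v = g [] + ∑' i : ℕ, ∑' v, g (v ++ [i]) := by
  let e : Option (ℕ × List ℕ) ≃ List ℕ :=
    { toFun := fun o => o.elim [] fun p => p.2 ++ [p.1]
      invFun := fun v => v.getLast?.map fun i => (i, v.dropLast)
      left_inv := by rintro (_ | ⟨i, v⟩) <;> simp
      right_inv := by
        intro v
        rcases List.eq_nil_or_concat v with rfl | ⟨w, i, rfl⟩ <;> simp }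
  rw [← e.tsum_eq, ← ENNReal.tsum_prod (f := fun i v => g (v ++ [i]))]
  rw [tsum_option]
  rfl

/-- The number of vertices of a cluster in the generations up to the `n`-th one. -/
def truncSize : ℕ → ClusterMarks → ℕ
  | 0, _ => 1
  | n + 1, k => 1 + ∑ i ∈ Finset.range (k []).1, truncSize n fun w => k (w ++ [i])

/-- Links the recursive count, suited to generating functions, with the sum over words that defines
`clusterSize`. -/
lemma truncSize_eq (n : ℕ) (k : ClusterMarks) :
    (truncSize n k : ℝ≥0∞) = ∑' v : List ℕ, if v.length ≤ n then alive v k else 0 := by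
  induction n generalizing k with
  | zero =>
    rw [tsum_eq_single []]
    · simp [truncSize, alive_nil]
    · intro v hv
      simp [hv]
  | succ n ih =>
    rw [tsum_list_append_singleton, truncSize]
    push_cast
    simp only [List.length_nil, Nat.zero_le, if_true, alive_nil, List.length_append,
      List.length_singleton, Nat.add_le_add_iff_right]
    congr 1
    simp_rw [ih]
    rw [tsum_eq_sum (s := Finset.range (k []).1)]
    · refine Finset.sum_congr rfl fun i hi => tsum_congr fun v => ?_
      rw [alive_append_singleton, if_pos (Finset.mem_range.1 hi)]
    · intro i hi
      rw [ENNReal.tsum_eq_zero]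
      intro v
      rw [alive_append_singleton, if_neg (fun h => hi (Finset.mem_range.2 h))]
      simp

lemma measurable_truncSize (n : ℕ) : Measurable (truncSize n) := by
  induction n with
  | zero => exact measurable_const
  | succ n ih =>
    -- The range of summation is random; treating the number of children as a separate countable
    -- variable makes it fixed.
    have hf : Measurable fun p : ℕ × ClusterMarks =>
        1 + ∑ i ∈ Finset.range p.1, truncSize n fun w => p.2 (w ++ [i]) := by
      refine measurable_from_prod_countable_right fun N => ?_
      have hi : ∀ i : ℕ, Measurable fun y : ClusterMarks => truncSize n fun w => y (w ++ [i]) :=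
        fun i => ih.comp (measurable_pi_lambda _ fun w => measurable_pi_apply _)
      exact measurable_const.add (Finset.measurable_sum (Finset.range N) fun i _ => hi i)
    exact hf.comp ((measurable_pi_apply ([] : List ℕ)).fst.prodMk measurable_id)

lemma tendsto_truncSize (k : ClusterMarks) :
    Filter.Tendsto (fun n => (truncSize n k : ℝ≥0∞)) Filter.atTop (nhds (clusterSize k)) := by
  have hmono : Monotone fun n => (truncSize n k : ℝ≥0∞) := by
    intro a b hab
    simp only [truncSize_eq]
    refine ENNReal.tsum_le_tsum fun v => ?_
    by_cases h : v.length ≤ a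
    · simp [h, h.trans hab]
    · simp [h]
  have hsup : ⨆ n, (truncSize n k : ℝ≥0∞) = clusterSize k := by
    refine le_antisymm (iSup_le fun n => ?_) ?_
    · rw [truncSize_eq]
      refine ENNReal.tsum_le_tsum fun v => ?_
      split_ifs <;> simp
    · rw [clusterSize, ENNReal.tsum_eq_iSup_sum]
      refine iSup_le fun s => ?_
      refine le_iSup_of_le (s.sup List.length) ?_
      rw [truncSize_eq]
      refine le_trans (Finset.sum_le_sum fun v hv => ?_) (ENNReal.sum_le_tsum s)
      rw [if_pos (Finset.le_sup (f := List.length) hv)]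
  rw [← hsup]
  exact tendsto_atTop_iSup hmono

/-- The marks of a tree with given marks of the root and of the subtrees at its children. -/
def assemble (ξ : Option ℕ → ClusterMarks) : ClusterMarks := fun v => ξ v.getLast? v.dropLast

/-- The map from a word to its last letter and remaining word is injective, so `assemble` reads each
i.i.d. coordinate at most once. Of the family `ξ none` only the root mark is read; `ξ (some i)`
becomes the subtree at child `i`. -/
lemma map_assemble (β : Measure (ℕ × ℝ)) [IsProbabilityMeasure β] :
    (Measure.infinitePi fun _ : Option ℕ => clusterLaw β).map assemble = clusterLaw β := by
  have hinj : Function.Injective fun v : List ℕ => (v.getLast?, v.dropLast) := by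
    intro v w h
    rcases List.eq_nil_or_concat v with rfl | ⟨v, i, rfl⟩ <;>
      rcases List.eq_nil_or_concat w with rfl | ⟨w, j, rfl⟩ <;> simp_all
  have h1 := Measure.map_infinitePi_infinitePi_of_inj
    (P := fun _ : Option ℕ × List ℕ => β) hinj
  have h2 := Measure.infinitePi_map_curry_symm (fun (_ : Option ℕ) (_ : List ℕ) => β)
  rw [← h2, Measure.map_map (by fun_prop) (MeasurableEquiv.measurable _)] at h1
  exact h1

lemma measurable_assemble : Measurable assemble :=
  measurable_pi_lambda _ fun _ => (measurable_pi_apply _).comp (measurable_pi_apply _)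

lemma lintegral_pow_poissonMeasure (r : ℝ≥0) (y : ℝ) (hy : 0 ≤ y) :
    ∫⁻ n, ENNReal.ofReal y ^ n ∂(poissonMeasure r) = ENNReal.ofReal (Real.exp (r * (y - 1))) := by
  rw [poissonMeasure, lintegral_sum_measure]
  simp_rw [lintegral_smul_measure, lintegral_dirac, smul_eq_mul]
  have hs : HasSum (fun n : ℕ => Real.exp (-r) * ((r * y) ^ n / (n.factorial : ℝ)))
      (Real.exp (r * (y - 1))) := by
    have h1 := (NormedSpace.expSeries_div_hasSum_exp (r * y : ℝ)).mul_left (Real.exp (-r))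
    rw [← Real.exp_eq_exp_ℝ, ← Real.exp_add] at h1
    convert h1 using 1
    congr 1
    ring_nf
  rw [← hs.tsum_eq, ENNReal.ofReal_tsum_of_nonneg (fun n => by positivity) hs.summable]
  refine tsum_congr fun n => ?_
  rw [← ENNReal.ofReal_pow hy, ← ENNReal.ofReal_mul (by positivity)]
  congr 1
  rw [mul_pow]
  ring

/-- The Galton–Watson recursion for generating functions: given the number of children of the root,
the subtrees are independent copies of the cluster one generation shorter. -/
lemma lintegral_pow_truncSize_succ {β : Measure (ℕ × ℝ)} [IsProbabilityMeasure β] {r : ℝ≥0}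
    (hβ : β.map Prod.fst = poissonMeasure r) (s : ℝ≥0∞) (n : ℕ) :
    ∫⁻ k, s ^ truncSize (n + 1) k ∂(clusterLaw β)
      = s * ∫⁻ N, (∫⁻ k, s ^ truncSize n k ∂(clusterLaw β)) ^ N ∂(poissonMeasure r) := by
  have hpow : Measurable fun n : ℕ => s ^ n := Measurable.of_discrete
  have hm : ∀ n, Measurable fun k => s ^ truncSize n k := fun n => hpow.comp
      (measurable_truncSize n)
  nth_rewrite 1 [← map_assemble β]
  rw [lintegral_map (hm _) measurable_assemble]
  set Q := Measure.infinitePi fun _ : Option ℕ => clusterLaw β with hQ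
  have hev : ∀ (o : Option ℕ) {g : ClusterMarks → ℝ≥0∞}, Measurable g →
      ∫⁻ ξ, g (ξ o) ∂Q = ∫⁻ k, g k ∂(clusterLaw β) := by
    intro o g hg
    rw [← lintegral_map hg (measurable_pi_apply o), hQ, Measure.infinitePi_map_eval]
  -- Decomposing over the number `N` of children replaces a product of random length by fixed finite
  -- products of independent factors.
  have hpt : ∀ ξ : Option ℕ → ClusterMarks, s ^ truncSize (n + 1) (assemble ξ)
      = ∑' N : ℕ, s * (({N} : Set ℕ).indicator (fun _ => 1) (ξ none []).1
          * ∏ i ∈ Finset.range N, s ^ truncSize n (ξ (some i))) := by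
    intro ξ
    rw [tsum_eq_single (ξ none []).1]
    · have h1 : (assemble ξ []) = ξ none [] := rfl
      have h2 : ∀ i, (fun w => assemble ξ (w ++ [i])) = ξ (some i) := by
        intro i; funext w; simp [assemble]
      rw [truncSize, pow_add, pow_one, ← Finset.prod_pow_eq_pow_sum, h1]
      simp [h2]
    · intro N hN
      rw [Set.indicator_of_notMem (fun h => hN (Set.mem_singleton_iff.1 h).symm)]
      simp
  simp_rw [hpt]
  have hmN : ∀ N : ℕ, Measurable fun ξ : Option ℕ → ClusterMarks =>
      (({N} : Set ℕ).indicator (fun _ => (1 : ℝ≥0∞)) (ξ none []).1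
          * ∏ i ∈ Finset.range N, s ^ truncSize n (ξ (some i))) := by
    intro N
    refine Measurable.mul ?_ (Finset.measurable_prod _ fun i _ => (hm n).comp
        (measurable_pi_apply _))
    exact (measurable_const.indicator (measurableSet_singleton N)).comp
      ((measurable_pi_apply _).comp (measurable_pi_apply _)).fst
  rw [lintegral_tsum fun N => ((hmN N).const_mul s).aemeasurable]
  rw [tsum_congr fun N => lintegral_const_mul s (hmN N)]
  rw [ENNReal.tsum_mul_left, lintegral_countable']
  congr 1
  refine tsum_congr fun N => ?_
  let X : Option ℕ → ClusterMarks → ℝ≥0∞ := fun o => o.elim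
    (fun k => ({N} : Set ℕ).indicator (fun _ => (1 : ℝ≥0∞)) (k []).1) fun _ k => s ^ truncSize n k
  have hX : ∀ o, Measurable (X o) := by
    rintro (_ | i)
    · exact (measurable_const.indicator (measurableSet_singleton N)).comp
        (measurable_pi_apply _).fst
    · exact hm n
  have hind : iIndepFun (fun o (ξ : Option ℕ → ClusterMarks) => X o (ξ o)) Q :=
    iIndepFun_infinitePi hX
  have hprod := lintegral_prod_eq_prod_lintegral_of_indepFun
    (Finset.insertNone (Finset.range N)) _ hind fun o => (hX o).comp (measurable_pi_apply o)
  simp only [Finset.prod_insertNone] at hprod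
  refine hprod.trans ?_
  rw [mul_comm]
  congr 1
  · simp_rw [fun i => hev (some i) (hX (some i))]
    simp [X]
  · rw [hev none (hX none), ← hβ, Measure.map_apply measurable_fst (measurableSet_singleton N)]
    have h1 : (clusterLaw β).map (fun k => k []) = β := Measure.infinitePi_map_eval _ _
    nth_rewrite 2 [← h1]
    have h2 : Measurable fun k : ClusterMarks => k [] := measurable_pi_apply _
    rw [Measure.map_apply h2 (measurable_fst (measurableSet_singleton N)),
        ← lintegral_indicator_one]
    · rfl
    · exact h2 (measurable_fst (measurableSet_singleton N))

/-- All moments of the size of a subcritical Poisson cluster are finite. -/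
lemma lintegral_clusterSize_pow_lt_top {β : Measure (ℕ × ℝ)} [IsProbabilityMeasure β] {r : ℝ≥0}
    (hβ : β.map Prod.fst = poissonMeasure r) (hr : r < 1) (p : ℕ) :
    ∫⁻ k, clusterSize k ^ p ∂(clusterLaw β) < ∞ := by
  set m : ℝ := (r : ℝ) with hm
  have hm0 : 0 ≤ m := r.coe_nonneg
  have hm1 : m < 1 := by exact_mod_cast hr
  -- The base `s` is chosen so that `1 + δ` is a fixed point of `y ↦ s * exp (m * (y - 1))`, the map
  -- of the recursion. For this small `δ` subcriticality gives `m * δ < 1 - m`, hence `s ≥ (1 + δ) *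
  -- (1 - m * δ) > 1`. The exponential moments of all truncated sizes then stay below `1 + δ`.
  set δ : ℝ := (1 - m) / 2 with hδ
  have hδ0 : 0 < δ := by rw [hδ]; linarith
  set s : ℝ := (1 + δ) * Real.exp (-(m * δ)) with hs
  have hs1 : 1 < s := by
    have h1 : 1 - m * δ ≤ Real.exp (-(m * δ)) := by
      have := Real.add_one_le_exp (-(m * δ)); linarith
    have h2 : 1 < (1 + δ) * (1 - m * δ) := by
      have : m * δ < 1 - m := by nlinarith
      nlinarith
    calc 1 < (1 + δ) * (1 - m * δ) := h2
      _ ≤ s := by rw [hs]; gcongr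
  have hbound : ∀ n, ∫⁻ k, ENNReal.ofReal s ^ truncSize n k ∂(clusterLaw β)
      ≤ ENNReal.ofReal (1 + δ) := by
    intro n
    induction n with
    | zero =>
      simp only [truncSize, pow_one, lintegral_const, measure_univ, mul_one]
      refine ENNReal.ofReal_le_ofReal ?_
      have : Real.exp (-(m * δ)) ≤ 1 := Real.exp_le_one_iff.2 (by nlinarith)
      rw [hs]
      nlinarith
    | succ n ih =>
      rw [lintegral_pow_truncSize_succ hβ]
      calc ENNReal.ofReal s * ∫⁻ N, (∫⁻ k, ENNReal.ofReal s ^ truncSize n k ∂(clusterLaw β)) ^ N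
            ∂(poissonMeasure r)
          ≤ ENNReal.ofReal s * ∫⁻ N, (ENNReal.ofReal (1 + δ)) ^ N ∂(poissonMeasure r) := by
            gcongr
        _ = ENNReal.ofReal s * ENNReal.ofReal (Real.exp (m * δ)) := by
            rw [lintegral_pow_poissonMeasure r (1 + δ) (by linarith)]
            congr 4
            ring
        _ = ENNReal.ofReal (1 + δ) := by
            rw [← ENNReal.ofReal_mul (by linarith), hs, mul_assoc, ← Real.exp_add]
            simp
  -- Powers are dominated by the exponential, `n ^ p ≤ C * s ^ n`; Fatou's lemma passes the uniform
  -- bound from truncated sizes to the full cluster.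
  obtain ⟨C, hC⟩ := (tendsto_pow_const_div_const_pow_of_one_lt p hs1).bddAbove_range
  have hCn : ∀ n : ℕ, (n : ℝ) ^ p ≤ C * s ^ n := by
    intro n
    have := hC ⟨n, rfl⟩
    rwa [div_le_iff₀ (by positivity)] at this
  have hC0 : 0 ≤ C := by
    have h1 : (1 : ℝ) ≤ C * s := by simpa using hCn 1
    exact nonneg_of_mul_nonneg_left (zero_le_one.trans h1) (by linarith)
  have hpn : ∀ n k, (truncSize n k : ℝ≥0∞) ^ p
      ≤ ENNReal.ofReal C * ENNReal.ofReal s ^ truncSize n k := by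
    intro n k
    rw [← ENNReal.ofReal_pow (by linarith), ← ENNReal.ofReal_mul hC0, ← ENNReal.ofReal_natCast,
      ← ENNReal.ofReal_pow (Nat.cast_nonneg _)]
    exact ENNReal.ofReal_le_ofReal (hCn _)
  have hpow : Measurable fun n : ℕ => ENNReal.ofReal s ^ n := Measurable.of_discrete
  have hmeas : ∀ n, Measurable fun k => (truncSize n k : ℝ≥0∞) ^ p := fun n =>
    ((Measurable.of_discrete (f := fun n : ℕ => (n : ℝ≥0∞))).comp
        (measurable_truncSize n)).pow_const p
  have hlim : ∀ k, Filter.liminf (fun n => (truncSize n k : ℝ≥0∞) ^ p) Filter.atTop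
      = clusterSize k ^ p := fun k =>
    (((ENNReal.continuous_pow p).tendsto _).comp (tendsto_truncSize k)).liminf_eq
  calc ∫⁻ k, clusterSize k ^ p ∂(clusterLaw β)
      = ∫⁻ k, Filter.liminf (fun n => (truncSize n k : ℝ≥0∞) ^ p) Filter.atTop ∂(clusterLaw β) := by
        simp_rw [hlim]
    _ ≤ Filter.liminf (fun n => ∫⁻ k, (truncSize n k : ℝ≥0∞) ^ p ∂(clusterLaw β)) Filter.atTop :=
        lintegral_liminf_le hmeas
    _ ≤ Filter.liminf (fun _ : ℕ => ENNReal.ofReal C * ENNReal.ofReal (1 + δ)) Filter.atTop := by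
        refine Filter.liminf_le_liminf (Filter.Eventually.of_forall fun n => ?_)
        calc ∫⁻ k, (truncSize n k : ℝ≥0∞) ^ p ∂(clusterLaw β)
            ≤ ∫⁻ k, ENNReal.ofReal C * ENNReal.ofReal s ^ truncSize n k ∂(clusterLaw β) :=
              lintegral_mono fun k => hpn n k
          _ = ENNReal.ofReal C * ∫⁻ k, ENNReal.ofReal s ^ truncSize n k ∂(clusterLaw β) :=
              lintegral_const_mul _ (hpow.comp (measurable_truncSize n))
          _ ≤ _ := by gcongr; exact hbound n
    _ < ∞ := by
        rw [Filter.liminf_const]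
        exact ENNReal.mul_lt_top ENNReal.ofReal_lt_top ENNReal.ofReal_lt_top

/-! ### Reflection of a cluster -/

/-- The marks of the reflected cluster. -/
def flipMarks (k : ClusterMarks) : ClusterMarks := fun v => ((k v).1, -(k v).2)

lemma measurable_flipMarks : Measurable flipMarks :=
  measurable_pi_lambda _ fun v => (measurable_pi_apply v).fst.prodMk (measurable_pi_apply v).snd.neg

lemma map_flipMarks {β : Measure (ℕ × ℝ)} [IsProbabilityMeasure β]
    (hβ : β.map (fun p => (p.1, -p.2)) = β) : (clusterLaw β).map flipMarks = clusterLaw β := by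
  have h := Measure.infinitePi_map_pi (fun _ : List ℕ => β)
    (f := fun _ p => (p.1, -p.2)) fun _ => measurable_fst.prodMk measurable_snd.neg
  simp only [hβ] at h
  exact h

lemma pos_flipMarks (v : List ℕ) (k : ClusterMarks) :
    clusterFamily.pos v (flipMarks k) = -clusterFamily.pos v k := by
  induction v with
  | nil => exact neg_zero.symm
  | cons i v ih =>
    change clusterFamily.pos v (flipMarks k) + -(k (i :: v)).2
      = -(clusterFamily.pos v k + (k (i :: v)).2)
    rw [ih]
    ring

lemma alive_flipMarks (v : List ℕ) (k : ClusterMarks) : alive v (flipMarks k) = alive v k := rfl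

/-! ### Absolute continuity of the displacements within a cluster -/

/-- The marks are independent, so replacing one of them by a fresh copy does not change the joint
law. On a cylinder, the old mark at `w` is unconstrained and the fresh one takes over its
constraint. -/
lemma map_update_clusterLaw (β : Measure (ℕ × ℝ)) [IsProbabilityMeasure β] (w : List ℕ) :
    ((clusterLaw β).prod β).map (fun p => Function.update p.1 w p.2) = clusterLaw β := by
  have hm : Measurable fun p : ClusterMarks × (ℕ × ℝ) => Function.update p.1 w p.2 := by
    refine measurable_pi_lambda _ fun v => ?_
    by_cases h : v = w
    · subst h; simpa using measurable_snd
    · simp only [Function.update_of_ne h]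
      exact (measurable_pi_apply v).comp measurable_fst
  refine Measure.eq_infinitePi _ fun s t ht => ?_
  rw [Measure.map_apply hm (MeasurableSet.pi s.countable_toSet fun i _ => ht i)]
  have hpre : (fun p : ClusterMarks × (ℕ × ℝ) => Function.update p.1 w p.2) ⁻¹' (s : Set _).pi t
      = ((s.erase w : Finset _) : Set (List ℕ)).pi t ×ˢ (if w ∈ s then t w else univ) := by
    ext ⟨k, x⟩
    simp only [Set.mem_preimage, Set.mem_pi, Set.mem_prod, Finset.mem_coe, Finset.mem_erase]
    constructor
    · intro h
      refine ⟨fun i hi => ?_, ?_⟩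
      · have := h i hi.2
        rwa [Function.update_of_ne hi.1] at this
      · split_ifs with hw
        · simpa using h w hw
        · trivial
    · rintro ⟨h1, h2⟩ i hi
      by_cases hiw : i = w
      · subst hiw
        rw [if_pos hi] at h2
        simpa using h2
      · rw [Function.update_of_ne hiw]
        exact h1 i ⟨hiw, hi⟩
  rw [hpre, Measure.prod_prod, clusterLaw, Measure.infinitePi_pi _ fun i _ => ht i]
  split_ifs with hw
  · rw [Finset.prod_erase_mul _ _ hw]
  · rw [measure_univ, mul_one, Finset.erase_eq_of_notMem hw]

lemma measurable_update_marks (w : List ℕ) :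
    Measurable fun p : ClusterMarks × (ℕ × ℝ) => Function.update p.1 w p.2 := by
  refine measurable_pi_lambda _ fun v => ?_
  by_cases h : v = w
  · subst h; simpa using measurable_snd
  · simp only [Function.update_of_ne h]
    exact (measurable_pi_apply v).comp measurable_fst

/-- Resampling the mark of one vertex. -/
lemma clusterLaw_eq_lintegral_update (β : Measure (ℕ × ℝ)) [IsProbabilityMeasure β]
    (w : List ℕ) {S : Set ClusterMarks} (hS : MeasurableSet S) :
    clusterLaw β S = ∫⁻ k, β {x | Function.update k w x ∈ S} ∂(clusterLaw β) := by
  nth_rewrite 1 [← map_update_clusterLaw β w]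
  rw [Measure.map_apply (measurable_update_marks w) hS,
    Measure.prod_apply (measurable_update_marks w hS)]
  rfl

/-- A position depends only on the marks of the vertex and its ancestors, which are suffixes of `v`;
a different word that is at least as long is none of them. -/
lemma pos_update_of_ne {v w : List ℕ} (h : v.length ≤ w.length) (hne : v ≠ w) (k : ClusterMarks)
    (x : ℕ × ℝ) : clusterFamily.pos v (Function.update k w x) = clusterFamily.pos v k := by
  induction v with
  | nil => rfl
  | cons i v ih =>
    change clusterFamily.pos v (Function.update k w x) + (Function.update k w x (i :: v)).2
      = clusterFamily.pos v k + (k (i :: v)).2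
    rw [Function.update_of_ne hne, ih (by simp at h; omega)
      (by rintro rfl; simp at h)]

lemma pos_update_cons (i : ℕ) (v : List ℕ) (k : ClusterMarks) (x : ℕ × ℝ) :
    clusterFamily.pos (i :: v) (Function.update k (i :: v) x) = clusterFamily.pos v k + x.2 := by
  change clusterFamily.pos v (Function.update k (i :: v) x)
    + (Function.update k (i :: v) x (i :: v)).2 = _
  rw [Function.update_self, pos_update_of_ne (by simp) (by simp)]

lemma measure_snd_add_mem_eq_zero {β : Measure (ℕ × ℝ)} (hβ : β.map Prod.snd ≪ volume) {N : Set ℝ}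
    (hN : MeasurableSet N) (h0 : volume N = 0) (y : ℝ) : β {x | y + x.2 ∈ N} = 0 := by
  have h1 : volume ((fun z => y + z) ⁻¹' N) = 0 := by
    rw [measure_preimage_add, h0]
  have h2 := hβ h1
  rwa [Measure.map_apply measurable_snd (measurable_const_add y hN)] at h2

/-- Resampling the displacement of the deeper vertex `b` leaves `c` in place and moves `b` by a
variable with a density. -/
lemma clusterLaw_pos_sub_mem_eq_zero {β : Measure (ℕ × ℝ)} [IsProbabilityMeasure β]
    (hβ : β.map Prod.snd ≪ volume) {b c : List ℕ} (hcb : c.length ≤ b.length) (hne : c ≠ b)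
    {N : Set ℝ} (hN : MeasurableSet N) (h0 : volume N = 0) :
    clusterLaw β {k | clusterFamily.pos b k - clusterFamily.pos c k ∈ N} = 0 := by
  have hm : MeasurableSet {k | clusterFamily.pos b k - clusterFamily.pos c k ∈ N} :=
    ((measurable_pos_cluster b).sub (measurable_pos_cluster c)) hN
  rw [clusterLaw_eq_lintegral_update β b hm, lintegral_eq_zero_iff' ?_]
  · refine Filter.Eventually.of_forall fun k => ?_
    rcases b with _ | ⟨i, b⟩
    · simp at hcb; exact absurd hcb hne
    · simp only [Set.mem_ofPred_eq, pos_update_of_ne hcb hne, pos_update_cons]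
      have := measure_snd_add_mem_eq_zero hβ hN h0
        (clusterFamily.pos b k - clusterFamily.pos c k)
      simpa only [sub_add_eq_add_sub, Pi.zero_apply] using this
  · exact (measurable_measure_prodMk_left (measurable_update_marks b hm)).aemeasurable

/-- The relative positions of three vertices of a cluster. -/
def relPos (v₀ v₁ v₂ : List ℕ) (k : ClusterMarks) : ℝ × ℝ :=
  (clusterFamily.pos v₁ k - clusterFamily.pos v₀ k, clusterFamily.pos v₂ k - clusterFamily.pos v₀ k)

lemma measurable_relPos (v₀ v₁ v₂ : List ℕ) : Measurable (relPos v₀ v₁ v₂) :=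
  ((measurable_pos_cluster v₁).sub (measurable_pos_cluster v₀)).prodMk
    ((measurable_pos_cluster v₂).sub (measurable_pos_cluster v₀))

/-- Two resamplings in order of depth: that of `b` makes the difference of `b` and `c` avoid a null
set of bad sections, then that of `a`, which moves neither `b` nor `c`, avoids the remaining null
section. -/
lemma map_relPos_absolutelyContinuous_of_length_le {β : Measure (ℕ × ℝ)} [IsProbabilityMeasure β]
    (hβ : β.map Prod.snd ≪ volume) {a b c : List ℕ} (hcb : c.length ≤ b.length)
    (hba : b.length ≤ a.length) (hc : c ≠ b) (hca : c ≠ a) (hb : b ≠ a) :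
    (clusterLaw β).map (relPos c a b) ≪ volume := by
  refine Measure.AbsolutelyContinuous.mk fun B hB h0 => ?_
  rw [Measure.map_apply (measurable_relPos _ _ _) hB]
  -- The second coordinates over which the null set `B` has a section of positive length; by Fubini
  -- there are almost none.
  set N : Set ℝ := {z | volume ((fun y => (y, z)) ⁻¹' B) ≠ 0} with hNdef
  have hsec : Measurable fun z : ℝ => volume ((fun y : ℝ => (y, z)) ⁻¹' B) :=
    measurable_measure_prodMk_right hB
  have hN : MeasurableSet N := hsec (measurableSet_singleton 0).compl
  have hN0 : volume N = 0 := by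
    rw [Measure.volume_eq_prod, Measure.prod_apply_symm hB, lintegral_eq_zero_iff hsec] at h0
    exact h0
  have hm := measurable_relPos c a b hB
  rw [clusterLaw_eq_lintegral_update β a hm, lintegral_eq_zero_iff' ?_]
  · have hae : ∀ᵐ k ∂(clusterLaw β), clusterFamily.pos b k - clusterFamily.pos c k ∉ N := by
      rw [ae_iff]
      simpa using clusterLaw_pos_sub_mem_eq_zero hβ hcb hc hN hN0
    filter_upwards [hae] with k hk
    rcases a with _ | ⟨i, a⟩
    · simp at hba; exact absurd hba hb
    · simp only [Set.mem_preimage, relPos, pos_update_of_ne hba hb,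
        pos_update_of_ne (hcb.trans hba) hca, pos_update_cons]
      have h1 : volume ((fun y => (y, clusterFamily.pos b k - clusterFamily.pos c k)) ⁻¹' B)
          = 0 := by
        by_contra h; exact hk h
      have := measure_snd_add_mem_eq_zero hβ (measurable_prodMk_right hB) h1
        (clusterFamily.pos a k - clusterFamily.pos c k)
      simpa only [sub_add_eq_add_sub, Pi.zero_apply, Set.mem_preimage] using this
  · exact (measurable_measure_prodMk_left (measurable_update_marks a hm)).aemeasurable

lemma map_relPos_swap_right {β : Measure (ℕ × ℝ)} {v₀ v₁ v₂ : List ℕ}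
    (h : (clusterLaw β).map (relPos v₀ v₁ v₂) ≪ volume) :
    (clusterLaw β).map (relPos v₀ v₂ v₁) ≪ volume := by
  have h1 : relPos v₀ v₂ v₁ = Prod.swap ∘ relPos v₀ v₁ v₂ := rfl
  rw [h1, ← Measure.map_map measurable_swap (measurable_relPos _ _ _)]
  refine (h.map measurable_swap).trans ?_
  rw [Measure.volume_eq_prod, Measure.prod_swap]

/-- Changing the reference vertex is the linear map `(x, y) ↦ (-x, y - x)`, whose preimages of null
sets are null. Together with the swap of the last two vertices this reduces to a triple ordered by
depth. -/
lemma map_relPos_swap_left {β : Measure (ℕ × ℝ)} {v₀ v₁ v₂ : List ℕ}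
    (h : (clusterLaw β).map (relPos v₀ v₁ v₂) ≪ volume) :
    (clusterLaw β).map (relPos v₁ v₀ v₂) ≪ volume := by
  have hT : Measurable fun p : ℝ × ℝ => (-p.1, p.2 - p.1) := by fun_prop
  have h1 : relPos v₁ v₀ v₂ = (fun p : ℝ × ℝ => (-p.1, p.2 - p.1)) ∘ relPos v₀ v₁ v₂ := by
    funext k
    simp [relPos]
  rw [h1, ← Measure.map_map hT (measurable_relPos _ _ _)]
  refine (h.map hT).trans ?_
  refine Measure.AbsolutelyContinuous.mk fun B hB h0 => ?_
  rw [Measure.map_apply hT hB, Measure.volume_eq_prod, Measure.measure_prod_null (hT hB)]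
  rw [Measure.volume_eq_prod, Measure.measure_prod_null hB] at h0
  have h2 := (Measure.measurePreserving_neg (volume : Measure ℝ)).quasiMeasurePreserving.ae h0
  filter_upwards [h2] with x hx
  have h3 : Prod.mk x ⁻¹' ((fun p : ℝ × ℝ => (-p.1, p.2 - p.1)) ⁻¹' B)
      = (fun y => y + -x) ⁻¹' (Prod.mk (-x) ⁻¹' B) := by
    ext y
    simp [sub_eq_add_neg]
  rw [h3, measure_preimage_add_right]
  exact hx

/-- The relative positions of three vertices of a cluster have a joint density. -/
lemma map_relPos_absolutelyContinuous {β : Measure (ℕ × ℝ)} [IsProbabilityMeasure β]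
    (hβ : β.map Prod.snd ≪ volume) {u v w : List ℕ} (huv : u ≠ v) (huw : u ≠ w) (hvw : v ≠ w) :
    (clusterLaw β).map (relPos u v w) ≪ volume := by
  have key : ∀ {a b c : List ℕ}, c.length ≤ b.length → b.length ≤ a.length → c ≠ b → c ≠ a →
      b ≠ a → (clusterLaw β).map (relPos c a b) ≪ volume :=
    fun h1 h2 h3 h4 h5 => map_relPos_absolutelyContinuous_of_length_le hβ h1 h2 h3 h4 h5
  have key' : ∀ {a b c : List ℕ}, c.length ≤ b.length → c.length ≤ a.length → c ≠ b → c ≠ a →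
      b ≠ a → (clusterLaw β).map (relPos c a b) ≪ volume := by
    intro a b c h1 h2 h3 h4 h5
    rcases le_total b.length a.length with h | h
    · exact key h1 h h3 h4 h5
    · exact map_relPos_swap_right (key h2 h h4 h3 h5.symm)
  rcases le_total u.length v.length with h1 | h1
  · rcases le_total u.length w.length with h2 | h2
    · exact key' h2 h1 huw huv hvw.symm
    · exact map_relPos_swap_right (map_relPos_swap_left
        (key' (h2.trans h1) h2 hvw.symm huw.symm huv.symm))
  · rcases le_total v.length w.length with h2 | h2
    · exact map_relPos_swap_left (key' h2 h1 hvw huv.symm huw.symm)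
    · exact map_relPos_swap_right (map_relPos_swap_left
        (key' h2 (h2.trans h1) hvw.symm huw.symm huv.symm))

/-! ### Sums over tuples of labels -/

lemma tsum_pi_prod {L : Type*} : ∀ (n : ℕ) (g : Fin n → L → ℝ≥0∞),
    ∑' V : Fin n → L, ∏ i, g i (V i) = ∏ i, ∑' v, g i v := by
  intro n
  induction n with
  | zero => intro g; simp
  | succ n ih =>
    intro g
    rw [← (Fin.consEquiv fun _ : Fin (n + 1) => L).tsum_eq, Fin.prod_univ_succ, ← ih,
      ← ENNReal.tsum_mul_right,
      ENNReal.tsum_prod' (f := fun c : L × (Fin n → L) =>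
        ∏ i, g i ((Fin.consEquiv fun _ : Fin (n + 1) => L) c i))]
    refine tsum_congr fun v => ?_
    rw [← ENNReal.tsum_mul_left]
    refine tsum_congr fun V => ?_
    rw [Fin.prod_univ_succ]
    rfl

open Classical in
lemma tsum_embedding {n : ℕ} {L : Type*} (g : (Fin n → L) → ℝ≥0∞) :
    ∑' a : Fin n ↪ L, g a = ∑' V : Fin n → L, if Function.Injective V then g V else 0 := by
  rw [← (Equiv.subtypeInjectiveEquivEmbedding (Fin n) L).tsum_eq]
  have h := tsum_subtype {V : Fin n → L | Function.Injective V} g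
  refine h.trans (tsum_congr fun V => ?_)
  rw [Set.indicator_apply]
  rfl

lemma tsum_pattern_one {L : Type*} (G : (Fin 1 → L) → ℝ≥0∞) :
    ∑' J, G J = ∑' b : Fin 1 ↪ L, G b := by
  classical
  rw [tsum_embedding]
  exact tsum_congr fun J => by rw [if_pos (Function.injective_of_subsingleton J)]

open Classical in
/-- Sums over tuples of the form `b ∘ p`, where `b` is injective and `p` is onto. -/
lemma tsum_embedding_comp {n r : ℕ} {L : Type*} {p : Fin n → Fin r} (hp : Function.Surjective p)
    (G : (Fin n → L) → ℝ≥0∞) :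
    ∑' b : Fin r ↪ L, G (b ∘ p)
      = ∑' J : Fin n → L, if ∀ i j, J i = J j ↔ p i = p j then G J else 0 := by
  have hinj : Function.Injective fun b : Fin r ↪ L => (b ∘ p : Fin n → L) := by
    intro b c h
    ext x
    obtain ⟨i, rfl⟩ := hp x
    exact congrFun h i
  have hr : Set.range (fun b : Fin r ↪ L => (b ∘ p : Fin n → L))
      = {J | ∀ i j, J i = J j ↔ p i = p j} := by
    ext J
    constructor
    · rintro ⟨b, rfl⟩ i j
      exact b.injective.eq_iff
    · intro hJ
      obtain ⟨s, hs⟩ := hp.hasRightInverse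
      refine ⟨⟨fun x => J (s x), fun x y hxy => ?_⟩, ?_⟩
      · rw [← hs x, ← hs y]
        exact (hJ _ _).1 hxy
      · funext i
        exact (hJ _ _).2 (hs _)
  rw [← tsum_range G hinj, hr, tsum_subtype]
  refine tsum_congr fun V => ?_
  rw [Set.indicator_apply]
  rfl

/-- Tuples are sorted by the partition of the coordinates into classes of equal values; an injective
choice of one value per class gives each tuple exactly once. -/
lemma tsum_pattern_two {L : Type*} (G : (Fin 2 → L) → ℝ≥0∞) :
    ∑' J, G J = ∑' b : Fin 1 ↪ L, G (b ∘ ![0, 0]) + ∑' b : Fin 2 ↪ L, G (b ∘ id) := by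
  classical
  rw [tsum_embedding_comp (by decide), tsum_embedding_comp (by decide), ← ENNReal.tsum_add]
  refine tsum_congr fun J => ?_
  simp only [Fin.forall_fin_two]
  by_cases h : J 0 = J 1
  · simp [h]
  · simp [h, Ne.symm h]

lemma forall_fin_three {Q : Fin 3 → Fin 3 → Prop} : (∀ i j, Q i j) ↔ (Q 0 0 ∧ Q 0 1 ∧ Q 0 2) ∧
    (Q 1 0 ∧ Q 1 1 ∧ Q 1 2) ∧ (Q 2 0 ∧ Q 2 1 ∧ Q 2 2) := by
  simp only [Fin.forall_fin_succ, IsEmpty.forall_iff, and_true]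
  rfl

/-- One summand for each of the five partitions of three coordinates; the vectors record the block
of each coordinate. With immigrants as labels, these become the terms of the moment–cumulant
formula. -/
lemma tsum_pattern_three {L : Type*} (G : (Fin 3 → L) → ℝ≥0∞) :
    ∑' J, G J = ∑' b : Fin 1 ↪ L, G (b ∘ ![0, 0, 0]) + ∑' b : Fin 2 ↪ L, G (b ∘ ![0, 0, 1])
      + ∑' b : Fin 2 ↪ L, G (b ∘ ![0, 1, 0]) + ∑' b : Fin 2 ↪ L, G (b ∘ ![1, 0, 0])
      + ∑' b : Fin 3 ↪ L, G (b ∘ id) := by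
  classical
  rw [tsum_embedding_comp (by decide), tsum_embedding_comp (by decide),
    tsum_embedding_comp (by decide), tsum_embedding_comp (by decide),
    tsum_embedding_comp (by decide), ← ENNReal.tsum_add, ← ENNReal.tsum_add, ← ENNReal.tsum_add,
    ← ENNReal.tsum_add]
  refine tsum_congr fun J => ?_
  simp only [forall_fin_three]
  by_cases h01 : J 0 = J 1 <;> by_cases h02 : J 0 = J 2 <;> by_cases h12 : J 1 = J 2
  · simp [h01, h12]
  · exact absurd (h01.symm.trans h02) h12
  · exact absurd (h01.trans h12) h02
  · simp [h01, h12, Ne.symm h12]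
  · exact absurd (h02.trans h12.symm) h01
  · simp [h02, h12, Ne.symm h12]
  · simp [h02, h12, Ne.symm h02]
  · simp [h01, h02, h12, Ne.symm h01, Ne.symm h02, Ne.symm h12]

/-! ### Factorial moment measures as sums over labels -/

section PointFamily
variable {Ω ι : Type*}

lemma lintegral_indicator_dirac {E : Type*} [MeasurableSpace E] (S : Set Ω) (f : Ω → E) (ω : Ω)
    {F : E → ℝ≥0∞} (hF : Measurable F) :
    ∫⁻ x, F x ∂(S.indicator (fun ω => Measure.dirac (f ω)) ω)
      = S.indicator (fun _ => 1) ω * F (f ω) := by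
  by_cases h : ω ∈ S
  · simp [h, lintegral_dirac' _ hF]
  · simp [h]

variable [MeasurableSpace Ω] [Countable ι]

lemma measurable_indicator_dirac {E : Type*} [MeasurableSpace E] {S : Set Ω} (hS : MeasurableSet S)
    {f : Ω → E} (hf : Measurable f) :
    Measurable fun ω => S.indicator (fun ω => Measure.dirac (f ω)) ω :=
  (Measure.measurable_dirac.comp hf).indicator hS

lemma measurable_measure_sum {E κ : Type*} [MeasurableSpace E] [Countable κ]
    {M : κ → Ω → Measure E} (hM : ∀ a, Measurable (M a)) :
    Measurable fun ω => Measure.sum fun a => M a ω := by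
  refine Measure.measurable_of_measurable_coe _ fun s hs => ?_
  simp only [Measure.sum_apply _ hs]
  exact Measurable.tsum fun a => (Measure.measurable_coe hs).comp (hM a)

lemma PointFamily.measurable_counting {X : PointFamily Ω ι}
    (hp : ∀ a, MeasurableSet (X.present a)) (hx : ∀ a, Measurable (X.pos a)) :
    Measurable X.counting :=
  measurable_measure_sum fun a => measurable_indicator_dirac (hp a) (hx a)

lemma PointFamily.measurable_factorialPower {X : PointFamily Ω ι}
    (hp : ∀ a, MeasurableSet (X.present a)) (hx : ∀ a, Measurable (X.pos a)) (n : ℕ) :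
    Measurable (X.factorialPower n) :=
  measurable_measure_sum fun a => measurable_indicator_dirac
    (MeasurableSet.iInter fun k => hp (a k)) (measurable_pi_lambda _ fun k => hx (a k))

lemma PointFamily.lintegral_factorialMoment {X : PointFamily Ω ι} (P : Measure Ω)
    (hp : ∀ a, MeasurableSet (X.present a)) (hx : ∀ a, Measurable (X.pos a)) (n : ℕ)
    {F : (Fin n → ℝ) → ℝ≥0∞} (hF : Measurable F) :
    ∫⁻ x, F x ∂(X.factorialMoment P n)
      = ∑' a : Fin n ↪ ι, ∫⁻ ω, (∏ i, (X.present (a i)).indicator (fun _ => 1) ω)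
          * F (fun i => X.pos (a i) ω) ∂P := by
  rw [PointFamily.factorialMoment, Measure.lintegral_bind
    (X.measurable_factorialPower hp hx n).aemeasurable hF.aemeasurable]
  simp only [PointFamily.factorialPower, lintegral_sum_measure]
  have hprod : ∀ (a : Fin n ↪ ι) ω, (⋂ k, X.present (a k)).indicator (fun _ => (1 : ℝ≥0∞)) ω
      = ∏ i, (X.present (a i)).indicator (fun _ => 1) ω := by
    intro a ω
    classical
    simp only [Set.indicator_apply, Finset.prod_ite_zero]
    simp
  simp_rw [lintegral_indicator_dirac _ _ _ hF, hprod]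
  rw [lintegral_tsum]
  intro a
  refine Measurable.aemeasurable (Measurable.mul ?_ ?_)
  · exact Finset.measurable_prod _ fun i _ => measurable_const.indicator (hp _)
  · exact hF.comp (measurable_pi_lambda _ fun i => hx _)

end PointFamily

/-! ### The joint law of the immigrants and of the clusters -/

/-- The law of the mark of an individual. -/
def markLaw (m : ℝ) (φ : ℝ → ℝ) : Measure (ℕ × ℝ) :=
  (poissonMeasure m.toNNReal).prod (volume.withDensity fun x => ENNReal.ofReal (φ x))

/-- The marks of the cluster of each immigrant. -/
def clusterMarks {Ω : Type*} (K : ℕ × List ℕ → Ω → ℕ) (D : ℕ × List ℕ → Ω → ℝ) (ω : Ω) :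
    ℕ → ClusterMarks := fun j v => (K (j, v) ω, D (j, v) ω)

section Joint
variable {Ω : Type*} [MeasurableSpace Ω] {P : Measure Ω} {ν m : ℝ}
  {φ : ℝ → ℝ} {U : ℕ → Ω → ℝ} {K : ℕ × List ℕ → Ω → ℕ} {D : ℕ × List ℕ → Ω → ℝ}

lemma IsBranchingClusterProcess.measurable_clusterMarks
    (hX : IsBranchingClusterProcess P ν m φ U K D) : Measurable (clusterMarks K D) :=
  measurable_pi_lambda _ fun _ => measurable_pi_lambda _ fun _ =>
    (hX.measurable_K _).prodMk (hX.measurable_D _)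

lemma IsBranchingClusterProcess.isProbabilityMeasure_markLaw [IsProbabilityMeasure P]
    (hX : IsBranchingClusterProcess P ν m φ U K D) : IsProbabilityMeasure (markLaw m φ) := by
  rw [markLaw, ← hX.marks_law (0, [])]
  exact Measure.isProbabilityMeasure_map
    ((hX.measurable_K _).prodMk (hX.measurable_D _)).aemeasurable

/-- Currying the i.i.d. family of marks along the pair (immigrant, vertex) gives an i.i.d. sequence
of clusters. -/
lemma IsBranchingClusterProcess.map_clusterMarks [IsProbabilityMeasure (markLaw m φ)]
    (hX : IsBranchingClusterProcess P ν m φ U K D) :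
    P.map (clusterMarks K D) = Measure.infinitePi fun _ : ℕ => clusterLaw (markLaw m φ) := by
  have hm : ∀ a, Measurable fun ω => (K a ω, D a ω) := fun a =>
    (hX.measurable_K a).prodMk (hX.measurable_D a)
  have h1 := hX.marks_indep.map_fun_eq_infinitePi_map hm
  have h2 : (fun a => P.map fun ω => (K a ω, D a ω)) = fun _ => markLaw m φ :=
    funext fun a => hX.marks_law a
  have h3 := Measure.infinitePi_map_curry (fun (_ : ℕ) (_ : List ℕ) => markLaw m φ)
  unfold clusterLaw
  rw [← h3]
  have h4 : (Measure.infinitePi fun _ : ℕ × List ℕ => markLaw m φ)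
      = P.map fun ω a => (K a ω, D a ω) := by
    rw [h1]
    congr 1
    funext a
    exact (hX.marks_law a).symm
  rw [h4, Measure.map_map (MeasurableEquiv.measurable _) (measurable_pi_lambda _ hm)]
  rfl

lemma IsBranchingClusterProcess.map_immigrants_clusterMarks [IsProbabilityMeasure P]
    [IsProbabilityMeasure (markLaw m φ)]
    (hX : IsBranchingClusterProcess P ν m φ U K D) :
    P.map (fun ω => ((fun j => U j ω), clusterMarks K D ω))
      = (P.map fun ω j => U j ω).prod
          (Measure.infinitePi fun _ : ℕ => clusterLaw (markLaw m φ)) := by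
  have hind : IndepFun (fun ω j => U j ω) (clusterMarks K D) P :=
    hX.immigrants_indep_marks.comp (φ := id)
      (ψ := fun (x : ℕ × List ℕ → ℕ × ℝ) (j : ℕ) (v : List ℕ) => x (j, v)) measurable_id
      (measurable_pi_lambda _ fun j => measurable_pi_lambda _ fun v => measurable_pi_apply _)
  rw [← hX.map_clusterMarks]
  exact (indepFun_iff_map_prod_eq_prod_map_map
    (measurable_pi_lambda _ hX.measurable_U).aemeasurable
    hX.measurable_clusterMarks.aemeasurable).1 hind

instance sigmaFinite_ofReal_smul_volume (ν : ℝ) :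
    SigmaFinite (ENNReal.ofReal ν • (volume : Measure ℝ)) :=
  inferInstanceAs (SigmaFinite (ν.toNNReal • (volume : Measure ℝ)))

/-- Sums over distinct immigrants together with their clusters. -/
lemma IsBranchingClusterProcess.tsum_lintegral_embedding [IsProbabilityMeasure P]
    [IsProbabilityMeasure (markLaw m φ)]
    (hX : IsBranchingClusterProcess P ν m φ U K D) (r : ℕ)
    {H : (Fin r → ℝ) → (Fin r → ClusterMarks) → ℝ≥0∞} (hH : Measurable (Function.uncurry H)) :
    ∑' b : Fin r ↪ ℕ, ∫⁻ ω, H (fun i => U (b i) ω) (fun i => clusterMarks K D ω (b i)) ∂P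
      = ∫⁻ u, ∫⁻ k, H u k ∂(Measure.pi fun _ : Fin r => clusterLaw (markLaw m φ))
          ∂(Measure.pi fun _ : Fin r => ENNReal.ofReal ν • (volume : Measure ℝ)) := by
  set G := Measure.pi fun _ : Fin r => clusterLaw (markLaw m φ) with hG
  have hUm : Measurable fun ω j => U j ω := measurable_pi_lambda _ hX.measurable_U
  rw [← hX.immigrants.sum_map_embedding hX.measurable_U r, lintegral_sum_measure]
  refine tsum_congr fun b => ?_
  have hb1 : Measurable fun (u : ℕ → ℝ) (i : Fin r) => u (b i) :=
    measurable_pi_lambda _ fun i => measurable_pi_apply _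
  have hb2 : Measurable fun (k : ℕ → ClusterMarks) (i : Fin r) => k (b i) :=
    measurable_pi_lambda _ fun i => measurable_pi_apply _
  have hbU : Measurable fun ω (i : Fin r) => U (b i) ω := hb1.comp hUm
  -- As `b` is injective, the selected clusters are `r` i.i.d. copies whatever `b` is. Only the
  -- positions of the immigrants depend on `b`, and their laws sum to a power of the intensity.
  have h1 : P.map (fun ω => ((fun i => U (b i) ω), fun i => clusterMarks K D ω (b i)))
      = (P.map fun ω (i : Fin r) => U (b i) ω).prod G := by
    have h2 := congrArg (Measure.map (Prod.map (fun (u : ℕ → ℝ) (i : Fin r) => u (b i))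
      (fun (k : ℕ → ClusterMarks) (i : Fin r) => k (b i)))) hX.map_immigrants_clusterMarks
    have := Measure.isProbabilityMeasure_map (μ := P) hUm.aemeasurable
    rw [Measure.map_map (hb1.prodMap hb2) (hUm.prodMk hX.measurable_clusterMarks),
      ← Measure.map_prod_map _ _ hb1 hb2, Measure.map_map hb1 hUm,
      Measure.map_infinitePi_infinitePi_of_inj (P := fun _ : ℕ => clusterLaw (markLaw m φ))
        b.injective, Measure.infinitePi_eq_pi] at h2
    exact h2
  have h3 : ∫⁻ ω, H (fun i => U (b i) ω) (fun i => clusterMarks K D ω (b i)) ∂P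
      = ∫⁻ p, Function.uncurry H p
          ∂(P.map (fun ω => ((fun i => U (b i) ω), fun i => clusterMarks K D ω (b i)))) := by
    have hpair : Measurable fun ω =>
        ((fun i => U (b i) ω), fun i => clusterMarks K D ω (b i)) :=
      hbU.prodMk (hb2.comp hX.measurable_clusterMarks)
    rw [lintegral_map hH hpair]
    rfl
  rw [h3, h1, lintegral_prod _ hH.aemeasurable]
  rfl

open Classical in
/-- The contribution to a factorial moment measure of the tuples of points whose immigrants follow
the pattern `p`. -/
def patternSum {n r : ℕ} (p : Fin n → Fin r) (F : (Fin n → ℝ) → ℝ≥0∞) (u : Fin r → ℝ)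
    (k : Fin r → ClusterMarks) : ℝ≥0∞ :=
  ∑' V : Fin n → List ℕ, if Function.Injective (fun i => (p i, V i)) then
    (∏ i, alive (V i) (k (p i))) * F (fun i => u (p i) + clusterFamily.pos (V i) (k (p i))) else 0

lemma measurable_patternSum_term {n r : ℕ} (p : Fin n → Fin r) {F : (Fin n → ℝ) → ℝ≥0∞}
    (hF : Measurable F) (V : Fin n → List ℕ) :
    Measurable fun x : (Fin r → ℝ) × (Fin r → ClusterMarks) => (∏ i, alive (V i) (x.2 (p i))) *
      F (fun i => x.1 (p i) + clusterFamily.pos (V i) (x.2 (p i))) := by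
  refine Measurable.mul (Finset.measurable_prod _ fun i _ => ?_) (hF.comp ?_)
  · exact (measurable_alive _).comp ((measurable_pi_apply _).comp measurable_snd)
  · refine measurable_pi_lambda _ fun i => Measurable.add ?_ ?_
    · exact (measurable_pi_apply _).comp measurable_fst
    · exact (measurable_pos_cluster _).comp ((measurable_pi_apply _).comp measurable_snd)

lemma measurable_patternSum {n r : ℕ} (p : Fin n → Fin r) {F : (Fin n → ℝ) → ℝ≥0∞}
    (hF : Measurable F) : Measurable (Function.uncurry (patternSum p F)) := by
  unfold patternSum Function.uncurry
  refine Measurable.tsum fun V => ?_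
  split_ifs
  · exact measurable_patternSum_term p hF V
  · exact measurable_const

/-- The contribution of the pattern `p` to the expectation. -/
def patternMoment (ν : ℝ) (β : Measure (ℕ × ℝ)) {n r : ℕ} (p : Fin n → Fin r)
    (F : (Fin n → ℝ) → ℝ≥0∞) : ℝ≥0∞ :=
  ∫⁻ u, ∫⁻ k, patternSum p F u k ∂(Measure.pi fun _ : Fin r => clusterLaw β)
    ∂(Measure.pi fun _ : Fin r => ENNReal.ofReal ν • (volume : Measure ℝ))

/-! ### Factorial moments sorted by the pattern of immigrants -/

lemma IsBranchingClusterProcess.measurableSet_present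
    (hX : IsBranchingClusterProcess P ν m φ U K D) (a : ℕ × List ℕ) :
    MeasurableSet ((clusterPoints U K D).present a) :=
  ((measurable_pi_apply a.1).comp hX.measurable_clusterMarks) (measurableSet_present_cluster a.2)

lemma IsBranchingClusterProcess.measurable_pos
    (hX : IsBranchingClusterProcess P ν m φ U K D) (a : ℕ × List ℕ) :
    Measurable ((clusterPoints U K D).pos a) :=
  (hX.measurable_U a.1).add ((measurable_pos_cluster a.2).comp
    ((measurable_pi_apply a.1).comp hX.measurable_clusterMarks))

-- A tuple of labels splits into a tuple `J` of immigrants and a tuple `V` of vertices. The sum over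
-- `J` is kept outside, ready to be sorted by coincidences.
open Classical in
lemma IsBranchingClusterProcess.lintegral_factorialMoment
    (hX : IsBranchingClusterProcess P ν m φ U K D) (n : ℕ)
    {F : (Fin n → ℝ) → ℝ≥0∞} (hF : Measurable F) :
    ∫⁻ x, F x ∂((clusterPoints U K D).factorialMoment P n)
      = ∑' J : Fin n → ℕ, ∫⁻ ω, ∑' V : Fin n → List ℕ,
          (if Function.Injective (fun i => (J i, V i)) then
            (∏ i, alive (V i) (clusterMarks K D ω (J i))) *
              F (fun i => U (J i) ω + clusterFamily.pos (V i) (clusterMarks K D ω (J i)))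
          else 0) ∂P := by
  have hterm : ∀ (J : Fin n → ℕ) (V : Fin n → List ℕ), Measurable fun ω =>
      (∏ i, alive (V i) (clusterMarks K D ω (J i))) *
        F (fun i => U (J i) ω + clusterFamily.pos (V i) (clusterMarks K D ω (J i))) := by
    intro J V
    have hc : ∀ i, Measurable fun ω => clusterMarks K D ω (J i) := fun i =>
      (measurable_pi_apply _).comp hX.measurable_clusterMarks
    refine Measurable.mul (Finset.measurable_prod _ fun i _ => (measurable_alive _).comp (hc i))
      (hF.comp (measurable_pi_lambda _ fun i => (hX.measurable_U _).add
        ((measurable_pos_cluster _).comp (hc i))))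
  rw [PointFamily.lintegral_factorialMoment P hX.measurableSet_present hX.measurable_pos n hF]
  rw [tsum_embedding fun a : Fin n → ℕ × List ℕ => ∫⁻ ω,
    (∏ i, ((clusterPoints U K D).present (a i)).indicator (fun _ => 1) ω)
      * F (fun i => (clusterPoints U K D).pos (a i) ω) ∂P]
  rw [← (Equiv.arrowProdEquivProdArrow (Fin n) (fun _ => ℕ) (fun _ => List ℕ)).symm.tsum_eq,
    ENNReal.tsum_prod']
  refine tsum_congr fun J => ?_
  rw [lintegral_tsum]
  · refine tsum_congr fun V => ?_
    simp only [Equiv.arrowProdEquivProdArrow, Equiv.coe_fn_symm_mk]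
    by_cases h : Function.Injective fun i => (J i, V i)
    · exact (if_pos h).trans (by simp only [if_pos h]; rfl)
    · exact (if_neg h).trans (by simp only [if_neg h]; simp)
  · intro V
    split_ifs
    · exact (hterm J V).aemeasurable
    · exact aemeasurable_const

lemma IsBranchingClusterProcess.tsum_pattern [IsProbabilityMeasure P]
    [IsProbabilityMeasure (markLaw m φ)]
    (hX : IsBranchingClusterProcess P ν m φ U K D) {n r : ℕ} (p : Fin n → Fin r)
    {F : (Fin n → ℝ) → ℝ≥0∞} (hF : Measurable F) :
    (∑' b : Fin r ↪ ℕ, ∫⁻ ω, patternSum p F (fun i => U (b i) ω)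
      (fun i => clusterMarks K D ω (b i)) ∂P) = patternMoment ν (markLaw m φ) p F :=
  hX.tsum_lintegral_embedding r (measurable_patternSum p hF)

-- Distinct blocks carry distinct immigrants, so whether the labels are distinct depends on the
-- pattern and the vertices but not on `b`.
open Classical in
lemma patternSum_comp_embedding {n r : ℕ} (p : Fin n → Fin r) (F : (Fin n → ℝ) → ℝ≥0∞)
    (b : Fin r ↪ ℕ) (u : ℕ → ℝ) (k : ℕ → ClusterMarks) :
    (∑' V : Fin n → List ℕ, if Function.Injective (fun i => ((b ∘ p) i, V i)) then
      (∏ i, alive (V i) (k ((b ∘ p) i))) *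
        F (fun i => u ((b ∘ p) i) + clusterFamily.pos (V i) (k ((b ∘ p) i))) else 0)
      = patternSum p F (fun i => u (b i)) (fun i => k (b i)) := by
  refine tsum_congr fun V => ?_
  have h : Function.Injective (fun i => ((b ∘ p) i, V i))
      ↔ Function.Injective (fun i => (p i, V i)) := by
    have hb : Function.Injective (Prod.map b (id : List ℕ → List ℕ)) :=
      b.injective.prodMap Function.injective_id
    exact hb.of_comp_iff (fun i => (p i, V i))
  simp only [h]
  rfl

lemma IsBranchingClusterProcess.lintegral_factorialMoment_one [IsProbabilityMeasure P]
    [IsProbabilityMeasure (markLaw m φ)]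
    (hX : IsBranchingClusterProcess P ν m φ U K D) {F : (Fin 1 → ℝ) → ℝ≥0∞} (hF : Measurable F) :
    ∫⁻ x, F x ∂((clusterPoints U K D).factorialMoment P 1)
      = patternMoment ν (markLaw m φ) id F := by
  rw [hX.lintegral_factorialMoment 1 hF, tsum_pattern_one, ← hX.tsum_pattern id hF]
  refine tsum_congr fun b => lintegral_congr fun ω => ?_
  exact patternSum_comp_embedding id F b (fun j => U j ω) (clusterMarks K D ω)

lemma IsBranchingClusterProcess.lintegral_factorialMoment_two [IsProbabilityMeasure P]
    [IsProbabilityMeasure (markLaw m φ)]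
    (hX : IsBranchingClusterProcess P ν m φ U K D) {F : (Fin 2 → ℝ) → ℝ≥0∞} (hF : Measurable F) :
    ∫⁻ x, F x ∂((clusterPoints U K D).factorialMoment P 2)
      = patternMoment ν (markLaw m φ) (![0, 0] : Fin 2 → Fin 1) F
        + patternMoment ν (markLaw m φ) id F := by
  rw [hX.lintegral_factorialMoment 2 hF, tsum_pattern_two, ← hX.tsum_pattern _ hF,
    ← hX.tsum_pattern _ hF]
  congr 1 <;> refine tsum_congr fun b => lintegral_congr fun ω => ?_
  all_goals exact patternSum_comp_embedding _ F b (fun j => U j ω) (clusterMarks K D ω)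

lemma IsBranchingClusterProcess.lintegral_factorialMoment_three [IsProbabilityMeasure P]
    [IsProbabilityMeasure (markLaw m φ)]
    (hX : IsBranchingClusterProcess P ν m φ U K D) {F : (Fin 3 → ℝ) → ℝ≥0∞} (hF : Measurable F) :
    ∫⁻ x, F x ∂((clusterPoints U K D).factorialMoment P 3)
      = patternMoment ν (markLaw m φ) (![0, 0, 0] : Fin 3 → Fin 1) F
        + patternMoment ν (markLaw m φ) (![0, 0, 1] : Fin 3 → Fin 2) F
        + patternMoment ν (markLaw m φ) (![0, 1, 0] : Fin 3 → Fin 2) F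
        + patternMoment ν (markLaw m φ) (![1, 0, 0] : Fin 3 → Fin 2) F
        + patternMoment ν (markLaw m φ) id F := by
  rw [hX.lintegral_factorialMoment 3 hF, tsum_pattern_three, ← hX.tsum_pattern _ hF,
    ← hX.tsum_pattern _ hF, ← hX.tsum_pattern _ hF, ← hX.tsum_pattern _ hF, ← hX.tsum_pattern _ hF]
  congr 1
  congr 1
  congr 1
  congr 1
  all_goals refine tsum_congr fun b => lintegral_congr fun ω => ?_
  all_goals exact patternSum_comp_embedding _ F b (fun j => U j ω) (clusterMarks K D ω)

end Joint

/-! ### Integrals over small powers -/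

lemma lintegral_pi_fin_one {α : Type*} [MeasurableSpace α] (μ : Measure α) [SigmaFinite μ]
    {f : (Fin 1 → α) → ℝ≥0∞} (hf : Measurable f) :
    ∫⁻ x, f x ∂(Measure.pi fun _ : Fin 1 => μ) = ∫⁻ x, f ![x] ∂μ := by
  have h := (measurePreserving_funUnique μ (Fin 1)).symm
  refine (h.lintegral_comp hf).symm.trans (lintegral_congr fun x => congrArg f ?_)
  funext i
  fin_cases i
  rfl

lemma lintegral_pi_fin_two {α : Type*} [MeasurableSpace α] (μ : Measure α) [SigmaFinite μ]
    {f : (Fin 2 → α) → ℝ≥0∞} (hf : Measurable f) :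
    ∫⁻ x, f x ∂(Measure.pi fun _ : Fin 2 => μ) = ∫⁻ x, ∫⁻ y, f ![x, y] ∂μ ∂μ := by
  have h := (measurePreserving_finTwoArrow μ).symm
  have hm : Measurable fun a => f (MeasurableEquiv.finTwoArrow.symm a) := hf.comp h.measurable
  rw [← h.lintegral_comp hf, lintegral_prod _ hm.aemeasurable]
  rfl

lemma lintegral_pi_fin_three {α : Type*} [MeasurableSpace α] (μ : Measure α) [SigmaFinite μ]
    {f : (Fin 3 → α) → ℝ≥0∞} (hf : Measurable f) :
    ∫⁻ x, f x ∂(Measure.pi fun _ : Fin 3 => μ) = ∫⁻ x, ∫⁻ y, ∫⁻ z, f ![x, y, z] ∂μ ∂μ ∂μ := by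
  have h := (measurePreserving_piFinSuccAbove (fun _ : Fin 3 => μ) 0).symm
  have hm : Measurable fun a => f ((MeasurableEquiv.piFinSuccAbove (fun _ : Fin 3 => α) 0).symm a) :=
    hf.comp h.measurable
  rw [← h.lintegral_comp hf, lintegral_prod _ hm.aemeasurable]
  refine lintegral_congr fun x => ?_
  have hx : Measurable fun y : Fin 2 → α => f (Fin.cons x y) := by
    refine hf.comp (measurable_pi_lambda _ fun i => ?_)
    refine Fin.cases ?_ (fun j => ?_) i
    · simp
    · simpa using measurable_pi_apply j
  refine Eq.trans (lintegral_congr fun y => congrArg f ?_) (lintegral_pi_fin_two μ hx)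
  funext i
  fin_cases i <;> rfl

/-! ### The measure of relative positions -/

section Rel
variable {E : Type*} [MeasurableSpace E]

/-- The expected sum of the unit masses at `T V`, over the tuples `V` of distinct vertices of a
cluster. -/
def relMeasure (β : Measure (ℕ × ℝ)) {n : ℕ} (T : (Fin n → List ℕ) → ClusterMarks → E) :
    Measure E :=
  Measure.sum fun V : Fin n ↪ List ℕ =>
    ((clusterLaw β).withDensity fun k => ∏ i, alive (V i) k).map (T V)

lemma measurable_prod_alive {n : ℕ} (V : Fin n → List ℕ) :
    Measurable fun k => ∏ i, alive (V i) k :=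
  Finset.measurable_prod _ fun _ _ => measurable_alive _

lemma lintegral_relMeasure (β : Measure (ℕ × ℝ)) {n : ℕ}
    {T : (Fin n → List ℕ) → ClusterMarks → E} (hT : ∀ V, Measurable (T V)) {F : E → ℝ≥0∞}
    (hF : Measurable F) :
    ∫⁻ x, F x ∂(relMeasure β T)
      = ∑' V : Fin n ↪ List ℕ, ∫⁻ k, (∏ i, alive (V i) k) * F (T V k) ∂(clusterLaw β) := by
  rw [relMeasure, lintegral_sum_measure]
  refine tsum_congr fun V => ?_
  have hm : Measurable fun k => F (T V k) := hF.comp (hT V)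
  rw [lintegral_map hF (hT V), lintegral_withDensity_eq_lintegral_mul _
      (measurable_prod_alive V) hm]
  rfl

/-- Dropping the condition that the vertices be distinct leaves the sum over all `n`-tuples, which
is the `n`-th power of the cluster size. -/
lemma relMeasure_univ_le (β : Measure (ℕ × ℝ)) {n : ℕ}
    {T : (Fin n → List ℕ) → ClusterMarks → E} (hT : ∀ V, Measurable (T V)) :
    relMeasure β T univ ≤ ∫⁻ k, clusterSize k ^ n ∂(clusterLaw β) := by
  have h1 := lintegral_relMeasure β hT (F := fun _ => 1) measurable_const
  rw [lintegral_one] at h1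
  rw [h1]
  simp only [mul_one]
  rw [← lintegral_tsum fun V => (measurable_prod_alive _).aemeasurable]
  refine lintegral_mono fun k => ?_
  rw [tsum_embedding fun V : Fin n → List ℕ => ∏ i, alive (V i) k]
  have h := tsum_pi_prod n fun _ v => alive v k
  rw [Finset.prod_const, Finset.card_univ, Fintype.card_fin] at h
  change _ ≤ (∑' v, alive v k) ^ n
  rw [← h]
  refine ENNReal.tsum_le_tsum fun V => ?_
  split_ifs
  · exact le_rfl
  · exact zero_le

end Rel

/-- The difference of the positions of two vertices. -/
def relPair (V : Fin 2 → List ℕ) (k : ClusterMarks) : ℝ :=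
  clusterFamily.pos (V 1) k - clusterFamily.pos (V 0) k

/-- The positions of two vertices relative to a third one. -/
def relTriple (V : Fin 3 → List ℕ) (k : ClusterMarks) : ℝ × ℝ := relPos (V 0) (V 1) (V 2) k

lemma measurable_relPair (V : Fin 2 → List ℕ) : Measurable (relPair V) :=
  (measurable_pos_cluster _).sub (measurable_pos_cluster _)

lemma measurable_relTriple (V : Fin 3 → List ℕ) : Measurable (relTriple V) :=
  measurable_relPos _ _ _

/-! ### Evaluation of the patterns -/

section Pattern
variable {ν : ℝ} {β : Measure (ℕ × ℝ)}

-- The immigrants are integrated out first, for fixed marks, so that translation invariance of their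
-- intensity can absorb positions inside the clusters.
open Classical in
lemma patternMoment_eq [IsProbabilityMeasure β] {n r : ℕ} (p : Fin n → Fin r)
    {F : (Fin n → ℝ) → ℝ≥0∞}
    (hF : Measurable F) :
    patternMoment ν β p F = ∑' V : Fin n → List ℕ, if Function.Injective (fun i => (p i, V i)) then
      ∫⁻ k, (∏ i, alive (V i) (k (p i))) *
        ∫⁻ u, F (fun i => u (p i) + clusterFamily.pos (V i) (k (p i)))
          ∂(Measure.pi fun _ : Fin r => ENNReal.ofReal ν • (volume : Measure ℝ))
        ∂(Measure.pi fun _ : Fin r => clusterLaw β) else 0 := by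
  have hm := measurable_patternSum p hF
  rw [patternMoment, lintegral_lintegral_swap hm.aemeasurable]
  have ht : ∀ V : Fin n → List ℕ, Measurable fun x : (Fin r → ℝ) × (Fin r → ClusterMarks) =>
      if Function.Injective (fun i => (p i, V i)) then (∏ i, alive (V i) (x.2 (p i))) *
        F (fun i => x.1 (p i) + clusterFamily.pos (V i) (x.2 (p i))) else 0 := by
    intro V
    split_ifs
    · exact measurable_patternSum_term p hF V
    · exact measurable_const
  have h1 : ∀ k : Fin r → ClusterMarks, ∫⁻ u, patternSum p F u k
        ∂(Measure.pi fun _ : Fin r => ENNReal.ofReal ν • (volume : Measure ℝ))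
      = ∑' V : Fin n → List ℕ, ∫⁻ u, (if Function.Injective (fun i => (p i, V i)) then
        (∏ i, alive (V i) (k (p i))) * F (fun i => u (p i) + clusterFamily.pos (V i) (k (p i)))
          else 0) ∂(Measure.pi fun _ : Fin r => ENNReal.ofReal ν • (volume : Measure ℝ)) := by
    intro k
    exact lintegral_tsum fun V => ((ht V).comp measurable_prodMk_right).aemeasurable
  simp_rw [h1]
  rw [lintegral_tsum fun V => ?_]
  · refine tsum_congr fun V => ?_
    split_ifs with h
    · refine lintegral_congr fun k => ?_
      rw [lintegral_const_mul]
      refine hF.comp (measurable_pi_lambda _ fun i => ?_)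
      exact (measurable_pi_apply _).add_const _
    · simp
  · exact ((ht V).lintegral_prod_left').aemeasurable

/-- With all points in different clusters, distinctness is automatic and translation removes every
displacement; what remains is a product of independent cluster sizes. -/
lemma patternMoment_id [IsProbabilityMeasure β] {n : ℕ} {F : (Fin n → ℝ) → ℝ≥0∞}
    (hF : Measurable F) :
    patternMoment ν β (id : Fin n → Fin n) F = (∫⁻ k, clusterSize k ∂(clusterLaw β)) ^ n *
      ∫⁻ u, F u ∂(Measure.pi fun _ : Fin n => ENNReal.ofReal ν • (volume : Measure ℝ)) := by
  set I := ∫⁻ u, F u ∂(Measure.pi fun _ : Fin n => ENNReal.ofReal ν • (volume : Measure ℝ)) with hI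
  have hm : ∀ V : Fin n → List ℕ, Measurable fun k : Fin n → ClusterMarks =>
      ∏ i, alive (V i) (k i) := fun V =>
    Finset.measurable_prod _ fun i _ => (measurable_alive _).comp (measurable_pi_apply _)
  have hinv : ∀ x : Fin n → ℝ, ∫⁻ u, F (fun i => u i + x i)
      ∂(Measure.pi fun _ : Fin n => ENNReal.ofReal ν • (volume : Measure ℝ)) = I := fun x =>
    lintegral_add_right_eq_self F x
  rw [patternMoment_eq id hF]
  have h1 : ∀ V : Fin n → List ℕ, Function.Injective (fun i => ((id i : Fin n), V i)) :=
    fun V i j hij => (Prod.ext_iff.1 hij).1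
  have hV : ∀ V : Fin n → List ℕ, ∫⁻ k, (∏ i, alive (V i) (k (id i))) *
      ∫⁻ u, F (fun i => u (id i) + clusterFamily.pos (V i) (k (id i)))
        ∂(Measure.pi fun _ : Fin n => ENNReal.ofReal ν • (volume : Measure ℝ))
        ∂(Measure.pi fun _ : Fin n => clusterLaw β)
      = (∫⁻ k, ∏ i, alive (V i) (k i) ∂(Measure.pi fun _ : Fin n => clusterLaw β)) * I := by
    intro V
    rw [← lintegral_mul_const I (hm V)]
    exact lintegral_congr fun k => congrArg _ (hinv fun i => clusterFamily.pos (V i) (k i))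
  refine Eq.trans (tsum_congr fun V => (if_pos (h1 V)).trans (hV V)) ?_
  rw [ENNReal.tsum_mul_right, ← lintegral_tsum fun V => (hm V).aemeasurable]
  congr 1
  simp_rw [fun k : Fin n → ClusterMarks => tsum_pi_prod n fun i v => alive v (k i)]
  have hind : iIndepFun (fun (i : Fin n) (k : Fin n → ClusterMarks) => clusterSize (k i))
      (Measure.infinitePi fun _ : Fin n => clusterLaw β) :=
    iIndepFun_infinitePi fun _ => measurable_clusterSize
  have h2 := lintegral_prod_eq_prod_lintegral_of_indepFun Finset.univ _ hind
    fun i => measurable_clusterSize.comp (measurable_pi_apply i)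
  rw [← Measure.infinitePi_eq_pi]
  refine h2.trans ?_
  have h3 : ∀ i : Fin n, ∫⁻ k : Fin n → ClusterMarks, clusterSize (k i)
      ∂(Measure.infinitePi fun _ : Fin n => clusterLaw β)
      = ∫⁻ k, clusterSize k ∂(clusterLaw β) := by
    intro i
    rw [← lintegral_map measurable_clusterSize (measurable_pi_apply i),
      Measure.infinitePi_map_eval]
  simp [h3]

/-- All points share one cluster. Translating its immigrant by the position of the vertex `V 0`
makes `t` the location of the first point, so only relative positions enter. -/
lemma patternMoment_fin_one [IsProbabilityMeasure β] {n : ℕ} (p : Fin (n + 1) → Fin 1)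
    {F : (Fin (n + 1) → ℝ) → ℝ≥0∞}
    (hF : Measurable F) :
    patternMoment ν β p F = ∫⁻ t, ∑' V : Fin (n + 1) ↪ List ℕ, ∫⁻ k, (∏ i, alive (V i) k) *
      F (fun i => t + (clusterFamily.pos (V i) k - clusterFamily.pos (V 0) k))
        ∂(clusterLaw β) ∂(ENNReal.ofReal ν • (volume : Measure ℝ)) := by
  classical
  obtain rfl : p = fun _ => 0 := Subsingleton.elim _ _
  have hpos : ∀ V : Fin (n + 1) → List ℕ, Measurable fun q : ℝ × ClusterMarks =>
      (∏ i, alive (V i) q.2) * F (fun i => q.1 +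
        (clusterFamily.pos (V i) q.2 - clusterFamily.pos (V 0) q.2)) := by
    intro V
    refine ((measurable_prod_alive V).comp measurable_snd).mul (hF.comp ?_)
    exact measurable_pi_lambda _ fun i => measurable_fst.add
      (((measurable_pos_cluster _).comp measurable_snd).sub
        ((measurable_pos_cluster _).comp measurable_snd))
  have hk : ∀ V : Fin (n + 1) → List ℕ, Measurable fun t : ℝ => ∫⁻ k, (∏ i, alive (V i) k) *
      F (fun i => t + (clusterFamily.pos (V i) k - clusterFamily.pos (V 0) k))
        ∂(clusterLaw β) := fun V => (hpos V).lintegral_prod_right'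
  rw [patternMoment_eq _ hF, lintegral_tsum fun V : Fin (n + 1) ↪ List ℕ => (hk V).aemeasurable]
  rw [tsum_embedding fun V : Fin (n + 1) → List ℕ => ∫⁻ t, ∫⁻ k, (∏ i, alive (V i) k) *
      F (fun i => t + (clusterFamily.pos (V i) k - clusterFamily.pos (V 0) k))
        ∂(clusterLaw β) ∂(ENNReal.ofReal ν • (volume : Measure ℝ))]
  refine tsum_congr fun V => ?_
  have hinj : Function.Injective (fun i => ((0 : Fin 1), V i)) ↔ Function.Injective V :=
    ⟨fun h i j hij => h (by simp [hij]), fun h i j hij => h (Prod.ext_iff.1 hij).2⟩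
  by_cases hV : Function.Injective V
  swap
  · rw [if_neg fun h => hV (hinj.1 h), if_neg hV]
  rw [if_pos (hinj.2 hV), if_pos hV, lintegral_lintegral_swap (hpos V).aemeasurable]
  have hFu : ∀ x : Fin (n + 1) → ℝ, Measurable fun u : Fin 1 → ℝ => F (fun i => u 0 + x i) :=
    fun x => hF.comp (measurable_pi_lambda _ fun i => (measurable_pi_apply _).add_const _)
  have hFt : ∀ x : Fin (n + 1) → ℝ, Measurable fun t : ℝ => F (fun i => t + x i) :=
    fun x => hF.comp (measurable_pi_lambda _ fun i => measurable_id.add_const _)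
  have h1 : ∀ k : Fin 1 → ClusterMarks, ∫⁻ u, F (fun i => u 0 + clusterFamily.pos (V i) (k 0))
        ∂(Measure.pi fun _ : Fin 1 => ENNReal.ofReal ν • (volume : Measure ℝ))
      = ∫⁻ t, F (fun i => t + (clusterFamily.pos (V i) (k 0) - clusterFamily.pos (V 0) (k 0)))
          ∂(ENNReal.ofReal ν • (volume : Measure ℝ)) := by
    intro k
    rw [lintegral_pi_fin_one _ (hFu _), ← lintegral_add_right_eq_self (fun t => F (fun i => t +
      (clusterFamily.pos (V i) (k 0) - clusterFamily.pos (V 0) (k 0))))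
      (clusterFamily.pos (V 0) (k 0))]
    refine lintegral_congr fun t => congrArg F (funext fun i => ?_)
    simp
  simp_rw [h1]
  have h2 : ∀ k, ∫⁻ t, (∏ i, alive (V i) k) *
      F (fun i => t + (clusterFamily.pos (V i) k - clusterFamily.pos (V 0) k))
        ∂(ENNReal.ofReal ν • (volume : Measure ℝ))
      = (∏ i, alive (V i) k) * ∫⁻ t, F (fun i => t + (clusterFamily.pos (V i) k -
          clusterFamily.pos (V 0) k)) ∂(ENNReal.ofReal ν • (volume : Measure ℝ)) := fun k =>
    lintegral_const_mul _ (hFt _)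
  rw [lintegral_pi_fin_one (clusterLaw β) (f := fun k => (∏ i, alive (V i) (k 0)) *
    ∫⁻ t, F (fun i => t + (clusterFamily.pos (V i) (k 0) - clusterFamily.pos (V 0) (k 0)))
      ∂(ENNReal.ofReal ν • (volume : Measure ℝ)))]
  · exact lintegral_congr fun k => (h2 k).symm
  · simp_rw [← h2]
    exact (hpos V).lintegral_prod_left'.comp (measurable_pi_apply 0)

lemma patternMoment_pair [IsProbabilityMeasure β] {F : (Fin 2 → ℝ) → ℝ≥0∞} (hF : Measurable F) :
    patternMoment ν β (![0, 0] : Fin 2 → Fin 1) F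
      = ∫⁻ t, ∫⁻ τ, F ![t, t + τ] ∂(relMeasure β relPair)
          ∂(ENNReal.ofReal ν • (volume : Measure ℝ)) := by
  rw [patternMoment_fin_one _ hF]
  refine lintegral_congr fun t => ?_
  rw [lintegral_relMeasure β measurable_relPair (F := fun τ => F ![t, t + τ])
    (hF.comp (by fun_prop))]
  refine tsum_congr fun V => lintegral_congr fun k => ?_
  congr 2
  funext i
  fin_cases i
  · simp
  · rfl

lemma patternMoment_triple [IsProbabilityMeasure β] {F : (Fin 3 → ℝ) → ℝ≥0∞} (hF : Measurable F) :
    patternMoment ν β (![0, 0, 0] : Fin 3 → Fin 1) F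
      = ∫⁻ t, ∫⁻ τ, F ![t, t + τ.1, t + τ.2] ∂(relMeasure β relTriple)
          ∂(ENNReal.ofReal ν • (volume : Measure ℝ)) := by
  rw [patternMoment_fin_one _ hF]
  refine lintegral_congr fun t => ?_
  rw [lintegral_relMeasure β measurable_relTriple (F := fun τ => F ![t, t + τ.1, t + τ.2])
    (hF.comp (by fun_prop))]
  refine tsum_congr fun V => lintegral_congr fun k => ?_
  congr 2
  funext i
  fin_cases i
  · simp
  · rfl
  · rfl

/-- Permuting the coordinates reduces the three partitions of type `2 + 1` to a single computation.
-/
lemma patternMoment_comp_perm {n r : ℕ} (p : Fin n → Fin r) (σ : Equiv.Perm (Fin n))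
    (F : (Fin n → ℝ) → ℝ≥0∞) :
    patternMoment ν β (p ∘ σ) F = patternMoment ν β p (fun x => F (x ∘ σ)) := by
  classical
  refine lintegral_congr fun u => lintegral_congr fun k => ?_
  rw [patternSum, ← (Equiv.arrowCongr σ.symm (Equiv.refl (List ℕ))).tsum_eq]
  refine tsum_congr fun V => ?_
  have h : Function.Injective (fun i => ((p ∘ σ) i,
      (Equiv.arrowCongr σ.symm (Equiv.refl (List ℕ))) V i))
      ↔ Function.Injective (fun i => (p i, V i)) :=
    ⟨fun h' => by
      have := h'.comp σ.symm.injective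
      simpa [Function.comp_def] using this, fun h' => h'.comp σ.injective⟩
  by_cases hV : Function.Injective (fun i => (p i, V i))
  swap
  · rw [if_neg fun h' => hV (h.1 h'), if_neg hV]
  rw [if_pos (h.2 hV), if_pos hV]
  congr 1
  exact Equiv.prod_comp σ fun i => alive (V i) (k (p i))

/-- The two clusters are independent. The lone point enters through its immigrant, up to a
translation, and through the number of choices of its vertex, of mean cluster size; the pair
produces `relMeasure β relPair`. -/
lemma patternMoment_pair_single [IsProbabilityMeasure β] {F : (Fin 3 → ℝ) → ℝ≥0∞}
    (hF : Measurable F) :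
    patternMoment ν β (![0, 0, 1] : Fin 3 → Fin 2) F
      = (∫⁻ k, clusterSize k ∂(clusterLaw β)) *
        ∫⁻ y, ∫⁻ t, ∫⁻ τ, F ![t, t + τ, y] ∂(relMeasure β relPair)
          ∂(ENNReal.ofReal ν • (volume : Measure ℝ))
          ∂(ENNReal.ofReal ν • (volume : Measure ℝ)) := by
  classical
  set Λ := ENNReal.ofReal ν • (volume : Measure ℝ) with hΛ
  let e : (Fin 2 → List ℕ) × List ℕ ≃ (Fin 3 → List ℕ) :=
    { toFun := fun q => ![q.1 0, q.1 1, q.2]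
      invFun := fun V => (![V 0, V 1], V 2)
      left_inv := by
        rintro ⟨V, v⟩
        refine Prod.ext (funext fun i => ?_) rfl
        fin_cases i <;> rfl
      right_inv := by
        intro V
        funext i
        fin_cases i <;> rfl }
  -- The third point lies in another cluster, so distinctness constrains the first two only.
  have hinj : ∀ V v, Function.Injective (fun i => ((![0, 0, 1] : Fin 3 → Fin 2) i, e (V, v) i))
      ↔ Function.Injective V := by
    intro V v
    have h1 : Function.Injective V ↔ V 0 ≠ V 1 := by
      constructor
      · intro h h01
        exact absurd (h h01) (by decide)
      · intro h i j hij
        fin_cases i <;> fin_cases j <;> first | rfl | exact absurd hij h | exact absurd hij.symm h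
    rw [h1]
    constructor
    · intro h h01
      have := @h 0 1 (Prod.ext rfl h01)
      exact absurd this (by decide)
    · intro h i j hij
      have hi : (![0, 0, 1] : Fin 3 → Fin 2) i = (![0, 0, 1] : Fin 3 → Fin 2) j :=
        (Prod.ext_iff.1 hij).1
      have hj := (Prod.ext_iff.1 hij).2
      fin_cases i <;> fin_cases j <;>
        first | rfl | exact absurd hi (by decide) | exact absurd hi.symm (by decide) |
          exact absurd hj h | exact absurd hj.symm h
  have hF3 : ∀ k : ClusterMarks, ∀ V : Fin 2 → List ℕ, Measurable fun q : ℝ × ℝ =>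
      F ![q.1, q.1 + relPair V k, q.2] := fun k V => hF.comp (by fun_prop)
  set I : (Fin 2 → List ℕ) → ClusterMarks → ℝ≥0∞ := fun V k =>
    ∫⁻ y, ∫⁻ t, F ![t, t + relPair V k, y] ∂Λ ∂Λ with hI
  have hmI4 : ∀ V, Measurable fun q : ClusterMarks × ℝ × ℝ =>
      F ![q.2.2, q.2.2 + relPair V q.1, q.2.1] := fun V => by
    have := measurable_relPair V
    exact hF.comp (by fun_prop)
  have hmI : ∀ V, Measurable (I V) := fun V =>
    Measurable.lintegral_prod_right' (f := fun q : ClusterMarks × ℝ =>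
      ∫⁻ t, F ![t, t + relPair V q.1, q.2] ∂Λ) (Measurable.lintegral_prod_right'
        (f := fun q : (ClusterMarks × ℝ) × ℝ => F ![q.2, q.2 + relPair V q.1.1, q.1.2])
          ((hmI4 V).comp (by fun_prop : Measurable fun q : (ClusterMarks × ℝ) × ℝ =>
            (q.1.1, q.1.2, q.2))))
  have hu : ∀ (V : Fin 2 → List ℕ) (v : List ℕ) (k : Fin 2 → ClusterMarks),
      ∫⁻ u, F (fun i => u ((![0, 0, 1] : Fin 3 → Fin 2) i) +
        clusterFamily.pos (e (V, v) i) (k ((![0, 0, 1] : Fin 3 → Fin 2) i)))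
          ∂(Measure.pi fun _ : Fin 2 => Λ) = I V (k 0) := by
    intro V v k
    -- Translating the two immigrants by the positions of `V 0` and of `v` removes all dependence on
    -- the lone vertex and leaves only the relative position of the pair.
    have hinv := lintegral_add_right_eq_self (μ := Measure.pi fun _ : Fin 2 => Λ)
      (fun u : Fin 2 → ℝ => F ![u 0, u 0 + relPair V (k 0), u 1])
      ![clusterFamily.pos (V 0) (k 0), clusterFamily.pos v (k 1)]
    have hm2 : Measurable fun u : Fin 2 → ℝ => F ![u 0, u 0 + relPair V (k 0), u 1] :=
      hF.comp (by fun_prop)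
    rw [lintegral_pi_fin_two Λ hm2] at hinv
    have hswap : ∫⁻ x, ∫⁻ y, F ![x, x + relPair V (k 0), y] ∂Λ ∂Λ = I V (k 0) :=
      lintegral_lintegral_swap (hF3 (k 0) V).aemeasurable
    rw [← hswap]
    refine Eq.trans (lintegral_congr fun u => congrArg F (funext fun i => ?_)) hinv
    fin_cases i
    · rfl
    · change u 0 + clusterFamily.pos (V 1) (k 0) = u 0 + clusterFamily.pos (V 0) (k 0)
        + (clusterFamily.pos (V 1) (k 0) - clusterFamily.pos (V 0) (k 0))
      ring
    · rfl
  have hterm : ∀ (V : Fin 2 → List ℕ) (v : List ℕ),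
      ∫⁻ k, alive (e (V, v) 0) (k ((![0, 0, 1] : Fin 3 → Fin 2) 0)) *
        alive (e (V, v) 1) (k ((![0, 0, 1] : Fin 3 → Fin 2) 1)) *
        alive (e (V, v) 2) (k ((![0, 0, 1] : Fin 3 → Fin 2) 2)) * I V (k 0)
          ∂(Measure.pi fun _ : Fin 2 => clusterLaw β)
      = (∫⁻ k, (∏ i, alive (V i) k) * I V k ∂(clusterLaw β)) * ∫⁻ k, alive v k ∂(clusterLaw β) := by
    intro V v
    have hmk : Measurable fun k => (∏ i, alive (V i) k) * I V k :=
      (measurable_prod_alive V).mul (hmI V)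
    have h1 : ∀ k : Fin 2 → ClusterMarks,
        alive (e (V, v) 0) (k ((![0, 0, 1] : Fin 3 → Fin 2) 0)) *
        alive (e (V, v) 1) (k ((![0, 0, 1] : Fin 3 → Fin 2) 1)) *
        alive (e (V, v) 2) (k ((![0, 0, 1] : Fin 3 → Fin 2) 2)) * I V (k 0)
        = ((∏ i, alive (V i) (k 0)) * I V (k 0)) * alive v (k 1) := by
      intro k
      rw [Fin.prod_univ_two]
      change alive (V 0) (k 0) * alive (V 1) (k 0) * alive v (k 1) * I V (k 0) = _
      ring
    simp_rw [h1]
    rw [lintegral_pi_fin_two (clusterLaw β)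
      (f := fun k => ((∏ i, alive (V i) (k 0)) * I V (k 0)) * alive v (k 1))
      ((hmk.comp (measurable_pi_apply 0)).mul ((measurable_alive v).comp (measurable_pi_apply 1)))]
    rw [← lintegral_mul_const _ hmk]
    exact lintegral_congr fun k => lintegral_const_mul ((∏ i, alive (V i) k) * I V k)
      (measurable_alive v)
  have hM : ∑' v, ∫⁻ k, alive v k ∂(clusterLaw β) = ∫⁻ k, clusterSize k ∂(clusterLaw β) :=
    (lintegral_tsum fun v => (measurable_alive v).aemeasurable).symm
  rw [patternMoment_eq _ hF, ← e.tsum_eq, ENNReal.tsum_prod']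
  refine Eq.trans (tsum_congr fun V => tsum_congr fun v => (?_ : _ =
    (if Function.Injective V then (∫⁻ k, (∏ i, alive (V i) k) * I V k ∂(clusterLaw β)) else 0)
      * ∫⁻ k, alive v k ∂(clusterLaw β))) ?_
  · by_cases hV : Function.Injective V
    · rw [if_pos ((hinj V v).2 hV), if_pos hV, ← hterm V v]
      refine lintegral_congr fun k => ?_
      rw [hu, Fin.prod_univ_three]
    · rw [if_neg fun h => hV ((hinj V v).1 h), if_neg hV, zero_mul]
  simp_rw [ENNReal.tsum_mul_left, hM]
  rw [ENNReal.tsum_mul_right, mul_comm]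
  congr 1
  refine Eq.trans (Eq.trans (tsum_congr fun V => ?_) (tsum_embedding fun V : Fin 2 → List ℕ =>
    ∫⁻ k, (∏ i, alive (V i) k) * I V k ∂(clusterLaw β)).symm) ?_
  · by_cases hV : Function.Injective V
    · rw [if_pos hV, if_pos hV]
    · rw [if_neg hV, if_neg hV]
  have hrel : ∀ y t, ∫⁻ τ, F ![t, t + τ, y] ∂(relMeasure β relPair)
      = ∑' V : Fin 2 ↪ List ℕ, ∫⁻ k, (∏ i, alive (V i) k) * F ![t, t + relPair V k, y]
          ∂(clusterLaw β) := fun y t =>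
    lintegral_relMeasure β measurable_relPair (F := fun τ => F ![t, t + τ, y])
      (hF.comp (by fun_prop))
  simp only [hrel]
  have hm3 : ∀ V : Fin 2 → List ℕ, Measurable fun q : (ℝ × ℝ) × ClusterMarks =>
      (∏ i, alive (V i) q.2) * F ![q.1.2, q.1.2 + relPair V q.2, q.1.1] := fun V =>
    ((measurable_prod_alive V).comp measurable_snd).mul ((hmI4 V).comp
      (by fun_prop : Measurable fun q : (ℝ × ℝ) × ClusterMarks => (q.2, q.1.1, q.1.2)))
  have hm2 : ∀ V : Fin 2 → List ℕ, Measurable fun q : ℝ × ℝ => ∫⁻ k, (∏ i, alive (V i) k) *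
      F ![q.2, q.2 + relPair V k, q.1] ∂(clusterLaw β) := fun V => (hm3 V).lintegral_prod_right'
  have hm1 : ∀ V : Fin 2 → List ℕ, Measurable fun y : ℝ => ∫⁻ t, ∫⁻ k, (∏ i, alive (V i) k) *
      F ![t, t + relPair V k, y] ∂(clusterLaw β) ∂Λ := fun V => (hm2 V).lintegral_prod_right'
  have hstep : ∀ y, ∫⁻ t, ∑' V : Fin 2 ↪ List ℕ, ∫⁻ k, (∏ i, alive (V i) k) *
      F ![t, t + relPair V k, y] ∂(clusterLaw β) ∂Λ
      = ∑' V : Fin 2 ↪ List ℕ, ∫⁻ t, ∫⁻ k, (∏ i, alive (V i) k) *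
      F ![t, t + relPair V k, y] ∂(clusterLaw β) ∂Λ := fun y =>
    lintegral_tsum fun V => ((hm2 V).comp measurable_prodMk_left).aemeasurable
  simp only [hstep]
  rw [lintegral_tsum fun V : Fin 2 ↪ List ℕ => (hm1 V).aemeasurable]
  refine tsum_congr fun V => ?_
  have hmul : ∀ k, (∏ i, alive (V i) k) * I V k
      = ∫⁻ q : ℝ × ℝ, (∏ i, alive (V i) k) * F ![q.2, q.2 + relPair V k, q.1] ∂(Λ.prod Λ) := by
    intro k
    have hmq : Measurable fun q : ℝ × ℝ => F ![q.2, q.2 + relPair V k, q.1] :=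
      (hF3 k V).comp measurable_swap
    rw [lintegral_const_mul _ hmq, lintegral_prod _ hmq.aemeasurable]
  simp only [hmul]
  rw [lintegral_lintegral_swap, lintegral_prod _ (hm2 V).aemeasurable]
  exact ((hm3 V).comp measurable_swap).aemeasurable

end Pattern

/-! ### The third cumulant measure -/

lemma isLocallyFiniteMeasure_of_closedBall {E : Type*} [SeminormedAddCommGroup E]
    [MeasurableSpace E] {μ : Measure E} (h : ∀ r : ℝ, μ (Metric.closedBall 0 r) < ∞) :
    IsLocallyFiniteMeasure μ := by
  refine ⟨fun x => ⟨Metric.closedBall 0 (‖x‖ + 1), ?_, h _⟩⟩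
  refine Filter.mem_of_superset (Metric.ball_mem_nhds x one_pos) fun y hy => ?_
  rw [mem_closedBall_zero_iff]
  have h1 : ‖y - x‖ < 1 := by rwa [← dist_eq_norm]
  have h2 := norm_add_le (y - x) x
  rw [sub_add_cancel] at h2
  linarith

lemma integrable_of_hasCompactSupport_of_bounded {E : Type*} [TopologicalSpace E]
    [MeasurableSpace E] [OpensMeasurableSpace E] {μ : Measure E}
    [IsLocallyFiniteMeasure μ] {F : E → ℝ} (hF : Measurable F) (hb : ∃ M : ℝ, ∀ t, |F t| ≤ M)
    (hc : HasCompactSupport F) : Integrable F μ := by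
  obtain ⟨M, hM⟩ := hb
  rw [← integrableOn_iff_integrable_of_support_subset (subset_tsupport F)]
  exact Measure.integrableOn_of_bounded (M := M) hc.isCompact.measure_lt_top.ne
    hF.aestronglyMeasurable (Filter.Eventually.of_forall hM)

lemma abs_le_of_mem_closedBall {n : ℕ} {x : Fin n → ℝ} {r : ℝ}
    (hx : x ∈ Metric.closedBall (0 : Fin n → ℝ) r) (i : Fin n) : x i ∈ Icc (-r) r := by
  rw [mem_closedBall_zero_iff] at hx
  have := (norm_le_pi_norm x i).trans hx
  exact abs_le.1 this

section Cumulant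
variable {Λ : Measure ℝ} [IsLocallyFiniteMeasure Λ] {M : ℝ≥0∞} {Q₂ : Measure ℝ} [IsFiniteMeasure Q₂]
  {Q₃ : Measure (ℝ × ℝ)} [IsFiniteMeasure Q₃] {α₁ : Measure (Fin 1 → ℝ)} {α₂ : Measure (Fin 2 → ℝ)}
  {α₃ : Measure (Fin 3 → ℝ)}

/-- The first factorial moment measure of a stationary cluster process. -/
def IsMomentOne (Λ : Measure ℝ) (M : ℝ≥0∞) (α₁ : Measure (Fin 1 → ℝ)) : Prop :=
  ∀ F : (Fin 1 → ℝ) → ℝ≥0∞, Measurable F → ∫⁻ x, F x ∂α₁ = M * ∫⁻ x, F ![x] ∂Λ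

/-- The second factorial moment measure of a stationary cluster process. -/
def IsMomentTwo (Λ : Measure ℝ) (M : ℝ≥0∞) (Q₂ : Measure ℝ) (α₂ : Measure (Fin 2 → ℝ)) : Prop :=
  ∀ F : (Fin 2 → ℝ) → ℝ≥0∞, Measurable F → ∫⁻ x, F x ∂α₂ = ∫⁻ t, ∫⁻ τ, F ![t, t + τ] ∂Q₂ ∂Λ
    + M ^ 2 * ∫⁻ x, ∫⁻ y, F ![x, y] ∂Λ ∂Λ

/-- The third factorial moment measure of a stationary cluster process. -/
def IsMomentThree (Λ : Measure ℝ) (M : ℝ≥0∞) (Q₂ : Measure ℝ) (Q₃ : Measure (ℝ × ℝ))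
    (α₃ : Measure (Fin 3 → ℝ)) : Prop :=
  ∀ F : (Fin 3 → ℝ) → ℝ≥0∞, Measurable F → ∫⁻ x, F x ∂α₃
    = ∫⁻ t, ∫⁻ τ, F ![t, t + τ.1, t + τ.2] ∂Q₃ ∂Λ
    + M * ∫⁻ y, ∫⁻ t, ∫⁻ τ, F ![t, t + τ, y] ∂Q₂ ∂Λ ∂Λ
    + M * ∫⁻ y, ∫⁻ t, ∫⁻ τ, F ![t, y, t + τ] ∂Q₂ ∂Λ ∂Λ
    + M * ∫⁻ y, ∫⁻ t, ∫⁻ τ, F ![y, t, t + τ] ∂Q₂ ∂Λ ∂Λ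
    + M ^ 3 * ∫⁻ x, ∫⁻ y, ∫⁻ z, F ![x, y, z] ∂Λ ∂Λ ∂Λ

/-! ### Local finiteness of the moment measures -/

lemma lintegral_indicator_Icc_lt_top (r : ℝ) :
    ∫⁻ t, (Icc (-r) r).indicator (fun _ => (1 : ℝ≥0∞)) t ∂Λ < ∞ := by
  have := lintegral_indicator_one (μ := Λ) (measurableSet_Icc (a := -r) (b := r))
  exact this.trans_lt isCompact_Icc.measure_lt_top

lemma indicator_closedBall_le {n : ℕ} (r : ℝ) (x : Fin n → ℝ) (i : Fin n) :
    (Metric.closedBall (0 : Fin n → ℝ) r).indicator (fun _ => (1 : ℝ≥0∞)) x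
      ≤ (Icc (-r) r).indicator (fun _ => 1) (x i) := by
  by_cases hx : x ∈ Metric.closedBall (0 : Fin n → ℝ) r
  · rw [Set.indicator_of_mem hx, Set.indicator_of_mem (abs_le_of_mem_closedBall hx i)]
  · rw [Set.indicator_of_notMem hx]
    exact zero_le

lemma indicator_closedBall_le_mul {n : ℕ} (r : ℝ) (x : Fin n → ℝ) (i j : Fin n) :
    (Metric.closedBall (0 : Fin n → ℝ) r).indicator (fun _ => (1 : ℝ≥0∞)) x
      ≤ (Icc (-r) r).indicator (fun _ => 1) (x i) * (Icc (-r) r).indicator (fun _ => 1) (x j) := by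
  by_cases hx : x ∈ Metric.closedBall (0 : Fin n → ℝ) r
  · rw [Set.indicator_of_mem hx, Set.indicator_of_mem (abs_le_of_mem_closedBall hx i),
      Set.indicator_of_mem (abs_le_of_mem_closedBall hx j), one_mul]
  · rw [Set.indicator_of_notMem hx]
    exact zero_le

/-- A ball confines the coordinate equal to `t` to a bounded interval; the relative positions cost
at most the finite mass of `Q`. -/
lemma lintegral_one_point_lt_top {E : Type*} [MeasurableSpace E] {Q : Measure E}
    [IsFiniteMeasure Q] {n : ℕ} (r : ℝ) (f : ℝ → E → Fin n → ℝ) (i : Fin n)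
    (hf : ∀ t τ, f t τ i = t) :
    ∫⁻ t, ∫⁻ τ, (Metric.closedBall (0 : Fin n → ℝ) r).indicator (fun _ => (1 : ℝ≥0∞)) (f t τ)
      ∂Q ∂Λ < ∞ := by
  calc ∫⁻ t, ∫⁻ τ, (Metric.closedBall (0 : Fin n → ℝ) r).indicator (fun _ => (1 : ℝ≥0∞)) (f t τ)
        ∂Q ∂Λ
      ≤ ∫⁻ t, ∫⁻ _, (Icc (-r) r).indicator (fun _ => (1 : ℝ≥0∞)) t ∂Q ∂Λ := by
        refine lintegral_mono fun t => lintegral_mono fun τ => ?_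
        have := indicator_closedBall_le r (f t τ) i
        rwa [hf] at this
    _ = (∫⁻ t, (Icc (-r) r).indicator (fun _ => (1 : ℝ≥0∞)) t ∂Λ) * Q univ := by
        simp_rw [lintegral_const]
        rw [lintegral_mul_const _ (measurable_const.indicator measurableSet_Icc)]
    _ < ∞ := ENNReal.mul_lt_top (lintegral_indicator_Icc_lt_top r) (measure_lt_top Q _)

lemma lintegral_two_point_lt_top {E : Type*} [MeasurableSpace E] {Q : Measure E}
    [IsFiniteMeasure Q] {n : ℕ} (r : ℝ) (f : ℝ → ℝ → E → Fin n → ℝ) (i j : Fin n)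
    (hi : ∀ y t τ, f y t τ i = y) (hj : ∀ y t τ, f y t τ j = t) :
    ∫⁻ y, ∫⁻ t, ∫⁻ τ, (Metric.closedBall (0 : Fin n → ℝ) r).indicator (fun _ => (1 : ℝ≥0∞))
      (f y t τ) ∂Q ∂Λ ∂Λ < ∞ := by
  set g : ℝ → ℝ≥0∞ := (Icc (-r) r).indicator (fun _ => (1 : ℝ≥0∞)) with hg
  have hgm : Measurable g := measurable_const.indicator measurableSet_Icc
  calc ∫⁻ y, ∫⁻ t, ∫⁻ τ, (Metric.closedBall (0 : Fin n → ℝ) r).indicator (fun _ => (1 : ℝ≥0∞))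
        (f y t τ) ∂Q ∂Λ ∂Λ
      ≤ ∫⁻ y, ∫⁻ t, ∫⁻ _, g y * g t ∂Q ∂Λ ∂Λ := by
        refine lintegral_mono fun y => lintegral_mono fun t => lintegral_mono fun τ => ?_
        have := indicator_closedBall_le_mul r (f y t τ) i j
        rwa [hi, hj] at this
    _ = (∫⁻ y, g y ∂Λ) * ((∫⁻ t, g t ∂Λ) * Q univ) := by
        simp_rw [lintegral_const, mul_assoc]
        have : ∀ y, ∫⁻ t, g y * (g t * Q univ) ∂Λ = g y * ((∫⁻ t, g t ∂Λ) * Q univ) := fun y => by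
          rw [lintegral_const_mul _ (hgm.mul_const _), lintegral_mul_const _ hgm]
        simp_rw [this]
        rw [lintegral_mul_const _ hgm]
    _ < ∞ := ENNReal.mul_lt_top (lintegral_indicator_Icc_lt_top r)
        (ENNReal.mul_lt_top (lintegral_indicator_Icc_lt_top r) (measure_lt_top Q _))

lemma measure_closedBall_eq {n : ℕ} (μ : Measure (Fin n → ℝ)) (r : ℝ) :
    μ (Metric.closedBall 0 r)
      = ∫⁻ x, (Metric.closedBall (0 : Fin n → ℝ) r).indicator (fun _ => (1 : ℝ≥0∞)) x ∂μ :=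
  (lintegral_indicator_one Metric.isClosed_closedBall.measurableSet).symm

lemma measurable_indicator_closedBall {n : ℕ} (r : ℝ) :
    Measurable ((Metric.closedBall (0 : Fin n → ℝ) r).indicator (fun _ => (1 : ℝ≥0∞))) :=
  measurable_const.indicator Metric.isClosed_closedBall.measurableSet

lemma IsMomentOne.isLocallyFiniteMeasure (h : IsMomentOne Λ M α₁) (hM : M ≠ ∞) :
    IsLocallyFiniteMeasure α₁ := by
  refine isLocallyFiniteMeasure_of_closedBall fun r => ?_
  rw [measure_closedBall_eq, h _ (measurable_indicator_closedBall r)]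
  refine ENNReal.mul_lt_top hM.lt_top (lt_of_le_of_lt (lintegral_mono fun t => ?_)
    (lintegral_indicator_Icc_lt_top (Λ := Λ) r))
  exact indicator_closedBall_le r ![t] 0

lemma lintegral_three_point_lt_top (r : ℝ) :
    ∫⁻ x, ∫⁻ y, ∫⁻ z, (Metric.closedBall (0 : Fin 3 → ℝ) r).indicator (fun _ => (1 : ℝ≥0∞))
      ![x, y, z] ∂Λ ∂Λ ∂Λ < ∞ := by
  -- The ball also confines the last coordinate, so `Λ` may be replaced there by a finite
  -- restriction, which then plays the part of `Q`.
  have h : ∀ x y, ∫⁻ z, (Metric.closedBall (0 : Fin 3 → ℝ) r).indicator (fun _ => (1 : ℝ≥0∞))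
      ![x, y, z] ∂Λ = ∫⁻ z, (Metric.closedBall (0 : Fin 3 → ℝ) r).indicator (fun _ => (1 : ℝ≥0∞))
      ![x, y, z] ∂(Λ.restrict (Icc (-r) r)) := by
    intro x y
    rw [← lintegral_indicator measurableSet_Icc]
    refine lintegral_congr fun z => ?_
    by_cases hz : z ∈ Icc (-r) r
    · rw [Set.indicator_of_mem hz]
    · rw [Set.indicator_of_notMem hz, Set.indicator_of_notMem]
      exact fun h => hz (abs_le_of_mem_closedBall h 2)
  simp_rw [h]
  have : IsFiniteMeasure (Λ.restrict (Icc (-r) r)) :=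
    ⟨by rw [Measure.restrict_apply_univ]; exact isCompact_Icc.measure_lt_top⟩
  exact lintegral_two_point_lt_top r (fun x y z => ![x, y, z]) 0 1 (fun _ _ _ => rfl)
    (fun _ _ _ => rfl)

lemma lintegral_pair_lt_top (r : ℝ) :
    ∫⁻ x, ∫⁻ y, (Metric.closedBall (0 : Fin 2 → ℝ) r).indicator (fun _ => (1 : ℝ≥0∞))
      ![x, y] ∂Λ ∂Λ < ∞ := by
  have h : ∀ x, ∫⁻ y, (Metric.closedBall (0 : Fin 2 → ℝ) r).indicator (fun _ => (1 : ℝ≥0∞))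
      ![x, y] ∂Λ = ∫⁻ y, (Metric.closedBall (0 : Fin 2 → ℝ) r).indicator (fun _ => (1 : ℝ≥0∞))
      ![x, y] ∂(Λ.restrict (Icc (-r) r)) := by
    intro x
    rw [← lintegral_indicator measurableSet_Icc]
    refine lintegral_congr fun z => ?_
    by_cases hz : z ∈ Icc (-r) r
    · rw [Set.indicator_of_mem hz]
    · rw [Set.indicator_of_notMem hz, Set.indicator_of_notMem]
      exact fun h => hz (abs_le_of_mem_closedBall h 1)
  simp_rw [h]
  have : IsFiniteMeasure (Λ.restrict (Icc (-r) r)) :=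
    ⟨by rw [Measure.restrict_apply_univ]; exact isCompact_Icc.measure_lt_top⟩
  exact lintegral_one_point_lt_top r (fun x y => ![x, y]) 0 (fun _ _ => rfl)

lemma IsMomentTwo.isLocallyFiniteMeasure (h : IsMomentTwo Λ M Q₂ α₂) (hM : M ≠ ∞) :
    IsLocallyFiniteMeasure α₂ := by
  refine isLocallyFiniteMeasure_of_closedBall fun r => ?_
  rw [measure_closedBall_eq, h _ (measurable_indicator_closedBall r)]
  exact ENNReal.add_lt_top.2 ⟨lintegral_one_point_lt_top r _ 0 fun _ _ => rfl,
    ENNReal.mul_lt_top (ENNReal.pow_lt_top hM.lt_top) (lintegral_pair_lt_top r)⟩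

lemma IsMomentThree.isLocallyFiniteMeasure (h : IsMomentThree Λ M Q₂ Q₃ α₃) (hM : M ≠ ∞) :
    IsLocallyFiniteMeasure α₃ := by
  refine isLocallyFiniteMeasure_of_closedBall fun r => ?_
  rw [measure_closedBall_eq, h _ (measurable_indicator_closedBall r)]
  refine ENNReal.add_lt_top.2 ⟨ENNReal.add_lt_top.2 ⟨ENNReal.add_lt_top.2 ⟨ENNReal.add_lt_top.2
    ⟨lintegral_one_point_lt_top r _ 0 fun _ _ => rfl, ENNReal.mul_lt_top hM.lt_top ?_⟩,
    ENNReal.mul_lt_top hM.lt_top ?_⟩, ENNReal.mul_lt_top hM.lt_top ?_⟩,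
    ENNReal.mul_lt_top (ENNReal.pow_lt_top hM.lt_top) (lintegral_three_point_lt_top r)⟩
  · exact lintegral_two_point_lt_top r _ 2 0 (fun _ _ _ => rfl) (fun _ _ _ => rfl)
  · exact lintegral_two_point_lt_top r _ 1 0 (fun _ _ _ => rfl) (fun _ _ _ => rfl)
  · exact lintegral_two_point_lt_top r _ 0 1 (fun _ _ _ => rfl) (fun _ _ _ => rfl)

/-- The value of the third cumulant measure of a stationary cluster process. -/
theorem cumulant_eq_of_moments (h₁ : IsMomentOne Λ M α₁) (h₂ : IsMomentTwo Λ M Q₂ α₂)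
    (h₃ : IsMomentThree Λ M Q₂ Q₃ α₃) (hM : M ≠ ∞) {F : (Fin 3 → ℝ) → ℝ} (hF : Measurable F)
    (hb : ∃ C : ℝ, ∀ t, |F t| ≤ C) (hc : HasCompactSupport F) :
    (∫ t, F t ∂α₃) - (∫ y, ∫ x, F ![x 0, x 1, y 0] ∂α₂ ∂α₁) - (∫ y, ∫ x, F ![x 0, y 0, x 1] ∂α₂ ∂α₁)
      - (∫ y, ∫ x, F ![y 0, x 0, x 1] ∂α₂ ∂α₁) + 2 * ∫ x, ∫ y, ∫ z, F ![x 0, y 0, z 0] ∂α₁ ∂α₁ ∂α₁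
      = ∫ t, ∫ τ, F ![t, t + τ.1, t + τ.2] ∂Q₃ ∂Λ := by
  have := h₁.isLocallyFiniteMeasure hM
  have := h₂.isLocallyFiniteMeasure hM
  have := h₃.isLocallyFiniteMeasure hM
  have hint : Integrable F α₃ := integrable_of_hasCompactSupport_of_bounded hF hb hc
  -- the constituents of `α₃`
  have hgA : Measurable fun p : ℝ × (ℝ × ℝ) => ![p.1, p.1 + p.2.1, p.1 + p.2.2] := by fun_prop
  set A := (Λ.prod Q₃).map fun p : ℝ × (ℝ × ℝ) => ![p.1, p.1 + p.2.1, p.1 + p.2.2] with hA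
  have hg₁ : Measurable fun p : ℝ × (ℝ × ℝ) => ![p.2.1, p.2.1 + p.2.2, p.1] := by fun_prop
  have hg₂ : Measurable fun p : ℝ × (ℝ × ℝ) => ![p.2.1, p.1, p.2.1 + p.2.2] := by fun_prop
  have hg₃ : Measurable fun p : ℝ × (ℝ × ℝ) => ![p.1, p.2.1, p.2.1 + p.2.2] := by fun_prop
  have hgC : Measurable fun p : ℝ × (ℝ × ℝ) => ![p.1, p.2.1, p.2.2] := by fun_prop
  set B₁ := (Λ.prod (Λ.prod Q₂)).map fun p : ℝ × (ℝ × ℝ) => ![p.2.1, p.2.1 + p.2.2, p.1] with hB₁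
  set B₂ := (Λ.prod (Λ.prod Q₂)).map fun p : ℝ × (ℝ × ℝ) => ![p.2.1, p.1, p.2.1 + p.2.2] with hB₂
  set B₃ := (Λ.prod (Λ.prod Q₂)).map fun p : ℝ × (ℝ × ℝ) => ![p.1, p.2.1, p.2.1 + p.2.2] with hB₃
  set C := (Λ.prod (Λ.prod Λ)).map fun p : ℝ × (ℝ × ℝ) => ![p.1, p.2.1, p.2.2] with hC
  have hprod3 : ∀ {μ₁ μ₂ μ₃ : Measure ℝ} [SFinite μ₁] [SFinite μ₂] [SFinite μ₃]
      {g : ℝ × (ℝ × ℝ) → Fin 3 → ℝ} (_ : Measurable g) {G : (Fin 3 → ℝ) → ℝ≥0∞} (_ : Measurable G),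
      ∫⁻ x, G x ∂((μ₁.prod (μ₂.prod μ₃)).map g)
        = ∫⁻ x, ∫⁻ y, ∫⁻ z, G (g (x, y, z)) ∂μ₃ ∂μ₂ ∂μ₁ := by
    intro μ₁ μ₂ μ₃ _ _ _ g hg G hG
    have hGg : Measurable fun p => G (g p) := hG.comp hg
    rw [lintegral_map hG hg, lintegral_prod _ hGg.aemeasurable]
    exact lintegral_congr fun x => lintegral_prod _ (hGg.comp measurable_prodMk_left).aemeasurable
  -- Writing `α₃` as a sum of positive measures makes `F` integrable against each of them, so that
  -- the real integrals can be split.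
  have hα₃ : α₃ = A + M • B₁ + M • B₂ + M • B₃ + M ^ 3 • C := by
    refine Measure.ext_of_lintegral _ fun G hG => ?_
    have hGA : Measurable fun p : ℝ × (ℝ × ℝ) => G ![p.1, p.1 + p.2.1, p.1 + p.2.2] := hG.comp hgA
    simp only [lintegral_add_measure, lintegral_smul_measure, smul_eq_mul]
    rw [h₃ G hG, hB₁, hB₂, hB₃, hC, hprod3 hg₁ hG, hprod3 hg₂ hG, hprod3 hg₃ hG, hprod3 hgC hG, hA,
      lintegral_map hG hgA, lintegral_prod _ hGA.aemeasurable]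
  -- the lower order terms
  have hlow : ∀ {g : (Fin 1 → ℝ) × (Fin 2 → ℝ) → Fin 3 → ℝ} (_ : Measurable g)
      {B : Measure (Fin 3 → ℝ)}
      (_ : ∀ G : (Fin 3 → ℝ) → ℝ≥0∞, Measurable G → ∫⁻ x, G x ∂B
        = ∫⁻ y, ∫⁻ t, ∫⁻ τ, G (g (![y], ![t, t + τ])) ∂Q₂ ∂Λ ∂Λ)
      (_ : ∀ G : (Fin 3 → ℝ) → ℝ≥0∞, Measurable G → ∫⁻ x, G x ∂C
        = ∫⁻ y, ∫⁻ x, ∫⁻ x', G (g (![y], ![x, x'])) ∂Λ ∂Λ ∂Λ) (_ : M • B + M ^ 3 • C ≤ α₃),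
      ∫ y, ∫ x, F (g (y, x)) ∂α₂ ∂α₁ = ∫ x, F x ∂(M • B) + ∫ x, F x ∂(M ^ 3 • C) := by
    intro g hg B hB hC' hle
    have hmeas : (α₁.prod α₂).map g = M • B + M ^ 3 • C := by
      refine Measure.ext_of_lintegral _ fun G hG => ?_
      have hGg : Measurable fun p => G (g p) := hG.comp hg
      rw [lintegral_map hG hg, lintegral_prod _ hGg.aemeasurable, h₁ _ hGg.lintegral_prod_right']
      simp only [lintegral_add_measure, lintegral_smul_measure, smul_eq_mul]
      rw [hB G hG, hC' G hG]
      have h4 : ∀ y : ℝ, ∫⁻ x, G (g (![y], x)) ∂α₂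
          = ∫⁻ t, ∫⁻ τ, G (g (![y], ![t, t + τ])) ∂Q₂ ∂Λ
            + M ^ 2 * ∫⁻ x, ∫⁻ x', G (g (![y], ![x, x'])) ∂Λ ∂Λ := fun y =>
        h₂ _ (hGg.comp measurable_prodMk_left)
      simp_rw [h4]
      have hm1 : Measurable fun p : (ℝ × ℝ) × ℝ => G (g (![p.1.1], ![p.1.2, p.2])) :=
        hGg.comp (by fun_prop)
      have hm2 : Measurable fun y => ∫⁻ x, ∫⁻ x', G (g (![y], ![x, x'])) ∂Λ ∂Λ :=
        Measurable.lintegral_prod_right' (f := fun p : ℝ × ℝ =>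
          ∫⁻ x', G (g (![p.1], ![p.2, x'])) ∂Λ)
          hm1.lintegral_prod_right'
      rw [lintegral_add_right _ (hm2.const_mul _), lintegral_const_mul _ hm2, mul_add, ← mul_assoc]
      ring
    have hi : Integrable F (M • B + M ^ 3 • C) := hint.mono_measure hle
    have hi' : Integrable (fun p => F (g p)) (α₁.prod α₂) := by
      rw [← hmeas] at hi
      exact hi.comp_measurable hg
    rw [← integral_prod _ hi', ← integral_map hg.aemeasurable hF.aestronglyMeasurable, hmeas,
      integral_add_measure (hi.mono_measure (Measure.le_add_right le_rfl))
        (hi.mono_measure (Measure.le_add_left le_rfl))]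
  have hCG : ∀ G : (Fin 3 → ℝ) → ℝ≥0∞, Measurable G → ∫⁻ x, G x ∂C
      = ∫⁻ x, ∫⁻ y, ∫⁻ z, G ![x, y, z] ∂Λ ∂Λ ∂Λ := fun G hG => hprod3 hgC hG
  have hm3 : ∀ {G : (Fin 3 → ℝ) → ℝ≥0∞}, Measurable G →
      Measurable fun p : (ℝ × ℝ) × ℝ => G ![p.1.1, p.1.2, p.2] := fun hG => hG.comp (by fun_prop)
  have hm3' : ∀ {G : (Fin 3 → ℝ) → ℝ≥0∞}, Measurable G →
      Measurable fun p : (ℝ × ℝ) × ℝ => G ![p.1.1, p.2, p.1.2] := fun hG => hG.comp (by fun_prop)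
  have e₃ := hlow (g := fun p => ![p.1 0, p.2 0, p.2 1]) (by fun_prop) (B := B₃)
    (fun G hG => hprod3 hg₃ hG) hCG (by
      rw [hα₃]; exact add_le_add (Measure.le_add_left le_rfl) le_rfl)
  have e₂ := hlow (g := fun p => ![p.2 0, p.1 0, p.2 1]) (by fun_prop) (B := B₂)
    (fun G hG => hprod3 hg₂ hG) (fun G hG => by
      rw [hCG G hG]
      exact lintegral_lintegral_swap (hm3 hG).lintegral_prod_right'.aemeasurable) (by
      rw [hα₃]
      exact add_le_add (Measure.le_add_right (Measure.le_add_left le_rfl)) le_rfl)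
  have e₁ := hlow (g := fun p => ![p.2 0, p.2 1, p.1 0]) (by fun_prop) (B := B₁)
    (fun G hG => hprod3 hg₁ hG) (fun G hG => by
      rw [hCG G hG]
      have h5 : ∀ x, ∫⁻ y, ∫⁻ z, G ![x, y, z] ∂Λ ∂Λ = ∫⁻ z, ∫⁻ y, G ![x, y, z] ∂Λ ∂Λ := fun x =>
        lintegral_lintegral_swap (f := fun y z => G ![x, y, z])
          (hG.comp (by fun_prop : Measurable fun p : ℝ × ℝ => ![x, p.1, p.2])).aemeasurable
      simp_rw [h5]
      exact lintegral_lintegral_swap (hm3' hG).lintegral_prod_right'.aemeasurable) (by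
      rw [hα₃]
      exact add_le_add (Measure.le_add_right (Measure.le_add_right (Measure.le_add_left le_rfl)))
        le_rfl)
  have e₀ : ∫ x, ∫ y, ∫ z, F ![x 0, y 0, z 0] ∂α₁ ∂α₁ ∂α₁ = ∫ x, F x ∂(M ^ 3 • C) := by
    have hg : Measurable fun p : (Fin 1 → ℝ) × (Fin 1 → ℝ) × (Fin 1 → ℝ) =>
      ![p.1 0, p.2.1 0, p.2.2 0] := by fun_prop
    have hmeas : (α₁.prod (α₁.prod α₁)).map (fun p => ![p.1 0, p.2.1 0, p.2.2 0]) = M ^ 3 • C := by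
      refine Measure.ext_of_lintegral _ fun G hG => ?_
      have hGg : Measurable fun p : (Fin 1 → ℝ) × (Fin 1 → ℝ) × (Fin 1 → ℝ) =>
        G ![p.1 0, p.2.1 0, p.2.2 0] := hG.comp hg
      have hm1 : Measurable fun p : (ℝ × ℝ) × (Fin 1 → ℝ) => G ![p.1.1, p.1.2, p.2 0] :=
        hG.comp (by fun_prop)
      rw [lintegral_map hG hg, lintegral_prod _ hGg.aemeasurable, h₁ _ hGg.lintegral_prod_right',
        lintegral_smul_measure, hCG G hG]
      have h6 : ∀ x : ℝ, ∫⁻ q : (Fin 1 → ℝ) × (Fin 1 → ℝ), G ![x, q.1 0, q.2 0] ∂(α₁.prod α₁)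
          = M * (M * ∫⁻ y, ∫⁻ z, G ![x, y, z] ∂Λ ∂Λ) := by
        intro x
        have hx : Measurable fun q : (Fin 1 → ℝ) × (Fin 1 → ℝ) => G ![x, q.1 0, q.2 0] :=
          hG.comp (by fun_prop)
        have hx2 : Measurable fun q : ℝ × ℝ => G ![x, q.1, q.2] := hG.comp (by fun_prop)
        rw [lintegral_prod _ hx.aemeasurable, h₁ _ hx.lintegral_prod_right']
        have h7 : ∀ y : ℝ, ∫⁻ z, G ![x, y, z 0] ∂α₁ = M * ∫⁻ z, G ![x, y, z] ∂Λ := fun y =>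
          h₁ (fun z => G ![x, y, z 0]) (hG.comp (by fun_prop))
        have h8 : ∫⁻ y, ∫⁻ z, G ![x, y, z 0] ∂α₁ ∂Λ = M * ∫⁻ y, ∫⁻ z, G ![x, y, z] ∂Λ ∂Λ := by
          simp_rw [h7]
          exact lintegral_const_mul _ hx2.lintegral_prod_right'
        rw [← h8]
        rfl
      have h9 : ∫⁻ x : ℝ, ∫⁻ q : (Fin 1 → ℝ) × (Fin 1 → ℝ), G ![x, q.1 0, q.2 0] ∂(α₁.prod α₁) ∂Λ
          = M * (M * ∫⁻ x, ∫⁻ y, ∫⁻ z, G ![x, y, z] ∂Λ ∂Λ ∂Λ) := by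
        simp_rw [h6]
        have hm : Measurable fun x => ∫⁻ y, ∫⁻ z, G ![x, y, z] ∂Λ ∂Λ :=
          Measurable.lintegral_prod_right' (f := fun p : ℝ × ℝ => ∫⁻ z, G ![p.1, p.2, z] ∂Λ)
            (hm3 hG).lintegral_prod_right'
        rw [lintegral_const_mul _ (hm.const_mul _), lintegral_const_mul _ hm]
      calc _ = M * ∫⁻ x : ℝ, ∫⁻ q : (Fin 1 → ℝ) × (Fin 1 → ℝ), G ![x, q.1 0, q.2 0]
          ∂(α₁.prod α₁) ∂Λ :=
            rfl
        _ = _ := by rw [h9, smul_eq_mul]; ring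
    have hi : Integrable F (M ^ 3 • C) := hint.mono_measure (by
      rw [hα₃]; exact Measure.le_add_left le_rfl)
    have hi' : Integrable (fun p : (Fin 1 → ℝ) × (Fin 1 → ℝ) × (Fin 1 → ℝ) =>
        F ![p.1 0, p.2.1 0, p.2.2 0]) (α₁.prod (α₁.prod α₁)) := by
      rw [← hmeas] at hi
      exact hi.comp_measurable hg
    rw [← hmeas, integral_map hg.aemeasurable hF.aestronglyMeasurable, integral_prod _ hi']
    refine integral_congr_ae ?_
    filter_upwards [hi'.prod_right_ae] with x hx
    exact (integral_prod _ hx).symm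
  have hiA : Integrable F A := hint.mono_measure (by
    rw [hα₃]
    exact Measure.le_add_right (Measure.le_add_right (Measure.le_add_right
      (Measure.le_add_right le_rfl))))
  have eA : ∫ t, ∫ τ, F ![t, t + τ.1, t + τ.2] ∂Q₃ ∂Λ = ∫ x, F x ∂A := by
    rw [hA, integral_map hgA.aemeasurable hF.aestronglyMeasurable]
    exact (integral_prod _ (hiA.comp_measurable hgA)).symm
  have i₁ : Integrable F (A + M • B₁ + M • B₂ + M • B₃ + M ^ 3 • C) := by rwa [← hα₃]
  have i₂ := integrable_add_measure.1 i₁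
  have i₃ := integrable_add_measure.1 i₂.1
  have i₄ := integrable_add_measure.1 i₃.1
  have i₅ := integrable_add_measure.1 i₄.1
  -- Each `M • B` cancels once, and `M ^ 3 • C` occurs `1 - 3 + 2 = 0` times; only `A` survives.
  rw [e₀, e₁, e₂, e₃, eA, hα₃, integral_add_measure i₂.1 i₂.2, integral_add_measure i₃.1 i₃.2,
    integral_add_measure i₄.1 i₄.2, integral_add_measure i₅.1 i₅.2]
  ring

end Cumulant

/-! ### The third cumulant density of the branching-cluster process -/

instance isLocallyFiniteMeasure_ofReal_smul_volume (ν : ℝ) :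
    IsLocallyFiniteMeasure (ENNReal.ofReal ν • (volume : Measure ℝ)) :=
  inferInstanceAs (IsLocallyFiniteMeasure (ν.toNNReal • (volume : Measure ℝ)))

section MarkLaw
variable {m : ℝ} {φ : ℝ → ℝ} {μ : Measure ℝ}

lemma IsEvenDensityOf.isProbabilityMeasure (hφ : IsEvenDensityOf φ μ) :
    IsProbabilityMeasure (volume.withDensity fun x => ENNReal.ofReal (φ x)) :=
  ⟨by rw [withDensity_apply _ MeasurableSet.univ, Measure.restrict_univ, hφ.lintegral_eq_one]⟩

lemma map_neg_withDensity (f : ℝ → ℝ≥0∞) :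
    (volume.withDensity f).map (fun x => -x) = volume.withDensity fun x => f (-x) := by
  ext s hs
  rw [Measure.map_apply measurable_neg hs, withDensity_apply _ (measurable_neg hs),
    withDensity_apply _ hs, ← lintegral_indicator (measurable_neg hs), ← lintegral_indicator hs,
    ← lintegral_neg_eq_self]
  refine lintegral_congr fun x => ?_
  by_cases hx : x ∈ s
  · rw [Set.indicator_of_mem hx, Set.indicator_of_mem (by simpa using hx)]
  · rw [Set.indicator_of_notMem hx, Set.indicator_of_notMem (by simpa using hx)]

lemma IsEvenDensityOf.map_neg (hφ : IsEvenDensityOf φ μ) :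
    (volume.withDensity fun x => ENNReal.ofReal (φ x)).map (fun x => -x)
      = volume.withDensity fun x => ENNReal.ofReal (φ x) := by
  rw [map_neg_withDensity]
  simp only [hφ.even]

lemma map_fst_markLaw (hφ : IsEvenDensityOf φ μ) :
    (markLaw m φ).map Prod.fst = poissonMeasure m.toNNReal := by
  have := hφ.isProbabilityMeasure
  rw [markLaw, Measure.map_fst_prod, measure_univ, one_smul]

lemma map_snd_markLaw_absolutelyContinuous (hφ : IsEvenDensityOf φ μ) :
    (markLaw m φ).map Prod.snd ≪ volume := by
  have := hφ.isProbabilityMeasure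
  rw [markLaw, Measure.map_snd_prod, measure_univ, one_smul]
  exact withDensity_absolutelyContinuous _ _

lemma map_neg_markLaw (hφ : IsEvenDensityOf φ μ) :
    (markLaw m φ).map (fun p => (p.1, -p.2)) = markLaw m φ := by
  have := hφ.isProbabilityMeasure
  have h := Measure.map_prod_map (poissonMeasure m.toNNReal)
    (volume.withDensity fun x => ENNReal.ofReal (φ x)) measurable_id
    (measurable_neg : Measurable fun x : ℝ => -x)
  rw [Measure.map_id, hφ.map_neg] at h
  exact h.symm

end MarkLaw

lemma relMeasure_relTriple_absolutelyContinuous {β : Measure (ℕ × ℝ)} [IsProbabilityMeasure β]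
    (hβ : β.map Prod.snd ≪ volume) : relMeasure β relTriple ≪ volume := by
  refine Measure.absolutelyContinuous_sum_left fun V => ?_
  refine ((withDensity_absolutelyContinuous _ _).map (measurable_relTriple V)).trans ?_
  refine map_relPos_absolutelyContinuous hβ ?_ ?_ ?_ <;>
    exact fun h => absurd (V.injective h) (by decide)

/-- Reversing all displacements preserves the law of the marks and the set of vertices that occur,
and negates relative positions. This symmetry is what makes the bispectrum real. -/
lemma map_neg_relMeasure_relTriple {β : Measure (ℕ × ℝ)} [IsProbabilityMeasure β]
    (hβ : β.map (fun p => (p.1, -p.2)) = β) :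
    (relMeasure β relTriple).map (fun τ => -τ) = relMeasure β relTriple := by
  refine Measure.ext_of_lintegral _ fun F hF => ?_
  have hF' : Measurable fun τ : ℝ × ℝ => F (-τ) := hF.comp measurable_neg
  rw [lintegral_map hF measurable_neg, lintegral_relMeasure β measurable_relTriple hF,
    lintegral_relMeasure β measurable_relTriple hF']
  refine tsum_congr fun V => ?_
  nth_rewrite 1 [← map_flipMarks hβ]
  have hm : Measurable fun k => (∏ i, alive (V i) k) * F (-relTriple V k) :=
    (measurable_prod_alive V).mul (hF.comp (measurable_relTriple V).neg)
  refine (lintegral_map hm measurable_flipMarks).trans (lintegral_congr fun k => ?_)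
  simp only [alive_flipMarks, relTriple, relPos, pos_flipMarks]
  congr 3
  simp only [Prod.neg_mk]
  congr 1 <;> ring

section Density
variable {Ω : Type*} [MeasurableSpace Ω] {P : Measure Ω} [IsProbabilityMeasure P] {ν m : ℝ}
  {φ : ℝ → ℝ} {U : ℕ → Ω → ℝ} {K : ℕ × List ℕ → Ω → ℕ} {D : ℕ × List ℕ → Ω → ℝ}

lemma IsBranchingClusterProcess.isMomentOne [IsProbabilityMeasure (markLaw m φ)]
    (hX : IsBranchingClusterProcess P ν m φ U K D) :
    IsMomentOne (ENNReal.ofReal ν • volume) (∫⁻ k, clusterSize k ∂(clusterLaw (markLaw m φ)))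
      ((clusterPoints U K D).factorialMoment P 1) := by
  intro F hF
  rw [hX.lintegral_factorialMoment_one hF, patternMoment_id hF, pow_one, lintegral_pi_fin_one _ hF]

lemma IsBranchingClusterProcess.isMomentTwo [IsProbabilityMeasure (markLaw m φ)]
    (hX : IsBranchingClusterProcess P ν m φ U K D) :
    IsMomentTwo (ENNReal.ofReal ν • volume) (∫⁻ k, clusterSize k ∂(clusterLaw (markLaw m φ)))
      (relMeasure (markLaw m φ) relPair) ((clusterPoints U K D).factorialMoment P 2) := by
  intro F hF
  rw [hX.lintegral_factorialMoment_two hF, patternMoment_id hF, patternMoment_pair hF,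
    lintegral_pi_fin_two _ hF]

lemma IsBranchingClusterProcess.isMomentThree [IsProbabilityMeasure (markLaw m φ)]
    (hX : IsBranchingClusterProcess P ν m φ U K D) :
    IsMomentThree (ENNReal.ofReal ν • volume) (∫⁻ k, clusterSize k ∂(clusterLaw (markLaw m φ)))
      (relMeasure (markLaw m φ) relPair) (relMeasure (markLaw m φ) relTriple)
      ((clusterPoints U K D).factorialMoment P 3) := by
  intro F hF
  have h1 : (![0, 1, 0] : Fin 3 → Fin 2) = ![0, 0, 1] ∘ (Equiv.swap 1 2 : Equiv.Perm (Fin 3)) := by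
    decide
  have h2 : (![1, 0, 0] : Fin 3 → Fin 2)
      = ![0, 0, 1] ∘ ((finRotate 3).symm : Equiv.Perm (Fin 3)) := by
    decide
  have hs : ∀ σ : Equiv.Perm (Fin 3), Measurable fun x : Fin 3 → ℝ => F (x ∘ σ) := fun σ =>
    hF.comp (measurable_pi_lambda _ fun i => measurable_pi_apply _)
  rw [hX.lintegral_factorialMoment_three hF, patternMoment_id hF, patternMoment_triple hF,
    lintegral_pi_fin_three _ hF, h1, h2, patternMoment_comp_perm, patternMoment_comp_perm,
    patternMoment_pair_single hF, patternMoment_pair_single (hs _),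
    patternMoment_pair_single (hs _)]
  have e1 : ∀ a b c : ℝ, ![a, b, c] ∘ (Equiv.swap 1 2 : Equiv.Perm (Fin 3)) = ![a, c, b] := by
    intro a b c
    funext i
    fin_cases i <;> rfl
  have e2 : ∀ a b c : ℝ, ![a, b, c] ∘ ((finRotate 3).symm : Equiv.Perm (Fin 3)) = ![c, a, b] := by
    intro a b c
    funext i
    fin_cases i <;> rfl
  simp only [e1, e2]

/-- The density of the reduced third factorial cumulant measure. -/
def cumulantDensity (ν m : ℝ) (φ : ℝ → ℝ) (τ : ℝ × ℝ) : ℝ :=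
  ν * ((relMeasure (markLaw m φ) relTriple).rnDeriv volume τ).toReal

lemma isFiniteMeasure_relMeasure {β : Measure (ℕ × ℝ)} [IsProbabilityMeasure β] {r : ℝ≥0}
    (hβ : β.map Prod.fst = poissonMeasure r) (hr : r < 1) {E : Type*} [MeasurableSpace E] {n : ℕ}
    {T : (Fin n → List ℕ) → ClusterMarks → E} (hT : ∀ V, Measurable (T V)) :
    IsFiniteMeasure (relMeasure β T) :=
  ⟨(relMeasure_univ_le β hT).trans_lt (lintegral_clusterSize_pow_lt_top hβ hr n)⟩

/-- The cumulant has collapsed to `ν` times the measure of relative triples; finiteness of that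
measure gives an `L¹` derivative and absolute continuity makes the derivative a density. -/
theorem IsBranchingClusterProcess.hasThirdCumulantDensity
    (hX : IsBranchingClusterProcess P ν m φ U K D) (hν : 0 < ν) (hm : m < 1) {μ : Measure ℝ}
    (hφ : IsEvenDensityOf φ μ) :
    (clusterPoints U K D).HasThirdCumulantDensity P (cumulantDensity ν m φ) := by
  have := hX.isProbabilityMeasure_markLaw
  have hr : m.toNNReal < 1 := by rwa [Real.toNNReal_lt_one]
  have hfst := map_fst_markLaw (m := m) hφ
  have := isFiniteMeasure_relMeasure hfst hr measurable_relPair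
  have := isFiniteMeasure_relMeasure hfst hr measurable_relTriple
  have hM : ∫⁻ k, clusterSize k ∂(clusterLaw (markLaw m φ)) ≠ ∞ := by
    simpa using (lintegral_clusterSize_pow_lt_top hfst hr 1).ne
  have hac := relMeasure_relTriple_absolutelyContinuous
    (map_snd_markLaw_absolutelyContinuous (m := m) hφ)
  refine ⟨hX.isMomentOne.isLocallyFiniteMeasure hM, hX.isMomentTwo.isLocallyFiniteMeasure hM,
    hX.isMomentThree.isLocallyFiniteMeasure hM, Measure.integrable_toReal_rnDeriv.const_mul ν, ?_⟩
  intro F hF hb hc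
  refine (cumulant_eq_of_moments hX.isMomentOne hX.isMomentTwo hX.isMomentThree hM hF hb hc).trans ?_
  rw [integral_smul_measure, ENNReal.toReal_ofReal hν.le, smul_eq_mul, ← integral_const_mul]
  refine integral_congr_ae (Filter.Eventually.of_forall fun t => ?_)
  change ν * ∫ τ, F ![t, t + τ.1, t + τ.2] ∂(relMeasure (markLaw m φ) relTriple) = _
  rw [← integral_rnDeriv_smul hac, ← integral_const_mul]
  refine integral_congr_ae (Filter.Eventually.of_forall fun τ => ?_)
  simp only [cumulantDensity, smul_eq_mul]
  ring

/-- The bispectrum is `ν` times the Fourier transform of a finite measure invariant under `τ ↦ -τ`,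
hence equal to its own conjugate. Working with the measure avoids choosing an even version of the
density. -/
lemma bispectrum_cumulantDensity_im (hm : m < 1) {μ : Measure ℝ} (hφ : IsEvenDensityOf φ μ)
    (w₁ w₂ : ℝ) : (bispectrum (cumulantDensity ν m φ) w₁ w₂).im = 0 := by
  have := hφ.isProbabilityMeasure
  have hpm : IsProbabilityMeasure (markLaw m φ) := by unfold markLaw; infer_instance
  have hr : m.toNNReal < 1 := by rwa [Real.toNNReal_lt_one]
  have := isFiniteMeasure_relMeasure (map_fst_markLaw (m := m) hφ) hr measurable_relTriple
  have hac := relMeasure_relTriple_absolutelyContinuous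
    (map_snd_markLaw_absolutelyContinuous (m := m) hφ)
  have hneg := map_neg_relMeasure_relTriple (map_neg_markLaw (m := m) hφ)
  set Q := relMeasure (markLaw m φ) relTriple with hQ
  set e : ℝ × ℝ → ℂ := fun τ => Complex.exp (-Complex.I * ((w₁ * τ.1 + w₂ * τ.2 : ℝ) : ℂ)) with he
  have h1 : bispectrum (cumulantDensity ν m φ) w₁ w₂ = ν * ∫ τ, e τ ∂Q := by
    rw [← integral_rnDeriv_smul hac, ← integral_const_mul, bispectrum]
    refine integral_congr_ae (Filter.Eventually.of_forall fun τ => ?_)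
    simp only [cumulantDensity, he, Complex.real_smul]
    push_cast
    ring
  have h2 : ∫ τ, e τ ∂Q = ∫ τ, e (-τ) ∂Q := by
    conv_lhs => rw [← hneg]
    refine integral_map measurable_neg.aemeasurable ?_
    exact Continuous.aestronglyMeasurable (by rw [he]; fun_prop)
  have h3 : ∀ τ, e (-τ) = (starRingEnd ℂ) (e τ) := by
    intro τ
    simp only [he, ← Complex.exp_conj, map_mul, map_neg, Complex.conj_I, Complex.conj_ofReal,
      Prod.fst_neg, Prod.snd_neg]
    congr 1
    push_cast
    ring
  have h4 : (starRingEnd ℂ) (∫ τ, e τ ∂Q) = ∫ τ, e τ ∂Q := by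
    rw [← integral_conj, h2]
    simp_rw [h3]
  rw [h1, Complex.mul_im, Complex.conj_eq_iff_im.1 h4]
  simp

end Density

open Filter Topology BoundedContinuousFunction

/-! ### The exponential `x ↦ exp (-x)` on `[0, ∞]` -/

/-- The function `x ↦ exp (-x)` on `[0, ∞]`. -/
def expNeg (x : ℝ≥0∞) : ℝ≥0∞ := EReal.exp (-(x : EReal))

lemma continuous_expNeg : Continuous expNeg :=
  ENNReal.continuous_exp.comp (continuous_neg.comp continuous_coe_ennreal_ereal)

lemma measurable_expNeg : Measurable expNeg := continuous_expNeg.measurable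

lemma expNeg_zero : expNeg 0 = 1 := by simp [expNeg]

lemma expNeg_le_one (x : ℝ≥0∞) : expNeg x ≤ 1 := by
  rw [expNeg, EReal.exp_le_one_iff, EReal.neg_le, neg_zero]
  exact EReal.coe_ennreal_nonneg x

lemma expNeg_ne_top (x : ℝ≥0∞) : expNeg x ≠ ∞ := ((expNeg_le_one x).trans_lt ENNReal.one_lt_top).ne

lemma expNeg_injective : Function.Injective expNeg := fun _ _ h =>
  EReal.coe_ennreal_injective (neg_injective (EReal.exp_strictMono.injective h))

lemma expNeg_add (x y : ℝ≥0∞) : expNeg (x + y) = expNeg x * expNeg y := by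
  have hne : ∀ z : ℝ≥0∞, EReal.exp (z : EReal) ≠ 0 := fun z => by
    rw [Ne, EReal.exp_eq_zero_iff]
    exact EReal.coe_ennreal_ne_bot z
  simp only [expNeg, EReal.exp_neg, EReal.coe_ennreal_add, EReal.exp_add]
  exact ENNReal.mul_inv (Or.inl (hne x)) (Or.inr (hne y))

lemma expNeg_sum {ι : Type*} (s : Finset ι) (f : ι → ℝ≥0∞) :
    expNeg (∑ i ∈ s, f i) = ∏ i ∈ s, expNeg (f i) := by
  classical
  induction s using Finset.induction_on with
  | empty => simp [expNeg_zero]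
  | insert a s ha ih => rw [Finset.sum_insert ha, Finset.prod_insert ha, expNeg_add, ih]

/-- Continuity of the exponential up to and including `∞`, where it vanishes, makes any summability
assumption unnecessary; likewise test functions need not be integrable below. -/
lemma tendsto_prod_expNeg (f : ℕ → ℝ≥0∞) :
    Tendsto (fun n => ∏ i ∈ Finset.range n, expNeg (f i)) atTop (𝓝 (expNeg (∑' i, f i))) := by
  simp_rw [← expNeg_sum]
  exact (continuous_expNeg.tendsto _).comp (ENNReal.tendsto_nat_tsum f)

/-- The function `y ↦ -log y` on `[0, 1]`, with values in `[0, ∞]`. -/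
def negLog (y : ℝ≥0∞) : ℝ≥0∞ := (-(ENNReal.log y)).toENNReal

lemma measurable_negLog : Measurable negLog :=
  measurable_ereal_toENNReal.comp (measurable_neg.comp ENNReal.measurable_log)

lemma expNeg_negLog {y : ℝ≥0∞} (hy : y ≤ 1) : expNeg (negLog y) = y := by
  have h : 0 ≤ -(ENNReal.log y) := by
    rw [EReal.le_neg, neg_zero]
    exact ENNReal.log_le_zero_iff.2 hy
  rw [expNeg, negLog, EReal.coe_toENNReal h, neg_neg, ENNReal.exp_log]

/-! ### Laplace functionals determine the law of a random measure -/

section Uniqueness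

/-- The exponential functions `x ↦ exp (-∑ c_i x_i)` on `[0, ∞]^J`. -/
def expChar {J : Type*} [Fintype J] (c : J → ℕ) : (J → ℝ≥0∞) →ᵇ ℝ :=
  BoundedContinuousFunction.ofNormedAddCommGroup
    (fun x => (expNeg (∑ i, (c i : ℝ≥0∞) * x i)).toReal)
    (ENNReal.continuousOn_toReal.comp_continuous
      (continuous_expNeg.comp (continuous_finsetSum _ fun i _ =>
        ENNReal.continuous_const_mul (ENNReal.natCast_ne_top _) |>.comp (continuous_apply i)))
      fun x => expNeg_ne_top _) 1 fun x => by
      rw [Real.norm_of_nonneg ENNReal.toReal_nonneg]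
      exact ENNReal.toReal_mono ENNReal.one_ne_top (expNeg_le_one _)

lemma expChar_apply {J : Type*} [Fintype J] (c : J → ℕ) (x : J → ℝ≥0∞) :
    expChar c x = (expNeg (∑ i, (c i : ℝ≥0∞) * x i)).toReal := rfl

/-- The algebra spanned by the exponential functions. -/
def expAlgebra (J : Type*) [Fintype J] : StarSubalgebra ℝ ((J → ℝ≥0∞) →ᵇ ℝ) where
  toSubalgebra := Algebra.adjoin ℝ (Set.range expChar)
  star_mem' := by
    intro f hf
    have : star f = f := by ext x; simp
    exact this.symm ▸ hf

/-- The exponentials separate the points of the Polish space `[0, ∞]^J` and are closed under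
multiplication, so the algebra they generate is their linear span and determines finite measures.
Natural coefficients already suffice for this. -/
lemma ext_of_forall_lintegral_expNeg {J : Type*} [Fintype J] {μ μ' : Measure (J → ℝ≥0∞)}
    [IsFiniteMeasure μ] [IsFiniteMeasure μ']
    (h : ∀ c : J → ℕ, ∫⁻ x, expNeg (∑ i, (c i : ℝ≥0∞) * x i) ∂μ
      = ∫⁻ x, expNeg (∑ i, (c i : ℝ≥0∞) * x i) ∂μ') : μ = μ' := by
  have hint : ∀ c : J → ℕ, ∫ x, expChar c x ∂μ = ∫ x, expChar c x ∂μ' := by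
    intro c
    have hm : Measurable fun x : J → ℝ≥0∞ => expNeg (∑ i, (c i : ℝ≥0∞) * x i) :=
      measurable_expNeg.comp (Finset.measurable_sum _ fun i _ =>
        (measurable_pi_apply i).const_mul _)
    have hlt : ∀ x : J → ℝ≥0∞, expNeg (∑ i, (c i : ℝ≥0∞) * x i) < ∞ := fun x =>
      (expNeg_ne_top _).lt_top
    simp only [expChar_apply]
    rw [integral_toReal hm.aemeasurable (Eventually.of_forall hlt),
      integral_toReal hm.aemeasurable (Eventually.of_forall hlt), h c]
  have hmul : ∀ f ∈ Submonoid.closure (Set.range (expChar (J := J))),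
      f ∈ Set.range (expChar (J := J)) := by
    intro f hf
    induction hf using Submonoid.closure_induction with
    | mem f hf => exact hf
    | one => exact ⟨0, by ext x; simp [expChar_apply, expNeg_zero]⟩
    | mul f g _ _ hf hg =>
      obtain ⟨c, rfl⟩ := hf
      obtain ⟨d, rfl⟩ := hg
      refine ⟨c + d, ?_⟩
      ext x
      rw [BoundedContinuousFunction.mul_apply]
      simp only [expChar_apply, Pi.add_apply, Nat.cast_add, add_mul, Finset.sum_add_distrib,
        expNeg_add, ENNReal.toReal_mul]
  refine ext_of_forall_mem_subalgebra_integral_eq_of_polish (𝕜 := ℝ) (A := expAlgebra J) ?_ ?_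
  · intro x y hxy
    classical
    obtain ⟨i, hi⟩ := Function.ne_iff.1 hxy
    refine ⟨expChar (Pi.single i 1), ⟨(expChar (Pi.single i 1)).toContinuousMap,
      ⟨expChar (Pi.single i 1), Algebra.subset_adjoin ⟨_, rfl⟩, rfl⟩, rfl⟩, ?_⟩
    have hs : ∀ z : J → ℝ≥0∞, ∑ k, ((Pi.single i 1 : J → ℕ) k : ℝ≥0∞) * z k = z i := by
      intro z
      rw [Finset.sum_eq_single i]
      · simp
      · intro k _ hk
        simp [hk]
      · simp
    intro he
    rw [expChar_apply, expChar_apply, hs, hs] at he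
    exact hi (expNeg_injective
      ((ENNReal.toReal_eq_toReal_iff' (expNeg_ne_top _) (expNeg_ne_top _)).1 he))
  · intro g hg
    have hg' : g ∈ Submodule.span ℝ (Set.range (expChar (J := J))) := by
      have h1 : g ∈ Subalgebra.toSubmodule (Algebra.adjoin ℝ (Set.range (expChar (J := J)))) := hg
      rw [Algebra.adjoin_eq_span] at h1
      exact Submodule.span_mono hmul h1
    clear hg
    induction hg' using Submodule.span_induction with
    | mem f hf =>
      obtain ⟨c, rfl⟩ := hf
      exact hint c
    | zero => simp
    | add f g hf' hg' hf hg =>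
      simp only [BoundedContinuousFunction.add_apply]
      rw [integral_add (f.integrable _) (g.integrable _),
        integral_add (f.integrable _) (g.integrable _), hf, hg]
    | smul a f hf' hf =>
      simp only [BoundedContinuousFunction.smul_apply]
      rw [integral_smul, integral_smul, hf]

/-- The σ-algebra on measures is generated by the evaluations at measurable sets, so
finite-dimensional distributions determine the law. Step functions as test functions give the
Laplace transforms of those distributions. -/
lemma ext_of_laplace {μ μ' : Measure (Measure ℝ)} [IsFiniteMeasure μ] [IsFiniteMeasure μ']
    (h : ∀ f : ℝ → ℝ≥0∞, Measurable f →
      ∫⁻ N, expNeg (∫⁻ x, f x ∂N) ∂μ = ∫⁻ N, expNeg (∫⁻ x, f x ∂N) ∂μ') : μ = μ' := by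
  set Ψ : Measure ℝ → {A : Set ℝ // MeasurableSet A} → ℝ≥0∞ := fun N A => N A.1 with hΨ
  have hΨm : Measurable Ψ := measurable_pi_lambda _ fun A => Measure.measurable_coe A.2
  have hcomap : (inferInstance : MeasurableSpace (Measure ℝ))
      ≤ MeasurableSpace.comap Ψ inferInstance := by
    refine iSup₂_le fun s hs => ?_
    rw [MeasurableSpace.comap_le_iff_le_map]
    intro t ht
    exact ⟨_, (measurable_pi_apply (⟨s, hs⟩ : {A : Set ℝ // MeasurableSet A})) ht, rfl⟩
  have hmap : μ.map Ψ = μ'.map Ψ := by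
    refine IsProjectiveLimit.unique (P := fun J => (μ.map Ψ).map J.restrict)
      (fun J => rfl) fun J => ?_
    refine ext_of_forall_lintegral_expNeg fun c => ?_
    have hm : Measurable fun x : J → ℝ≥0∞ => expNeg (∑ i, (c i : ℝ≥0∞) * x i) :=
      measurable_expNeg.comp (Finset.measurable_sum _ fun i _ =>
        (measurable_pi_apply i).const_mul _)
    have hJ := Finset.measurable_restrict (X := fun _ : {A : Set ℝ // MeasurableSet A} => ℝ≥0∞) J
    have hmJ : Measurable fun x : {A : Set ℝ // MeasurableSet A} → ℝ≥0∞ =>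
        expNeg (∑ i : J, (c i : ℝ≥0∞) * x i.1) :=
      measurable_expNeg.comp (Finset.measurable_sum _ fun i _ =>
        (measurable_pi_apply i.1).const_mul _)
    rw [lintegral_map hm hJ, lintegral_map hm hJ]
    simp only [Finset.restrict]
    rw [lintegral_map hmJ hΨm, lintegral_map hmJ hΨm]
    have hf : ∀ N : Measure ℝ, ∫⁻ x, ∑ i : J, (c i : ℝ≥0∞) * i.1.1.indicator 1 x ∂N
        = ∑ i : J, (c i : ℝ≥0∞) * N i.1.1 := by
      intro N
      rw [lintegral_finsetSum _ fun i _ => (measurable_one.indicator i.1.2).const_mul _]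
      refine Finset.sum_congr rfl fun i _ => ?_
      rw [lintegral_const_mul _ (measurable_one.indicator i.1.2), lintegral_indicator_one i.1.2]
    have h1 := h (fun x => ∑ i : J, (c i : ℝ≥0∞) * i.1.1.indicator 1 x)
      (Finset.measurable_sum _ fun i _ => (measurable_one.indicator i.1.2).const_mul _)
    simp only [hf] at h1
    exact h1.symm
  ext s hs
  obtain ⟨t, ht, rfl⟩ := hcomap s hs
  rw [← Measure.map_apply hΨm ht, hmap, Measure.map_apply hΨm ht]

end Uniqueness

/-! ### The Laplace functional of a Poisson process -/

section Poisson
variable {Ω : Type*} [MeasurableSpace Ω] {P : Measure Ω} [IsProbabilityMeasure P]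
  {Ω' : Type*} [MeasurableSpace Ω'] {P' : Measure Ω'} [IsProbabilityMeasure P']
  {I : Ω → Measure ℝ} {I' : Ω' → Measure ℝ} {Λ : Measure ℝ}

/-- Level sets are disjoint, so their counts are independent. Only `Λ` occurs in the resulting
product, which is all that is needed. The value `0`, whose level set may have infinite intensity,
contributes a factor one. -/
lemma IsPoissonProcess.lintegral_expNeg_simpleFunc (hI : IsPoissonProcess P I Λ)
    (s : SimpleFunc ℝ ℝ≥0∞) (hs : ∀ y, y ≠ 0 → Λ (s ⁻¹' {y}) ≠ ∞) :
    ∫⁻ ω, expNeg (∫⁻ x, s x ∂(I ω)) ∂P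
      = ∏ y ∈ s.range, if y = 0 then 1 else
          ∫⁻ n, expNeg (y * (n : ℝ≥0∞)) ∂(poissonMeasure (Λ (s ⁻¹' {y})).toNNReal) := by
  have hsum : ∀ ω, expNeg (∫⁻ x, s x ∂(I ω)) = ∏ y : s.range, expNeg (y.1 * I ω (s ⁻¹' {y.1})) := by
    intro ω
    rw [SimpleFunc.lintegral_eq_lintegral, SimpleFunc.lintegral, expNeg_sum,
      ← Finset.prod_coe_sort]
  have hm : ∀ y : ℝ≥0∞, Measurable fun x : ℝ≥0∞ => expNeg (y * x) := fun y =>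
    measurable_expNeg.comp (measurable_id.const_mul y)
  have hind := (hI.iIndepFun_fintype (fun y : s.range => s ⁻¹' {y.1})
    (fun y => s.measurableSet_fiber _)
    (fun y y' hy => Disjoint.preimage _ (Set.disjoint_singleton.2
        fun h => hy (Subtype.ext h)))).comp
    (fun y x => expNeg (y.1 * x)) fun y => hm _
  have hprod := lintegral_prod_eq_prod_lintegral_of_indepFun Finset.univ
    (fun (y : s.range) ω => expNeg (y.1 * I ω (s ⁻¹' {y.1}))) hind
    (fun y => (hm _).comp ((Measure.measurable_coe (s.measurableSet_fiber _)).comp hI.measurable))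
  simp_rw [hsum]
  rw [hprod, Finset.prod_coe_sort s.range fun y => ∫⁻ ω, expNeg (y * I ω (s ⁻¹' {y})) ∂P]
  refine Finset.prod_congr rfl fun y _ => ?_
  split_ifs with hy
  · simp [hy, expNeg_zero]
  · exact hI.lintegral_count (s.measurableSet_fiber y) (hs y hy) (hm y)

/-- Monotone convergence for the inner integral, then dominated convergence with bound one for the
outer. -/
lemma tendsto_lintegral_expNeg {E : Type*} [MeasurableSpace E] {N : Ω → Measure E}
    (hN : Measurable N) {f : ℕ → E → ℝ≥0∞} {g : E → ℝ≥0∞} (hf : ∀ n, Measurable (f n))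
    (hmono : Monotone f) (hlim : ∀ x, Tendsto (fun n => f n x) atTop (𝓝 (g x))) :
    Tendsto (fun n => ∫⁻ ω, expNeg (∫⁻ x, f n x ∂(N ω)) ∂P) atTop
      (𝓝 (∫⁻ ω, expNeg (∫⁻ x, g x ∂(N ω)) ∂P)) := by
  refine tendsto_lintegral_of_dominated_convergence (fun _ => 1)
    (fun n => measurable_expNeg.comp ((Measure.measurable_lintegral (hf n)).comp hN))
    (fun n => Eventually.of_forall fun ω => expNeg_le_one _) (by simp)
    (Eventually.of_forall fun ω => (continuous_expNeg.tendsto _).comp ?_)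
  exact lintegral_tendsto_of_tendsto_of_monotone (fun n => (hf n).aemeasurable)
    (Eventually.of_forall fun x n k hnk => hmono hnk x) (Eventually.of_forall hlim)

/-- The usual approximations are cut off to spanning sets of `Λ`, which makes the nonzero level sets
of finite measure and keeps monotonicity. -/
lemma exists_monotone_simpleFunc (Λ : Measure ℝ) [SigmaFinite Λ] {g : ℝ → ℝ≥0∞}
    (hg : Measurable g) :
    ∃ s : ℕ → SimpleFunc ℝ ℝ≥0∞, (∀ n y, y ≠ 0 → Λ (s n ⁻¹' {y}) ≠ ∞) ∧
      (Monotone fun n x => s n x) ∧ ∀ x, Tendsto (fun n => s n x) atTop (𝓝 (g x)) := by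
  refine ⟨fun n => (SimpleFunc.eapprox g n).restrict (spanningSets Λ n), ?_, ?_, ?_⟩
  · intro n y hy
    refine ((measure_mono ?_).trans_lt (measure_spanningSets_lt_top Λ n)).ne
    intro x hx
    by_contra hxs
    refine hy ?_
    rw [← show _ = y from hx, SimpleFunc.restrict_apply _ (measurableSet_spanningSets Λ n),
      Set.indicator_of_notMem hxs]
  · intro n k hnk x
    simp only [SimpleFunc.restrict_apply _ (measurableSet_spanningSets Λ _)]
    refine (Set.indicator_le_indicator_of_subset (monotone_spanningSets Λ hnk)
      (fun _ => zero_le) x).trans ?_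
    exact Set.indicator_le_indicator (SimpleFunc.monotone_eapprox g hnk x)
  · intro x
    refine (SimpleFunc.tendsto_eapprox hg x).congr' ?_
    filter_upwards [eventually_ge_atTop (spanningSetsIndex Λ x)] with n hn
    simp only [SimpleFunc.restrict_apply _ (measurableSet_spanningSets Λ _)]
    rw [Set.indicator_of_mem (mem_spanningSets_of_index_le Λ x hn)]

/-- The Laplace functional of a Poisson process depends on its intensity only. -/
lemma IsPoissonProcess.lintegral_expNeg_congr [SigmaFinite Λ] (hI : IsPoissonProcess P I Λ)
    (hI' : IsPoissonProcess P' I' Λ) {g : ℝ → ℝ≥0∞} (hg : Measurable g) :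
    ∫⁻ ω, expNeg (∫⁻ x, g x ∂(I ω)) ∂P = ∫⁻ ω, expNeg (∫⁻ x, g x ∂(I' ω)) ∂P' := by
  obtain ⟨s, hfin, hmono, hlim⟩ := exists_monotone_simpleFunc Λ hg
  have h1 := tendsto_lintegral_expNeg (P := P) hI.measurable (fun n => (s n).measurable) hmono hlim
  have h2 := tendsto_lintegral_expNeg (P := P') hI'.measurable (fun n => (s n).measurable)
    hmono hlim
  refine tendsto_nhds_unique h1 (h2.congr fun n => ?_)
  rw [hI.lintegral_expNeg_simpleFunc _ (hfin n), hI'.lintegral_expNeg_simpleFunc _ (hfin n)]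

end Poisson

lemma IsPoissonProcess.map_neg {Ω : Type*} [MeasurableSpace Ω] {P : Measure Ω} {I : Ω → Measure ℝ}
    {Λ : Measure ℝ} (hI : IsPoissonProcess P I Λ) (hΛ : Λ.map (fun x => -x) = Λ) :
    IsPoissonProcess P (fun ω => (I ω).map fun x => -x) Λ where
  measurable := (Measure.measurable_map _ measurable_neg).comp hI.measurable
  count A hA hfin := by
    have h1 : Λ ((fun x => -x) ⁻¹' A) = Λ A := by
      rw [← Measure.map_apply measurable_neg hA, hΛ]
    have h2 := hI.count ((fun x => -x) ⁻¹' A) (measurable_neg hA) (by rwa [h1])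
    rw [h1] at h2
    simpa only [Measure.map_apply measurable_neg hA] using h2
  indep n A hA hd := by
    have h := hI.indep n (fun i => (fun x => -x) ⁻¹' (A i)) (fun i => measurable_neg (hA i))
      fun i j hij => (hd hij).preimage _
    simpa only [Measure.map_apply measurable_neg (hA _)] using h

/-! ### The Laplace functional of the branching-cluster process -/

/-- The sum of `f` over the points of the cluster with marks `k` of an immigrant at `u`. -/
def clusterSum (f : ℝ → ℝ≥0∞) (u : ℝ) (k : ClusterMarks) : ℝ≥0∞ :=
  ∑' v, alive v k * f (u + clusterFamily.pos v k)

lemma measurable_clusterSum {f : ℝ → ℝ≥0∞} (hf : Measurable f) :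
    Measurable (Function.uncurry (clusterSum f)) :=
  Measurable.tsum fun v => ((measurable_alive v).comp measurable_snd).mul
    (hf.comp (measurable_fst.add ((measurable_pos_cluster v).comp measurable_snd)))

lemma clusterSum_flipMarks (f : ℝ → ℝ≥0∞) (u : ℝ) (k : ClusterMarks) :
    clusterSum f u (flipMarks k) = clusterSum (fun x => f (-x)) (-u) k := by
  simp only [clusterSum, alive_flipMarks, pos_flipMarks]
  refine tsum_congr fun v => ?_
  congr 2
  ring

/-- Minus the logarithm of the Laplace functional of a cluster whose immigrant is at `u`. -/
def clusterExponent (β : Measure (ℕ × ℝ)) (f : ℝ → ℝ≥0∞) (u : ℝ) : ℝ≥0∞ :=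
  negLog (∫⁻ k, expNeg (clusterSum f u k) ∂(clusterLaw β))

section Exponent
variable {β : Measure (ℕ × ℝ)} [IsProbabilityMeasure β] {f : ℝ → ℝ≥0∞}

lemma measurable_clusterExponent (hf : Measurable f) : Measurable (clusterExponent β f) :=
  measurable_negLog.comp
    (Measurable.lintegral_prod_right' (measurable_expNeg.comp (measurable_clusterSum hf)))

lemma expNeg_clusterExponent (f : ℝ → ℝ≥0∞) (u : ℝ) :
    expNeg (clusterExponent β f u) = ∫⁻ k, expNeg (clusterSum f u k) ∂(clusterLaw β) :=
  expNeg_negLog ((lintegral_mono fun k => expNeg_le_one _).trans (by simp))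

/-- A cluster rooted at `-u`, reflected, is in law a cluster rooted at `u`. -/
lemma clusterExponent_neg (hβ : β.map (fun p => (p.1, -p.2)) = β) (hf : Measurable f) (u : ℝ) :
    clusterExponent β (fun x => f (-x)) (-u) = clusterExponent β f u := by
  have hm : Measurable fun k => expNeg (clusterSum f u k) :=
    measurable_expNeg.comp ((measurable_clusterSum hf).comp measurable_prodMk_left)
  rw [clusterExponent, clusterExponent]
  conv_rhs => rw [← map_flipMarks hβ]
  rw [lintegral_map hm measurable_flipMarks]
  simp only [clusterSum_flipMarks]

/-- For fixed immigrants the clusters are independent, so finite products factor; the infinite sum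
is reached by dominated convergence. -/
lemma lintegral_expNeg_tsum_clusterSum (hf : Measurable f) (u : ℕ → ℝ) :
    ∫⁻ k, expNeg (∑' j, clusterSum f (u j) (k j)) ∂(Measure.infinitePi fun _ : ℕ => clusterLaw β)
      = expNeg (∑' j, clusterExponent β f (u j)) := by
  have hm : ∀ j, Measurable fun k : ClusterMarks => expNeg (clusterSum f (u j) k) := fun j =>
    measurable_expNeg.comp ((measurable_clusterSum hf).comp measurable_prodMk_left)
  refine tendsto_nhds_unique (tendsto_lintegral_of_dominated_convergence
    (F := fun n (k : ℕ → ClusterMarks) => ∏ j ∈ Finset.range n, expNeg (clusterSum f (u j) (k j)))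
    (fun _ => 1) ?_ ?_ (by simp) (Eventually.of_forall fun k => tendsto_prod_expNeg _))
    ((tendsto_prod_expNeg _).congr fun n => ?_)
  · exact fun n => Finset.measurable_prod _ fun j _ => (hm j).comp (measurable_pi_apply j)
  · exact fun n => Eventually.of_forall fun k => Finset.prod_le_one' fun j _ => expNeg_le_one _
  · rw [lintegral_prod_eq_prod_lintegral_of_indepFun _
      (fun j (k : ℕ → ClusterMarks) => expNeg (clusterSum f (u j) (k j)))
      (iIndepFun_infinitePi (P := fun _ : ℕ => clusterLaw β) hm)
      fun j => (hm j).comp (measurable_pi_apply j)]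
    refine Finset.prod_congr rfl fun j _ => ?_
    rw [expNeg_clusterExponent]
    exact ((measurePreserving_eval_infinitePi (fun _ : ℕ => clusterLaw β) j).lintegral_comp
      (hm j)).symm

end Exponent

lemma lintegral_counting_clusterPoints {Ω : Type*} (U : ℕ → Ω → ℝ) (K : ℕ × List ℕ → Ω → ℕ)
    (D : ℕ × List ℕ → Ω → ℝ) {f : ℝ → ℝ≥0∞} (hf : Measurable f) (ω : Ω) :
    ∫⁻ x, f x ∂((clusterPoints U K D).counting ω)
      = ∑' j, clusterSum f (U j ω) (clusterMarks K D ω j) := by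
  rw [PointFamily.counting, lintegral_sum_measure, ENNReal.tsum_prod']
  refine tsum_congr fun j => tsum_congr fun v => ?_
  exact lintegral_indicator_dirac _ _ _ hf

section Reversible
variable {Ω : Type*} [MeasurableSpace Ω] {P : Measure Ω} [IsProbabilityMeasure P] {ν m : ℝ}
  {φ : ℝ → ℝ} {U : ℕ → Ω → ℝ} {K : ℕ × List ℕ → Ω → ℕ} {D : ℕ × List ℕ → Ω → ℝ}

/-- Integrating out the clusters, which are independent of the immigrants, reduces the Laplace
functional of the whole process to that of the immigrants. -/
lemma IsBranchingClusterProcess.lintegral_expNeg_counting [IsProbabilityMeasure (markLaw m φ)]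
    (hX : IsBranchingClusterProcess P ν m φ U K D) {f : ℝ → ℝ≥0∞} (hf : Measurable f) :
    ∫⁻ ω, expNeg (∫⁻ x, f x ∂((clusterPoints U K D).counting ω)) ∂P
      = ∫⁻ ω, expNeg (∫⁻ x, clusterExponent (markLaw m φ) f x
          ∂(Measure.sum fun j => Measure.dirac (U j ω))) ∂P := by
  have hUm : Measurable fun ω j => U j ω := measurable_pi_lambda _ hX.measurable_U
  have hm : Measurable fun p : (ℕ → ℝ) × (ℕ → ClusterMarks) =>
      expNeg (∑' j, clusterSum f (p.1 j) (p.2 j)) :=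
    measurable_expNeg.comp (Measurable.tsum fun j => by
      have hj : Measurable fun p : (ℕ → ℝ) × (ℕ → ClusterMarks) => (p.1 j, p.2 j) :=
        ((measurable_pi_apply j).comp measurable_fst).prodMk
          ((measurable_pi_apply j).comp measurable_snd)
      exact (measurable_clusterSum hf).comp hj)
  have hg := measurable_clusterExponent (β := markLaw m φ) hf
  have hm' : Measurable fun u : ℕ → ℝ => expNeg (∑' j, clusterExponent (markLaw m φ) f (u j)) :=
    measurable_expNeg.comp (Measurable.tsum fun j => hg.comp (measurable_pi_apply j))
  simp_rw [lintegral_counting_clusterPoints U K D hf, lintegral_sum_measure,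
    lintegral_dirac' _ hg]
  have h1 := lintegral_map (μ := P) hm (hUm.prodMk hX.measurable_clusterMarks)
  rw [hX.map_immigrants_clusterMarks, lintegral_prod _ hm.aemeasurable] at h1
  simp only [lintegral_expNeg_tsum_clusterSum hf] at h1
  rw [lintegral_map hm' hUm] at h1
  exact h1.symm

theorem IsBranchingClusterProcess.isReversible (hX : IsBranchingClusterProcess P ν m φ U K D)
    {μ : Measure ℝ} (hφ : IsEvenDensityOf φ μ) :
    IsReversible P (clusterPoints U K D).counting := by
  have := hX.isProbabilityMeasure_markLaw
  have hN : Measurable (clusterPoints U K D).counting :=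
    PointFamily.measurable_counting hX.measurableSet_present hX.measurable_pos
  have hN' : Measurable fun ω => ((clusterPoints U K D).counting ω).map fun x => -x :=
    (Measure.measurable_map _ measurable_neg).comp hN
  have hvol : (ENNReal.ofReal ν • (volume : Measure ℝ)).map (fun x => -x)
      = ENNReal.ofReal ν • volume := by
    rw [Measure.map_smul]
    congr 1
    exact Measure.map_neg_eq_self volume
  refine ⟨hN, ?_⟩
  have := Measure.isProbabilityMeasure_map (μ := P) hN.aemeasurable
  have := Measure.isProbabilityMeasure_map (μ := P) hN'.aemeasurable
  refine ext_of_laplace fun f hf => ?_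
  have hfn : Measurable fun x => f (-x) := hf.comp measurable_neg
  have hL : Measurable fun N : Measure ℝ => expNeg (∫⁻ x, f x ∂N) :=
    measurable_expNeg.comp (Measure.measurable_lintegral hf)
  have hg := measurable_clusterExponent (β := markLaw m φ) hf
  rw [lintegral_map hL hN', lintegral_map hL hN]
  simp_rw [lintegral_map hf measurable_neg]
  rw [hX.lintegral_expNeg_counting hfn, hX.lintegral_expNeg_counting hf,
    hX.immigrants.lintegral_expNeg_congr (hX.immigrants.map_neg hvol)
      (measurable_clusterExponent hfn)]
  simp_rw [lintegral_map (measurable_clusterExponent hfn) measurable_neg,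
    clusterExponent_neg (map_neg_markLaw hφ) hf]

end Reversible

/-! ### The weights of the random sum -/

section Weights

/-- Exposes the Catalan numbers, whose convolution recursion makes the total mass computable. -/
lemma matchProb_succ (m : ℝ) (n : ℕ) :
    matchProb m (n + 1) = 2 * catalan n * (m * (2 - m) / 4) ^ (n + 1) / m := by
  have h1 : ((n + 1 : ℕ) : ℝ) * catalan n = n.centralBinom := by
    exact_mod_cast succ_mul_catalan_eq_centralBinom n
  have h2 : (n.centralBinom : ℝ) * (n.factorial * n.factorial) = (2 * n).factorial := by
    rw [Nat.centralBinom_eq_two_mul_choose]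
    have := Nat.choose_mul_factorial_mul_factorial (show n ≤ 2 * n by omega)
    rw [show 2 * n - n = n by omega, mul_assoc] at this
    exact_mod_cast this
  have h3 : ((n + 1).factorial : ℝ) = ((n + 1 : ℕ) : ℝ) * n.factorial := by
    exact_mod_cast Nat.factorial_succ n
  have hn : (n.factorial : ℝ) ≠ 0 := by exact_mod_cast n.factorial_ne_zero
  have hn1 : ((n + 1 : ℕ) : ℝ) ≠ 0 := by exact_mod_cast n.succ_ne_zero
  rw [matchProb, show 2 * (n + 1) - 2 = 2 * n by omega, show 2 * (n + 1) - 1 = 2 * n + 1 by omega,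
    show n + 1 - 1 = n by omega, ← h2, ← h1, h3, div_pow, pow_succ 2, pow_mul,
    show (2 : ℝ) ^ 2 = 4 by norm_num, pow_succ 4]
  field_simp
  ring

/-- At the radius of convergence the sums telescope and stay below one. This bound later selects the
right root of a quadratic equation. -/
lemma sum_catalan_div_four_pow (N : ℕ) :
    ∑ n ∈ Finset.range N, 2 * (catalan n : ℝ) * (1 / 4) ^ (n + 1)
      = 1 - N.centralBinom * (1 / 4) ^ N := by
  induction N with
  | zero => simp
  | succ N ih =>
    have h1 : ((N : ℝ) + 1) * catalan N = N.centralBinom := by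
      exact_mod_cast succ_mul_catalan_eq_centralBinom N
    have h2 : ((N : ℝ) + 1) * (N + 1).centralBinom = 2 * (2 * N + 1) * N.centralBinom := by
      exact_mod_cast Nat.succ_mul_centralBinom_succ N
    have h3 : (N : ℝ) + 1 ≠ 0 := by positivity
    have h4 : ((N + 1).centralBinom : ℝ) = 2 * (2 * N + 1) * catalan N := by
      apply mul_left_cancel₀ h3
      rw [h2, ← h1]
      ring
    rw [Finset.sum_range_succ, ih, h4, ← h1]
    ring

/-- The generating function of the Catalan numbers. -/
lemma hasSum_catalan {m : ℝ} (hm₀ : 0 < m) (hm₁ : m < 1) :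
    HasSum (fun n => 2 * (catalan n : ℝ) * (m * (2 - m) / 4) ^ (n + 1)) m := by
  set x := m * (2 - m) / 4 with hx
  set a : ℕ → ℝ := fun n => 2 * (catalan n : ℝ) * x ^ (n + 1) with ha
  have hx0 : 0 ≤ x := by
    rw [hx]
    have : 0 < 2 - m := by linarith
    positivity
  have hx1 : x ≤ 1 / 4 := by nlinarith [sq_nonneg (1 - m)]
  have ha0 : ∀ n, 0 ≤ a n := fun n => by positivity
  have hpart : ∀ N, ∑ n ∈ Finset.range N, a n ≤ 1 := by
    intro N
    refine (Finset.sum_le_sum fun n _ => mul_le_mul_of_nonneg_left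
      (pow_le_pow_left₀ hx0 hx1 (n + 1)) (by positivity)).trans ?_
    rw [sum_catalan_div_four_pow]
    have : (0 : ℝ) ≤ N.centralBinom * (1 / 4) ^ N := by positivity
    linarith
  have hsum : Summable a := summable_of_sum_range_le ha0 hpart
  have hS1 : ∑' n, a n ≤ 1 := hsum.tsum_le_of_sum_range_le hpart
  have hnorm : Summable fun n => ‖a n‖ := hsum.norm
  have hprod := tsum_mul_tsum_eq_tsum_sum_antidiagonal_of_summable_norm hnorm hnorm
  -- The Catalan recursion; for the sum `S` of the series it yields `S ^ 2 = 2 * (S - 2 * x)`.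
  have hconv : ∀ n, ∑ kl ∈ Finset.HasAntidiagonal.antidiagonal n, a kl.1 * a kl.2
      = 2 * a (n + 1) := by
    intro n
    simp only [ha, catalan_succ']
    push_cast
    rw [Finset.mul_sum, Finset.sum_mul, Finset.mul_sum]
    refine Finset.sum_congr rfl fun kl hkl => ?_
    rw [← Finset.HasAntidiagonal.mem_antidiagonal.1 hkl]
    ring
  simp_rw [hconv] at hprod
  rw [tsum_mul_left] at hprod
  have h0 := hsum.tsum_eq_zero_add
  have ha00 : a 0 = 2 * x := by simp [ha]
  have hS : ∑' n, a n = m := by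
    -- As `4 * x = m * (2 - m)`, the roots are `m` and `2 - m`; the second exceeds one and is
    -- excluded by `hS1`.
    have hq : (∑' n, a n - m) * (∑' n, a n - (2 - m)) = 0 := by
      rw [ha00] at h0
      nlinarith
    rcases mul_eq_zero.1 hq with h | h <;> linarith
  exact hS ▸ hsum.hasSum

lemma hasSum_matchProb {m : ℝ} (hm₀ : 0 < m) (hm₁ : m < 1) :
    HasSum (fun n => matchProb m (n + 1)) 1 := by
  simp_rw [matchProb_succ]
  simpa [div_self hm₀.ne'] using (hasSum_catalan hm₀ hm₁).div_const m

lemma matchProb_succ_nonneg {m : ℝ} (hm₀ : 0 < m) (hm₁ : m < 1) (n : ℕ) :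
    0 ≤ matchProb m (n + 1) := by
  rw [matchProb_succ]
  have : 0 < 2 - m := by linarith
  positivity

end Weights

/-! ### The law of the summands -/

section Rho
variable {h : ℝ → ℝ}

/-- The convolution of `h` with its reflection. -/
def selfCorrelation (h : ℝ → ℝ) (x : ℝ) : ℝ :=
  convolution h (fun y => h (-y)) (ContinuousLinearMap.mul ℝ ℝ) volume x

lemma selfCorrelation_apply (h : ℝ → ℝ) (x : ℝ) :
    selfCorrelation h x = ∫ t, h t * h (t - x) := by
  simp only [selfCorrelation, convolution_def, ContinuousLinearMap.mul_apply', neg_sub]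

lemma selfCorrelation_neg (h : ℝ → ℝ) (x : ℝ) : selfCorrelation h (-x) = selfCorrelation h x := by
  rw [selfCorrelation_apply, selfCorrelation_apply,
    ← integral_sub_right_eq_self (fun t => h t * h (t - -x)) x]
  refine integral_congr_ae (Eventually.of_forall fun t => ?_)
  simp only [sub_neg_eq_add, sub_add_cancel]
  ring

lemma rho_eq (m : ℝ) (h : ℝ → ℝ) (x : ℝ) : rho m h x
    = (h |x| - m * selfCorrelation h x) / (2 - m) :=
  rfl

lemma rho_neg (m : ℝ) (h : ℝ → ℝ) (x : ℝ) : rho m h (-x) = rho m h x := by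
  rw [rho_eq, rho_eq, abs_neg, selfCorrelation_neg]

namespace IsMonotoneKernel
variable (hh : IsMonotoneKernel h)
include hh

lemma integrable : Integrable h := by
  refine ⟨hh.measurable.aestronglyMeasurable, ?_⟩
  rw [hasFiniteIntegral_iff_ofReal (Eventually.of_forall hh.nonneg), hh.lintegral_eq_one]
  exact ENNReal.one_lt_top

lemma integral_eq_one : ∫ x, h x = 1 := by
  rw [integral_eq_lintegral_of_nonneg_ae (Eventually.of_forall hh.nonneg)
    hh.measurable.aestronglyMeasurable, hh.lintegral_eq_one, ENNReal.toReal_one]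

lemma integrable_selfCorrelation : Integrable (selfCorrelation h) :=
  hh.integrable.integrable_convolution (ContinuousLinearMap.mul ℝ ℝ) hh.integrable.comp_neg

lemma integral_selfCorrelation : ∫ x, selfCorrelation h x = 1 := by
  have h1 := integral_convolution (ContinuousLinearMap.mul ℝ ℝ) hh.integrable hh.integrable.comp_neg
  rw [integral_neg_eq_self, hh.integral_eq_one] at h1
  simpa [selfCorrelation] using h1

/-- The origin is excluded: `h 0` is unrestricted there and would be counted twice. -/
lemma comp_abs_ae_eq : (fun x => h |x|) =ᵐ[volume] fun x => h x + h (-x) := by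
  filter_upwards [Measure.ae_ne volume 0] with x hx
  rcases hx.lt_or_gt with h0 | h0
  · rw [abs_of_neg h0, hh.eq_zero_of_neg x h0, zero_add]
  · rw [abs_of_pos h0, hh.eq_zero_of_neg (-x) (by linarith), add_zero]

lemma integrable_rho (m : ℝ) : Integrable (rho m h) :=
  ((((hh.integrable.add hh.integrable.comp_neg).congr hh.comp_abs_ae_eq.symm).sub
    (hh.integrable_selfCorrelation.const_mul m)).div_const _)

lemma integral_rho {m : ℝ} (hm : m < 1) : ∫ x, rho m h x = 1 := by
  have h1 : ∫ x, h |x| = 2 := by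
    rw [integral_congr_ae hh.comp_abs_ae_eq, integral_add hh.integrable hh.integrable.comp_neg,
      integral_neg_eq_self, hh.integral_eq_one]
    norm_num
  have hi : Integrable fun x => h |x| :=
    (hh.integrable.add hh.integrable.comp_neg).congr hh.comp_abs_ae_eq.symm
  simp_rw [rho_eq]
  rw [integral_div, integral_sub hi (hh.integrable_selfCorrelation.const_mul m),
    integral_const_mul, hh.integral_selfCorrelation, h1, mul_one, div_self (by linarith)]

/-- In `∫ h(t) h(t - x) dt` the second factor vanishes for `t < x`, while `h(t) ≤ h(x)` for almost
every `t ≥ x` by monotonicity; the second factor has integral one. -/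
lemma selfCorrelation_le_of_pos : ∀ᵐ x, 0 < x → selfCorrelation h x ≤ h x := by
  obtain ⟨g, hg, hae⟩ := hh.exists_antitone
  have hae' : ∀ᵐ x, 0 < x → h x = g x := (ae_restrict_iff' measurableSet_Ioi).1 hae
  filter_upwards [hae'] with x hx hx0
  rw [selfCorrelation_apply]
  have h1 : ∫ t, h x * h (t - x) = h x := by
    rw [integral_const_mul, integral_sub_right_eq_self, hh.integral_eq_one, mul_one]
  rw [← h1]
  refine integral_mono_of_nonneg (Eventually.of_forall
      fun t => mul_nonneg (hh.nonneg _) (hh.nonneg _))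
    ((hh.integrable.comp_sub_right x).const_mul _) ?_
  filter_upwards [hae'] with t ht
  rcases lt_or_ge t x with htx | htx
  · simp [hh.eq_zero_of_neg (t - x) (by linarith)]
  · refine mul_le_mul_of_nonneg_right ?_ (hh.nonneg _)
    rw [hx hx0, ht (hx0.trans_le htx)]
    exact hg hx0 (hx0.trans_le htx) htx

lemma rho_nonneg {m : ℝ} (hm₀ : 0 ≤ m) (hm₁ : m ≤ 1) : ∀ᵐ x, 0 ≤ rho m h x := by
  have h1 := hh.selfCorrelation_le_of_pos
  have h2 : ∀ᵐ x : ℝ, 0 < -x → selfCorrelation h (-x) ≤ h (-x) :=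
    (Measure.measurePreserving_neg (volume : Measure ℝ)).quasiMeasurePreserving.ae h1
  filter_upwards [h1, h2, Measure.ae_ne volume 0] with x hx hx' hx0
  have h3 : selfCorrelation h x ≤ h |x| := by
    rcases hx0.lt_or_gt with h0 | h0
    · rw [abs_of_neg h0, ← selfCorrelation_neg]
      exact hx' (by linarith)
    · rw [abs_of_pos h0]
      exact hx h0
  have h4 := hh.nonneg |x|
  rw [rho_eq]
  refine div_nonneg ?_ (by linarith)
  nlinarith

lemma isProbabilityMeasure_rho {m : ℝ} (hm₀ : 0 ≤ m) (hm₁ : m < 1) :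
    IsProbabilityMeasure (volume.withDensity fun x => ENNReal.ofReal (rho m h x)) := by
  constructor
  rw [withDensity_apply _ MeasurableSet.univ, Measure.restrict_univ,
    ← ofReal_integral_eq_lintegral_ofReal (hh.integrable_rho m) (hh.rho_nonneg hm₀ hm₁.le),
    hh.integral_rho hm₁, ENNReal.ofReal_one]

end IsMonotoneKernel

end Rho

/-! ### Even densities of symmetric laws -/

/-- The Radon–Nikodym derivative of a symmetric law is even only almost everywhere; averaging it
with its reflection gives a version that is even at every point. -/
lemma exists_isEvenDensityOf {μ : Measure ℝ} [IsProbabilityMeasure μ] (hμ : μ ≪ volume)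
    (hneg : μ.map (fun x => -x) = μ) : ∃ φ : ℝ → ℝ, IsEvenDensityOf φ μ := by
  set d := μ.rnDeriv volume with hd
  have hdm : Measurable d := Measure.measurable_rnDeriv _ _
  have hdμ : volume.withDensity d = μ := Measure.withDensity_rnDeriv_eq _ _ hμ
  have hdn : (fun x => d (-x)) =ᵐ[volume] d := by
    have h1 := map_neg_withDensity d
    rw [hdμ, hneg, ← hdμ] at h1
    refine (withDensity_eq_iff hdm.aemeasurable (hdm.comp measurable_neg).aemeasurable
        ?_).1 h1 |>.symm
    exact (Measure.lintegral_rnDeriv_lt_top μ volume).ne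
  have hae : (fun x => ENNReal.ofReal (((d x).toReal + (d (-x)).toReal) / 2)) =ᵐ[volume] d := by
    filter_upwards [hdn, Measure.rnDeriv_lt_top μ volume] with x hx hlt
    rw [hx, add_self_div_two, ENNReal.ofReal_toReal hlt.ne]
  refine ⟨fun x => ((d x).toReal + (d (-x)).toReal) / 2, ?_, fun x => by positivity, ?_, ?_, ?_⟩
  · exact (hdm.ennreal_toReal.add (hdm.comp measurable_neg).ennreal_toReal).div_const 2
  · rw [lintegral_congr_ae hae, ← setLIntegral_univ, ← withDensity_apply _ MeasurableSet.univ, hdμ,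
      measure_univ]
  · intro x
    simp only [neg_neg]
    rw [add_comm]
  · rw [withDensity_congr_ae hae, hdμ]

section ConvPow
variable {μ : Measure ℝ} [IsProbabilityMeasure μ]

instance isProbabilityMeasure_convPow (n : ℕ) : IsProbabilityMeasure (convPow μ n) := by
  induction n with
  | zero => exact Measure.dirac.isProbabilityMeasure
  | succ n ih => exact Measure.probabilitymeasure_of_probabilitymeasures_conv _ _

lemma map_neg_convPow (hμ : μ.map (fun x => -x) = μ) (n : ℕ) :
    (convPow μ n).map (fun x => -x) = convPow μ n := by
  induction n with
  | zero => simp [convPow, Measure.map_dirac' measurable_neg]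
  | succ n ih =>
    have h := Measure.map_conv_addMonoidHom (μ := convPow μ n) (ν := μ)
      (negAddMonoidHom : ℝ →+ ℝ) measurable_neg
    have hc : (⇑(negAddMonoidHom : ℝ →+ ℝ)) = fun x => -x := rfl
    rw [hc, ih, hμ] at h
    exact h

lemma convPow_succ_absolutelyContinuous (hμ : μ ≪ volume) (n : ℕ) :
    convPow μ (n + 1) ≪ volume :=
  Measure.conv_absolutelyContinuous hμ

end ConvPow

theorem IsMonotoneKernel.exists_isEvenDensityOf_randomSumLaw {h : ℝ → ℝ} (hh : IsMonotoneKernel h)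
    {m : ℝ} (hm₀ : 0 < m) (hm₁ : m < 1) :
    ∃ φ : ℝ → ℝ, IsEvenDensityOf φ (randomSumLaw m h) := by
  have := hh.isProbabilityMeasure_rho hm₀.le hm₁
  have hneg : (volume.withDensity fun x => ENNReal.ofReal (rho m h x)).map (fun x => -x)
      = volume.withDensity fun x => ENNReal.ofReal (rho m h x) := by
    rw [map_neg_withDensity]
    simp only [rho_neg]
  have hp : IsProbabilityMeasure (randomSumLaw m h) := by
    constructor
    rw [randomSumLaw, Measure.sum_apply _ MeasurableSet.univ]
    simp only [Measure.smul_apply, measure_univ, smul_eq_mul, mul_one]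
    rw [← ENNReal.ofReal_tsum_of_nonneg (matchProb_succ_nonneg hm₀ hm₁)
      (hasSum_matchProb hm₀ hm₁).summable, (hasSum_matchProb hm₀ hm₁).tsum_eq, ENNReal.ofReal_one]
  refine exists_isEvenDensityOf ?_ ?_
  · exact Measure.absolutelyContinuous_sum_left fun n =>
      (convPow_succ_absolutelyContinuous (withDensity_absolutelyContinuous _ _) n).smul_left _
  · rw [randomSumLaw, Measure.map_sum measurable_neg.aemeasurable]
    simp only [Measure.map_smul, map_neg_convPow hneg]

end BranchingMatch

end

theorem mainTheorem10 (m ν : ℝ) (hm₀ : 0 < m) (hm₁ : m < 1) (hν : 0 < ν)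
    (h : ℝ → ℝ) (hh : BranchingMatch.IsMonotoneKernel h) :
    (∃ φ : ℝ → ℝ, BranchingMatch.IsEvenDensityOf φ (BranchingMatch.randomSumLaw m h)) ∧
    ∀ φ : ℝ → ℝ, BranchingMatch.IsEvenDensityOf φ (BranchingMatch.randomSumLaw m h) →
      ∀ (Ω : Type*) [MeasurableSpace Ω] (P : MeasureTheory.Measure Ω)
        [MeasureTheory.IsProbabilityMeasure P]
        (U : ℕ → Ω → ℝ) (K : ℕ × List ℕ → Ω → ℕ) (D : ℕ × List ℕ → Ω → ℝ),
        BranchingMatch.IsBranchingClusterProcess P ν m φ U K D →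
          BranchingMatch.IsReversible P (BranchingMatch.clusterPoints U K D).counting ∧
          ∃ c : ℝ × ℝ → ℝ,
            (BranchingMatch.clusterPoints U K D).HasThirdCumulantDensity P c ∧
            ∀ w₁ w₂ : ℝ, (BranchingMatch.bispectrum c w₁ w₂).im = 0 := by
  refine ⟨hh.exists_isEvenDensityOf_randomSumLaw hm₀ hm₁, fun φ hφ Ω _ P _ U K D hX =>
    ⟨hX.isReversible hφ, BranchingMatch.cumulantDensity ν m φ,
      hX.hasThirdCumulantDensity hν hm₁ hφ, BranchingMatch.bispectrum_cumulantDensity_im hm₁ hφ⟩⟩
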